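/- **Setting.** Let $p$ be a prime, $q$ a power of $p$, and let $\mathbf G$ be a connected reductive algebraic group defined and split over $\mathbb F_p$, with root system $\Phi$ and positive roots $\Phi^+$ (with respect to a split maximal torus and a Borel subgroup containing it). Assume that $p$ is not a very bad prime for $\mathbf G$: $p>2$ if $\Phi$ has a component of type $B_r$, $C_r$ ($r\ge 2$) or $F_4$, and $p>3$ if it has one of type $G_2$. Let $U$ be the group of $\mathbb F_q$-points of the unipotent radical of the Borel subgroup, with root subgroups $X_\alpha=\{x_\alpha(t): t\in\mathbb F_q\}$, $\alpha\in\Phi^+$. (The group $U$ with its root subgroups depends only on $\Phi^+$ and $q$; it is realised in the adjoint Chevalley group by $x_\alpha(t)=\exp(t\,\mathrm{ad}\,e_\alpha)$, where the $e_\alpha$ are the root vectors of a Chevalley basis.) A subset $\mathcal P\subseteq\Phi^+$ is *closed* if $\alpha+\alpha'\in\mathcal P$ whenever $\alpha,\alpha'\in\mathcal P$ and $\alpha+\alpha'\in\Phi^+$. For $\mathcal P$ closed, $\mathcal K\subseteq\mathcal P$ is *normal in* $\mathcal P$ if $\kappa+\alpha\in\mathcal K$ whenever $\kappa\in\mathcal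 K$, $\alpha\in\mathcal P$ and $\kappa+\alpha\in\Phi^+$. Then $\mathcal S=\mathcal P\setminus\mathcal K$ is called a *quattern*. Put $X_{\mathcal P}=\prod_{\alpha\in\mathcal P}X_\alpha$, a subgroup of $U$ in which $X_{\mathcal K}$ is normal, and $X_{\mathcal S}=X_{\mathcal P}/X_{\mathcal K}$. Put $\mathcal Z(\mathcal S)=\{\gamma\in\mathcal S:\gamma+\alpha\notin\mathcal S\text{ for all }\alpha\in\mathcal S\}$, and for $\mathcal Z\subseteq\mathcal Z(\mathcal S)$ let $\mathrm{Irr}(X_{\mathcal S})_{\mathcal Z}$ be the set of irreducible complex characters $\chi$ of $X_{\mathcal S}$ such that for every $\alpha\in\mathcal Z$ the image of $X_\alpha$ in $X_{\mathcal S}$ is not contained in $\ker\chi=\{g:\chi(g)=\chi(1)\}$. **Lemma 3.1.** Let $\mathcal S=\mathcal P\setminus\mathcal K$ be a quattern, let $\mathcal Z\subseteq\mathcal Z(\mathcal S)$ and $\gamma\in\mathcal Z$, and let $\beta,\delta\in\mathcal S$ with $\delta+\beta=\gamma$. Suppose that * $\alpha+\alpha'\neq\beta$ for all $\alpha,\alpha'\in\mathcal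 S\setminus\{\beta,\delta\}$, and * $\delta+\alpha\notin\mathcal S$ for all $\alpha\in\mathcal S\setminus\{\beta\}$. Let $\mathcal P'=\mathcal P\setminus\{\beta\}$, $\mathcal K'=\mathcal K\cup\{\delta\}$ and $\mathcal S'=\mathcal P'\setminus\mathcal K'$. Then $\mathcal P'$ is closed and $\mathcal K'$ is normal in $\mathcal P'$, so that $\mathcal S'=\mathcal S\setminus\{\beta,\delta\}$ is a quattern with $X_{\mathcal S'}=X_{\mathcal P'}/X_{\mathcal K'}$; moreover $\mathcal Z\subseteq\mathcal Z(\mathcal S')$, the subgroups $X_{\mathcal K}\trianglelefteq X_{\mathcal P}$, $X_{\mathcal K}\trianglelefteq X_{\mathcal P'}$ and $X_{\mathcal K'}\trianglelefteq X_{\mathcal P'}$ are normal, and $$\chi\longmapsto \mathrm{Ind}^{\beta}\,\mathrm{Inf}_{\delta}\,\chi$$ is a bijection from $\mathrm{Irr}(X_{\mathcal S'})_{\mathcal Z}$ to $\mathrm{Irr}(X_{\mathcal S})_{\mathcal Z}$, where $\mathrm{Inf}_\delta$ is inflation from $X_{\mathcal P'}/X_{\mathcal K'}$ to $X_{\mathcal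 P'}/X_{\mathcal K}$ and $\mathrm{Ind}^\beta$ is induction from $X_{\mathcal P'}/X_{\mathcal K}$ to $X_{\mathcal P}/X_{\mathcal K}$. -/

import Mathlib

noncomputable section

open scoped Nat

/-! ### Subquotients of a group -/

section Subquotients

variable {G : Type*} [Group G]

/-- The subquotient `A / B` of a group `G`, for subgroups `B ≤ A` with `B` normal in `A`. So that it
is a group without a proof of normality, the quotient is taken by the normal closure of `B` in `A`,
which is `B` itself when `B` is normal in `A`. -/
abbrev Subquotient (A B : Subgroup G) : Type _ :=
  A ⧸ Subgroup.normalClosure (B.subgroupOf A : Set A)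

lemma Subquotient.normalClosure_le_comap {A' A B' B : Subgroup G} (hA : A' ≤ A) (hB : B' ≤ B) :
    Subgroup.normalClosure (B'.subgroupOf A' : Set A') ≤
      (Subgroup.normalClosure (B.subgroupOf A : Set A)).comap (Subgroup.inclusion hA) := by
  apply Subgroup.normalClosure_le_normal
  intro u hu
  exact Subgroup.subset_normalClosure (hB hu)

/-- The natural homomorphism `A' / B' → A / B` for `A' ≤ A` and `B' ≤ B`. -/
def Subquotient.map {A' A B' B : Subgroup G} (hA : A' ≤ A) (hB : B' ≤ B) :
    Subquotient A' B' →* Subquotient A B :=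
  QuotientGroup.map _ _ (Subgroup.inclusion hA) (Subquotient.normalClosure_le_comap hA hB)

end Subquotients

/-! ### Finite Chevalley groups: root elements and root subgroups -/

section Chevalley

variable {ι X Y : Type*} [AddCommGroup X] [AddCommGroup Y]

/-- The prime `p` is not a very bad prime for the reduced root datum `Φ`: it exceeds every
`|⟨α, β^∨⟩|` with `α ≠ ±β`. For `α ≠ ±β` in one irreducible component this absolute value is at
most `1` in types `A`, `D`, `E`; it is at most `2`, and `2` occurs, exactly in types `B_r`, `C_r`
(`r ≥ 2`) and `F_4`; and `3` occurs exactly in type `G_2`. So this says `p > 2` if `Φ` has a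
component of type `B_r`, `C_r` or `F_4`, and `p > 3` if it has one of type `G_2`. -/
def NotVeryBad (Φ : RootDatum ι X Y) (p : ℕ) : Prop :=
  ∀ α β : ι, Φ.root α ≠ Φ.root β → Φ.root α ≠ -Φ.root β → |Φ.pairing α β| < (p : ℤ)

/-- A Chevalley basis, presented by its multiplication table: `L` is the Lie ring (the `ℤ`-form of
the semisimple Lie algebra with the root system of `Φ`) with `ℤ`-basis `h_i` (`i` a simple root,
`h_i` the simple coroot) and `e_α` (`α` a root), such that

* `[h_i, h_j] = 0` and `[h_i, e_α] = ⟨α, α_i^∨⟩ e_α`;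
* `[e_α, e_{-α}] = h_α`, where `h_α` is the same combination of the `h_i` as the coroot `α^∨` is
  of the simple coroots;
* `[e_α, e_β] = ±(r + 1) e_{α + β}` if `α + β` is a root, where `r` is the largest integer such
  that `β - r α` is a root;
* `[e_α, e_β] = 0` if `α + β` is neither a root nor zero. -/
structure ChevalleyBasis [Finite ι] (Φ : RootDatum ι X Y) (b : Φ.Base)
    (L : Type*) [LieRing L] where
  /-- The basis; `Sum.inl i` is the index of `h_i` and `Sum.inr α` that of `e_α`. -/
  basis : Module.Basis (b.support ⊕ ι) ℤ L
  lie_h_h : ∀ i j : b.support, ⁅basis (Sum.inl i), basis (Sum.inl j)⁆ = 0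
  lie_h_e : ∀ (i : b.support) (α : ι),
    ⁅basis (Sum.inl i), basis (Sum.inr α)⁆ = Φ.pairing α i • basis (Sum.inr α)
  lie_e_e_neg : ∀ (α β : ι) (c : b.support → ℤ), Φ.root β = -Φ.root α →
    Φ.coroot α = ∑ i, c i • Φ.coroot i →
    ⁅basis (Sum.inr α), basis (Sum.inr β)⁆ = ∑ i, c i • basis (Sum.inl i)
  lie_e_e_add : ∀ α β γ : ι, Φ.root γ = Φ.root α + Φ.root β →
    ⁅basis (Sum.inr α), basis (Sum.inr β)⁆
        = ((Φ.chainBotCoeff α β : ℤ) + 1) • basis (Sum.inr γ) ∨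
      ⁅basis (Sum.inr α), basis (Sum.inr β)⁆
        = -(((Φ.chainBotCoeff α β : ℤ) + 1) • basis (Sum.inr γ))
  lie_e_e_zero : ∀ α β : ι, Φ.root α + Φ.root β ∉ Set.range Φ.root →
    Φ.root α + Φ.root β ≠ 0 → ⁅basis (Sum.inr α), basis (Sum.inr β)⁆ = 0

variable [Fintype ι] [DecidableEq ι] {Φ : RootDatum ι X Y} {b : Φ.Base}
  {L : Type*} [LieRing L]

/-- The integer matrix of `(ad e_α)^k / k!` in the Chevalley basis. The division of integers is
exact, since these divided powers preserve the `ℤ`-span of a Chevalley basis. -/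
def ChevalleyBasis.divPow (C : ChevalleyBasis Φ b L) (α : ι) (k : ℕ) :
    Matrix (b.support ⊕ ι) (b.support ⊕ ι) ℤ :=
  ((LinearMap.toMatrix C.basis C.basis (LieAlgebra.ad ℤ L (C.basis (Sum.inr α)))) ^ k).map
    (fun z => z / (k ! : ℤ))

variable (F : Type*) [Field F]

/-- The root element `x_α(t) = exp(t ad e_α)` over the field `F`, as a matrix in the Chevalley
basis. The exponential series stops at `k = 3` because root strings have length at most four,
so that `(ad e_α)^4 = 0`. -/
def ChevalleyBasis.rootElt (C : ChevalleyBasis Φ b L) (α : ι) (t : F) :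
    Matrix (b.support ⊕ ι) (b.support ⊕ ι) F :=
  ∑ k ∈ Finset.range 4, t ^ k • (C.divPow α k).map (Int.cast : ℤ → F)

/-- The root subgroup `X_α = {x_α(t) | t ∈ F}` of the Chevalley group (of adjoint type) over `F`;
a priori, the group generated by these elements. -/
def ChevalleyBasis.rootSubgroup (C : ChevalleyBasis Φ b L) (α : ι) :
    Subgroup (GL (b.support ⊕ ι) F) :=
  Subgroup.closure {u | ∃ t : F, (u : Matrix (b.support ⊕ ι) (b.support ⊕ ι) F) = C.rootElt F α t}

/-- For a set `P` of roots, the subgroup `X_P` generated by the root subgroups `X_α`, `α ∈ P`. For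
`P` the set of all positive roots this is `U`; for a closed set `P` of positive roots this is the
pattern subgroup `X_P = ∏_{α ∈ P} X_α`. -/
def ChevalleyBasis.patternSubgroup (C : ChevalleyBasis Φ b L) (P : Set ι) :
    Subgroup (GL (b.support ⊕ ι) F) :=
  ⨆ α ∈ P, C.rootSubgroup F α

/-- The quattern group `X_S = X_P / X_K` for the quattern `S = P \ K`. -/
abbrev ChevalleyBasis.QuatternGroup (C : ChevalleyBasis Φ b L) (P K : Set ι) : Type _ :=
  Subquotient (C.patternSubgroup F P) (C.patternSubgroup F K)

lemma ChevalleyBasis.patternSubgroup_mono (C : ChevalleyBasis Φ b L) {P' P : Set ι} (hP : P' ⊆ P) :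
    C.patternSubgroup F P' ≤ C.patternSubgroup F P :=
  biSup_mono fun _ h => hP h

/-- The natural homomorphism `X_{P'} / X_{K'} → X_P / X_K` for `P' ⊆ P` and `K' ⊆ K`. For
`P' = P` it is the quotient map by `X_K / X_{K'}`; for `K' = K ⊆ P'` it is the inclusion. -/
def ChevalleyBasis.quatternMap (C : ChevalleyBasis Φ b L) {P' P K' K : Set ι} (hP : P' ⊆ P)
    (hK : K' ⊆ K) : C.QuatternGroup F P' K' →* C.QuatternGroup F P K :=
  Subquotient.map (C.patternSubgroup_mono F hP) (C.patternSubgroup_mono F hK)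

end Chevalley

/-! ### Closed sets of positive roots, normal subsets, quatterns -/

section Quatterns

variable {ι X Y : Type*} [AddCommGroup X] [AddCommGroup Y] {Φ : RootDatum ι X Y}

/-- `P` is a closed set of positive roots (a pattern). -/
def IsPattern (b : Φ.Base) (P : Set ι) : Prop :=
  (∀ α ∈ P, b.IsPos α) ∧
    ∀ α ∈ P, ∀ β ∈ P, ∀ ε : ι, Φ.root ε = Φ.root α + Φ.root β → ε ∈ P

/-- `K` is normal in `P`. -/
def IsNormalIn (Φ : RootDatum ι X Y) (K P : Set ι) : Prop :=
  K ⊆ P ∧ ∀ δ ∈ K, ∀ α ∈ P, ∀ ε : ι, Φ.root ε = Φ.root δ + Φ.root α → ε ∈ K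

/-- `𝒵(S)`: the `γ ∈ S` such that `γ + α ∉ S` for all `α ∈ S`. -/
def centralRoots (Φ : RootDatum ι X Y) (S : Set ι) : Set ι :=
  {γ | γ ∈ S ∧ ∀ α ∈ S, ∀ ε ∈ S, Φ.root ε ≠ Φ.root γ + Φ.root α}

end Quatterns

/-! ### Characters of finite groups -/

section Characters

/-- `Irr(G)`, the irreducible complex characters of the (finite) group `G`. -/
def Irr (G : Type*) [Group G] : Set (G → ℂ) :=
  {χ | ∃ (n : ℕ) (ρ : Representation ℂ G (Fin n → ℂ)), ρ.IsIrreducible ∧ χ = ρ.character}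

/-- The inflation of a class function along a quotient map `f : G → G/N`. -/
def inflate {G Q : Type*} [Group G] [Group Q] (f : G →* Q) (ψ : Q → ℂ) : G → ℂ :=
  fun g => ψ (f g)

/-- The induction of a class function `ψ` of the finite group `H`, seen as a subgroup of the finite
group `G` through the injective homomorphism `f`:
`(Ind ψ)(g) = |H|⁻¹ ∑_{x ∈ G, x⁻¹ g x ∈ H} ψ(x⁻¹ g x)`. -/
def induce {H G : Type*} [Group H] [Group G] (f : H →* G) (ψ : H → ℂ) : G → ℂ :=
  fun g => (Nat.card H : ℂ)⁻¹ * ∑ᶠ x : G, ∑ᶠ (h : H) (_ : f h = x⁻¹ * g * x), ψ h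

variable {ι X Y : Type*} [AddCommGroup X] [AddCommGroup Y] [Fintype ι] [DecidableEq ι]
  {Φ : RootDatum ι X Y} {b : Φ.Base} {L : Type*} [LieRing L] (F : Type*) [Field F]

/-- `Irr(X_S)_Z` for `S = P \ K`: the irreducible characters `χ` of `X_S` such that the image of
`X_α` in `X_S` is not contained in `ker χ = {g | χ(g) = χ(1)}`, for all `α ∈ Z`. -/
def ChevalleyBasis.IrrZ (C : ChevalleyBasis Φ b L) (P K Z : Set ι) :
    Set (C.QuatternGroup F P K → ℂ) :=
  {χ | χ ∈ Irr (C.QuatternGroup F P K) ∧ ∀ α ∈ Z, ∃ u : C.patternSubgroup F P,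
    (u : GL (b.support ⊕ ι) F) ∈ C.rootSubgroup F α ∧ χ (QuotientGroup.mk u) ≠ χ 1}

end Characters

end

noncomputable section

open scoped Nat Pointwise commutatorElement

/-! ### Irreducible complex representations and Schur's lemma -/

section Representations

open Representation

variable {G : Type*} [Group G]

/-! Write G = X_P/X_K, H = X_{P'}/X_K and Q = X_{P'}/X_{K'}. By the Chevalley commutator formula
[x_δ(s), x_β(t)] is a product of root elements for roots iδ + jβ with i, j ≥ 1. Apart from γ = δ + β
these roots arise from γ by adding δ or β repeatedly, so they lie in K because γ is central in S.
Hence [x_δ(s), x_β(t)] = x_γ(nst) in G, where n = ±(r + 1) and r + 1 < p because p is not very bad;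
so n is invertible. Moreover the leg X_δ is central in H with H/X_δ = Q, H is normal in G, and G is
the product of the arm X_β and H. This is a Heisenberg situation, abstracted as `ArmLeg`.

Let V be an irreducible representation of G that is nontrivial on X_γ. By Schur, X_γ acts through a
nontrivial additive character λ. The arm element with parameter t carries the leg invariants to the
eigenspace of the leg character s ↦ λ(st). As t varies these are all characters of F, each once, so
V is the direct sum of the arm translates of its leg invariants (`sum_arm_mul_proj_mul_arm`). Thus V
is induced from its leg invariants, a representation of Q (`character_eq_induce`), which is
irreducible (`legInvariants_isIrreducible`). Conversely, the leg invariants of the representation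
coinduced from σ are σ (`evalOne_injective`, `evalOne_surjective`). Averaging an induced character
over cosets of the leg recovers the character of Q (`sum_induce_inflate_mul_leg`). On central
elements induction only multiplies by |F|, so the conditions at the roots of Z are preserved.

The commutator formula itself is proved for the matrices exp(t ad e_α). Over ℤ, the commutator of
x_α(1) and x_β(1) is an automorphism of the Lie ring that differs from 1 by terms of weights iα +
jβ. Its component of lowest weight is a derivation, hence zero or an integral multiple of some ad
e_ε, and can be removed by a root element; iteration gives a product of root elements
(`mem_closure_rootEnd`). Conjugation by a diagonal matrix then replaces the parameters (1, 1) by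
arbitrary nonzero (s, t) in F (`exists_torus_character`). -/

lemma Representation.isIrreducible_iff_forall_invariant {V : Type*} [AddCommGroup V] [Module ℂ V]
    (ρ : Representation ℂ G V) :
    ρ.IsIrreducible ↔ Nontrivial V ∧
      ∀ p : Submodule ℂ V, (∀ g, ∀ v ∈ p, ρ g v ∈ p) → p = ⊥ ∨ p = ⊤ := by
  constructor
  · intro h
    refine ⟨?_, fun p hp => ?_⟩
    · by_contra hV
      rw [not_nontrivial_iff_subsingleton] at hV
      apply h.toNontrivial.exists_pair_ne.elim
      rintro a ⟨b, hab⟩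
      exact hab (Subrepresentation.toSubmodule_injective (Subsingleton.elim _ _))
    · rcases h.eq_bot_or_eq_top ⟨p, hp⟩ with h1 | h1
      · exact Or.inl (congrArg Subrepresentation.toSubmodule h1)
      · exact Or.inr (congrArg Subrepresentation.toSubmodule h1)
  · rintro ⟨hV, h⟩
    refine { exists_pair_ne := ⟨⊥, ⊤, fun h1 => ?_⟩, eq_bot_or_eq_top := fun a => ?_ }
    · exact bot_ne_top (α := Submodule ℂ V) (congrArg Subrepresentation.toSubmodule h1)
    · rcases h a.toSubmodule (fun g v hv => a.apply_mem_toSubmodule g hv) with h1 | h1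
      · exact Or.inl (Subrepresentation.toSubmodule_injective h1)
      · exact Or.inr (Subrepresentation.toSubmodule_injective h1)

lemma Representation.isIrreducible_of_linearEquiv {V W : Type*} [AddCommGroup V] [Module ℂ V]
    [AddCommGroup W] [Module ℂ W] {ρ : Representation ℂ G V} {σ : Representation ℂ G W}
    (e : V ≃ₗ[ℂ] W) (he : ∀ g v, e (ρ g v) = σ g (e v)) (h : ρ.IsIrreducible) :
    σ.IsIrreducible := by
  rw [isIrreducible_iff_forall_invariant] at h ⊢
  obtain ⟨hV, h⟩ := h
  refine ⟨e.symm.toEquiv.nontrivial, fun p hp => ?_⟩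
  rcases h (p.comap e.toLinearMap) (fun g v hv => by
    simpa [he] using hp g _ (by simpa using hv)) with h1 | h1
  · left
    rw [eq_bot_iff]
    intro w hw
    have : e.symm w ∈ p.comap e.toLinearMap := by simpa using hw
    rw [h1] at this
    simpa using this
  · right
    rw [eq_top_iff]
    intro w _
    have : e.symm w ∈ p.comap e.toLinearMap := by rw [h1]; trivial
    simpa using this

lemma Representation.character_eq_of_linearEquiv {V W : Type*} [AddCommGroup V] [Module ℂ V]
    [AddCommGroup W] [Module ℂ W] {ρ : Representation ℂ G V} {σ : Representation ℂ G W}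
    (e : V ≃ₗ[ℂ] W) (he : ∀ g v, e (ρ g v) = σ g (e v)) :
    ρ.character = σ.character := by
  ext g
  have : σ g = e.conj (ρ g) := by
    ext w
    simp [LinearEquiv.conj_apply, he]
  rw [Representation.character, Representation.character, this, LinearMap.trace_conj']

lemma Representation.character_mem_Irr {V : Type*} [AddCommGroup V] [Module ℂ V]
    [FiniteDimensional ℂ V] {ρ : Representation ℂ G V} (h : ρ.IsIrreducible) :
    ρ.character ∈ Irr G := by
  let e : V ≃ₗ[ℂ] (Fin (Module.finrank ℂ V) → ℂ) := (Module.finBasis ℂ V).equivFun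
  let σ : Representation ℂ G (Fin (Module.finrank ℂ V) → ℂ) :=
    { toFun := fun g => e.conj (ρ g)
      map_one' := by ext; simp
      map_mul' := fun x y => by ext; simp [LinearEquiv.conj_apply] }
  have he : ∀ g v, e (ρ g v) = σ g (e v) := fun g v => by
    simp [σ, LinearEquiv.conj_apply]
  exact ⟨_, σ, isIrreducible_of_linearEquiv e he h, character_eq_of_linearEquiv e he⟩

/-- Schur's lemma: an eigenspace of a central element is an invariant subspace. -/
lemma Representation.exists_eq_smul_one_of_central {V : Type*} [AddCommGroup V] [Module ℂ V]
    [FiniteDimensional ℂ V] {ρ : Representation ℂ G V} (h : ρ.IsIrreducible) {z : G}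
    (hz : ∀ g, z * g = g * z) : ∃ c : ℂ, ρ z = c • 1 := by
  rw [isIrreducible_iff_forall_invariant] at h
  obtain ⟨hV, h⟩ := h
  obtain ⟨c, hc⟩ := Module.End.exists_eigenvalue (ρ z)
  refine ⟨c, ?_⟩
  rcases h (Module.End.eigenspace (ρ z) c) (fun g v hv => by
    rw [Module.End.mem_eigenspace_iff] at hv ⊢
    rw [← Module.End.mul_apply, ← map_mul, hz, map_mul, Module.End.mul_apply, hv, map_smul])
    with h1 | h1
  · exact absurd h1 hc
  · ext v
    have : v ∈ Module.End.eigenspace (ρ z) c := by rw [h1]; trivial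
    simpa [Module.End.mem_eigenspace_iff] using this

end Representations

/-! ### Arms and legs: the Heisenberg argument for abstract groups -/

section ArmLeg

open Representation

/-- An arm and a leg: `H` is embedded by `f` as a normal subgroup of `G`, with quotient the
elementary abelian *arm* `F`, and `π : H → Q` is the quotient by the central *leg* `F`; the
commutator of arm and leg is the multiplication of `F`, with values in a subgroup of the centre
of `G`. -/
structure ArmLeg (F : Type*) [Field F] {G H Q : Type*} [Group G] [Group H] [Group Q]
    (f : H →* G) (π : H →* Q) where
  injective : Function.Injective f
  surjective : Function.Surjective π
  leg : F → H
  center : F → H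
  arm : F → G
  leg_add : ∀ s t, leg (s + t) = leg s * leg t
  center_add : ∀ s t, center (s + t) = center s * center t
  arm_add : ∀ s t, arm (s + t) = arm s * arm t
  map_eq_one : ∀ h, π h = 1 ↔ ∃ s, leg s = h
  leg_central : ∀ s h, leg s * h = h * leg s
  center_central : ∀ s g, f (center s) * g = g * f (center s)
  leg_mul_arm : ∀ s t, f (leg s) * arm t = arm t * (f (leg s) * f (center (s * t)))
  normal : ∀ h g, ∃ h', f h * g = g * f h'
  exists_eq_mul : ∀ g, ∃ t h, g = arm t * f h

namespace ArmLeg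

variable {F G H Q : Type*} [Field F] [Group G] [Group H] [Group Q] {f : H →* G} {π : H →* Q}
  (D : ArmLeg F f π)

include D

lemma leg_zero : D.leg 0 = 1 := by
  have := D.leg_add 0 0
  simpa using this

lemma arm_zero : D.arm 0 = 1 := by
  have := D.arm_add 0 0
  simpa using this

lemma center_zero : D.center 0 = 1 := by
  have := D.center_add 0 0
  simpa using this

lemma arm_neg (t : F) : D.arm (-t) = (D.arm t)⁻¹ := by
  rw [eq_inv_iff_mul_eq_one, ← D.arm_add, neg_add_cancel, D.arm_zero]

lemma map_leg (s : F) : π (D.leg s) = 1 := (D.map_eq_one _).2 ⟨s, rfl⟩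

lemma exists_eq_mul_leg {h h' : H} (hh : π h = π h') : ∃ s, h = h' * D.leg s := by
  obtain ⟨s, hs⟩ := (D.map_eq_one (h'⁻¹ * h)).1 (by rw [map_mul, map_inv, hh, inv_mul_cancel])
  exact ⟨s, by rw [hs, mul_inv_cancel_left]⟩

section Representation

variable [Fintype F] {V : Type*} [AddCommGroup V] [Module ℂ V] (ρ : Representation ℂ G V)

/-- The projection to the invariants of the leg. -/
def proj : Module.End ℂ V := (Fintype.card F : ℂ)⁻¹ • ∑ s, ρ (f (D.leg s))

lemma leg_mul_proj (s : F) : ρ (f (D.leg s)) * D.proj ρ = D.proj ρ := by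
  rw [proj, mul_smul_comm, Finset.mul_sum]
  congr 1
  simp_rw [← map_mul, ← D.leg_add]
  exact Fintype.sum_equiv (Equiv.addLeft s) _ _ fun _ => rfl

lemma proj_apply_of_forall {v : V} (hv : ∀ s, ρ (f (D.leg s)) v = v) : D.proj ρ v = v := by
  have hq : (Fintype.card F : ℂ) ≠ 0 := by simp
  simp only [proj, LinearMap.smul_apply, LinearMap.sum_apply, hv, Finset.sum_const,
    Finset.card_univ, ← Nat.cast_smul_eq_nsmul ℂ, smul_smul, inv_mul_cancel₀ hq, one_smul]

lemma proj_mul_proj : D.proj ρ * D.proj ρ = D.proj ρ := by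
  ext v
  apply D.proj_apply_of_forall
  intro s
  rw [← Module.End.mul_apply, D.leg_mul_proj]

lemma map_mul_proj (h : H) : ρ (f h) * D.proj ρ = D.proj ρ * ρ (f h) := by
  rw [proj, mul_smul_comm, smul_mul_assoc, Finset.mul_sum, Finset.sum_mul]
  simp_rw [← map_mul, D.leg_central]

lemma mem_range_proj_iff {v : V} : v ∈ LinearMap.range (D.proj ρ) ↔ D.proj ρ v = v := by
  constructor
  · rintro ⟨w, rfl⟩
    rw [← Module.End.mul_apply, D.proj_mul_proj]
  · exact fun h => ⟨v, h⟩

lemma map_leg_apply_of_mem {v : V} (hv : v ∈ LinearMap.range (D.proj ρ)) (s : F) :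
    ρ (f (D.leg s)) v = v := by
  rw [mem_range_proj_iff] at hv
  rw [← hv, ← Module.End.mul_apply, D.leg_mul_proj]

lemma map_apply_mem {v : V} (hv : v ∈ LinearMap.range (D.proj ρ)) (h : H) :
    ρ (f h) v ∈ LinearMap.range (D.proj ρ) := by
  rw [mem_range_proj_iff] at hv ⊢
  rw [← Module.End.mul_apply, ← D.map_mul_proj, Module.End.mul_apply, hv]

lemma map_apply_eq_of_map_eq {v : V} (hv : v ∈ LinearMap.range (D.proj ρ)) {h h' : H}
    (hh : π h = π h') : ρ (f h) v = ρ (f h') v := by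
  obtain ⟨s, rfl⟩ := D.exists_eq_mul_leg hh
  rw [map_mul, map_mul, Module.End.mul_apply, D.map_leg_apply_of_mem ρ hv]

/-- The representation of `Q` on the invariants of the leg. -/
def legInvariants : Representation ℂ Q (LinearMap.range (D.proj ρ)) where
  toFun x := (ρ (f (Function.surjInv D.surjective x))).restrict fun _ hv => D.map_apply_mem ρ hv _
  map_one' := by
    ext ⟨v, hv⟩
    have := D.map_apply_eq_of_map_eq ρ hv (h := Function.surjInv D.surjective 1) (h' := 1)
      (by rw [Function.surjInv_eq D.surjective, map_one])
    simpa using this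
  map_mul' x y := by
    ext ⟨v, hv⟩
    have := D.map_apply_eq_of_map_eq ρ hv (h := Function.surjInv D.surjective (x * y))
      (h' := Function.surjInv D.surjective x * Function.surjInv D.surjective y)
      (by simp [Function.surjInv_eq])
    simpa using this

lemma legInvariants_apply (h : H) (v : LinearMap.range (D.proj ρ)) :
    (D.legInvariants ρ (π h) v : V) = ρ (f h) v :=
  D.map_apply_eq_of_map_eq ρ v.2 (Function.surjInv_eq _ _)

lemma trace_map_mul_proj [FiniteDimensional ℂ V] (h : H) :
    LinearMap.trace ℂ V (ρ (f h) * D.proj ρ) = (D.legInvariants ρ).character (π h) := by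
  have h1 : ∀ v, (ρ (f h) * D.proj ρ) v ∈ LinearMap.range (D.proj ρ) := fun v =>
    D.map_apply_mem ρ ⟨v, rfl⟩ h
  rw [← LinearMap.trace_restrict_eq_of_forall_mem _ _ h1, Representation.character]
  congr 1
  ext v
  rw [D.legInvariants_apply, LinearMap.coe_restrict_apply, Module.End.mul_apply,
    (D.mem_range_proj_iff ρ).1 v.2]

variable {ρ} {lam : AddChar F ℂ} (hlam : ∀ u, ρ (f (D.center u)) = lam u • 1)

include hlam

lemma leg_mul_arm_mul_proj (s t : F) :
    ρ (f (D.leg s)) * ρ (D.arm t) * D.proj ρ = lam (s * t) • (ρ (D.arm t) * D.proj ρ) := by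
  rw [← map_mul, D.leg_mul_arm, map_mul, map_mul, hlam, mul_smul_comm, mul_smul_comm,
    smul_mul_assoc, mul_one, mul_assoc, D.leg_mul_proj]

variable (hlam1 : lam ≠ 1)

include hlam1

/-- The arm moves the invariants to the eigenspace of the leg character s ↦ λ(st), which is
nontrivial and so has mean zero. -/
lemma proj_mul_arm_mul_proj {t : F} (ht : t ≠ 0) : D.proj ρ * ρ (D.arm t) * D.proj ρ = 0 := by
  classical
  conv_lhs => enter [1, 1]; rw [proj]
  rw [smul_mul_assoc, smul_mul_assoc, Finset.sum_mul, Finset.sum_mul]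
  simp_rw [D.leg_mul_arm_mul_proj hlam, ← Finset.sum_smul,
    AddChar.sum_mulShift t (AddChar.IsPrimitive.of_ne_one hlam1), if_neg ht]
  simp

/-- The summands are the projections to the eigenspaces of the leg for the characters s ↦ λ(ts).
Since λ is primitive, these are all the characters of F. -/
lemma sum_arm_mul_proj_mul_arm : ∑ t, ρ (D.arm t) * D.proj ρ * ρ (D.arm (-t)) = 1 := by
  classical
  have key : ∀ t, ρ (D.arm t) * D.proj ρ * ρ (D.arm (-t)) =
      (Fintype.card F : ℂ)⁻¹ • ∑ s, lam (t * -s) • ρ (f (D.leg s)) := by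
    intro t
    rw [proj, mul_smul_comm, smul_mul_assoc, Finset.mul_sum, Finset.sum_mul]
    congr 1
    refine Finset.sum_congr rfl fun s _ => ?_
    rw [mul_assoc, ← map_mul ρ (f _), D.leg_mul_arm, map_mul, map_mul, hlam, ← mul_assoc,
      ← map_mul, ← D.arm_add, add_neg_cancel, D.arm_zero, map_one, one_mul, mul_smul_comm,
      mul_one, mul_neg, mul_neg, mul_comm s t]
  simp_rw [key, ← Finset.smul_sum]
  rw [Finset.sum_comm]
  simp_rw [← Finset.sum_smul, AddChar.sum_mulShift _ (AddChar.IsPrimitive.of_ne_one hlam1)]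
  rw [Finset.sum_eq_single 0]
  · simp [D.leg_zero]
  · intro s _ hs
    simp [hs]
  · simp

/-- That the arm meets H trivially is not part of `ArmLeg`; the nontrivial central character forces
it. An element of H commutes with the projection, whereas an arm element vanishes between two copies
of it. -/
lemma arm_notMem_range [Nontrivial V] {t : F} (ht : t ≠ 0) (h : H) : f h ≠ D.arm t := by
  intro hh
  have h0 : D.proj ρ = 0 := by
    have := D.proj_mul_arm_mul_proj hlam hlam1 ht
    rw [← hh, ← D.map_mul_proj, mul_assoc, D.proj_mul_proj] at this
    rw [← one_mul (D.proj ρ), ← map_one ρ, ← inv_mul_cancel (f h), map_mul, mul_assoc, this,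
      mul_zero]
  have := D.sum_arm_mul_proj_mul_arm hlam hlam1
  simp [h0] at this

/-- Cyclicity of the trace puts the arm element between two copies of the projection. -/
lemma trace_arm_mul_map_mul_proj {t : F} (ht : t ≠ 0) (h : H) :
    LinearMap.trace ℂ V (ρ (D.arm t * f h) * D.proj ρ) = 0 := by
  rw [← D.proj_mul_proj, ← mul_assoc, LinearMap.trace_mul_comm, map_mul ρ,
    mul_assoc _ _ (D.proj ρ), D.map_mul_proj, ← mul_assoc, ← mul_assoc,
    D.proj_mul_arm_mul_proj hlam hlam1 ht, zero_mul, map_zero]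

lemma character_eq_sum (g : G) :
    ρ.character g = ∑ t, LinearMap.trace ℂ V (ρ ((D.arm t)⁻¹ * g * D.arm t) * D.proj ρ) := by
  rw [Representation.character, ← mul_one (ρ g), ← D.sum_arm_mul_proj_mul_arm hlam hlam1,
    Finset.mul_sum, map_sum]
  refine Finset.sum_congr rfl fun t _ => ?_
  rw [← mul_assoc, LinearMap.trace_mul_comm, D.arm_neg, map_mul ρ, map_mul ρ]
  simp only [mul_assoc]

/-- A subspace invariant under `G` is determined by its invariants under the leg. -/
lemma le_of_forall_proj_mem {p p' : Submodule ℂ V} (hp : ∀ g, ∀ v ∈ p, ρ g v ∈ p)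
    (hp' : ∀ g, ∀ v ∈ p', ρ g v ∈ p') (h : ∀ v ∈ p, D.proj ρ v ∈ p') : p ≤ p' := by
  intro v hv
  have := congrArg (fun T : Module.End ℂ V => T v) (D.sum_arm_mul_proj_mul_arm hlam hlam1)
  simp only [LinearMap.sum_apply, Module.End.mul_apply, Module.End.one_apply] at this
  rw [← this]
  exact Submodule.sum_mem _ fun t _ => hp' _ _ (h _ (hp _ _ hv))

omit hlam hlam1 in
lemma proj_mem {p : Submodule ℂ V} (hp : ∀ g, ∀ v ∈ p, ρ g v ∈ p) {v : V} (hv : v ∈ p) :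
    D.proj ρ v ∈ p := by
  rw [proj, LinearMap.smul_apply, LinearMap.sum_apply]
  exact Submodule.smul_mem _ _ (Submodule.sum_mem _ fun s _ => hp _ _ hv)

lemma isIrreducible_of_legInvariants (h : (D.legInvariants ρ).IsIrreducible) :
    ρ.IsIrreducible := by
  rw [isIrreducible_iff_forall_invariant] at h ⊢
  obtain ⟨hV, h⟩ := h
  refine ⟨(Submodule.subtype_injective (LinearMap.range (D.proj ρ))).nontrivial, fun p hp => ?_⟩
  rcases h (p.comap (Submodule.subtype _)) (fun x v hv => by
    obtain ⟨y, rfl⟩ := D.surjective x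
    simp only [Submodule.mem_comap, Submodule.subtype_apply] at hv ⊢
    rw [D.legInvariants_apply]
    exact hp _ _ hv) with h1 | h1
  · left
    rw [← le_bot_iff]
    refine D.le_of_forall_proj_mem hlam hlam1 hp (by simp) fun v hv => ?_
    have : (⟨D.proj ρ v, v, rfl⟩ : LinearMap.range (D.proj ρ)) ∈ p.comap (Submodule.subtype _) :=
      D.proj_mem hp hv
    rw [h1] at this
    exact congrArg Subtype.val ((Submodule.mem_bot ℂ).1 this)
  · right
    rw [← top_le_iff]
    refine D.le_of_forall_proj_mem hlam hlam1 (by simp) hp fun v _ => ?_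
    have : (⟨D.proj ρ v, v, rfl⟩ : LinearMap.range (D.proj ρ)) ∈ p.comap (Submodule.subtype _) := by
      rw [h1]; trivial
    exact this

lemma legInvariants_isIrreducible (h : ρ.IsIrreducible) : (D.legInvariants ρ).IsIrreducible := by
  classical
  rw [isIrreducible_iff_forall_invariant] at h ⊢
  obtain ⟨hV, h⟩ := h
  constructor
  · by_contra hn
    rw [not_nontrivial_iff_subsingleton] at hn
    have h0 : D.proj ρ = 0 := LinearMap.ext fun v => congrArg Subtype.val
      (Subsingleton.elim (⟨D.proj ρ v, v, rfl⟩ : LinearMap.range (D.proj ρ)) 0)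
    have := D.sum_arm_mul_proj_mul_arm hlam hlam1
    simp [h0] at this
  intro p hp
  rw [or_iff_not_imp_left]
  intro hne
  let p' : Submodule ℂ V := p.map (Submodule.subtype _)
  have hp' : ∀ w ∈ p', w ∈ LinearMap.range (D.proj ρ) := by
    rintro _ ⟨w, _, rfl⟩
    exact w.2
  have hf : ∀ x, ∀ w ∈ p', ρ (f x) w ∈ p' := by
    rintro x _ ⟨w, hw, rfl⟩
    exact ⟨_, hp (π x) w hw, D.legInvariants_apply ρ x w⟩
  -- This is the G-submodule generated by p'. The projection sends it back into p', since it kills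
  -- the translates with t ≠ 0; so if it is all of V, then p is everything.
  let P : Submodule ℂ V := ⨆ t, p'.map (ρ (D.arm t))
  have hP : ∀ g, ∀ v ∈ P, ρ g v ∈ P := by
    intro g v hv
    suffices P ≤ P.comap (ρ g) from this hv
    refine iSup_le fun t => ?_
    rintro _ ⟨w, hw, rfl⟩
    obtain ⟨u, x, hx⟩ := D.exists_eq_mul (g * D.arm t)
    rw [Submodule.mem_comap, ← Module.End.mul_apply, ← map_mul, hx, map_mul]
    exact Submodule.mem_iSup_of_mem u ⟨_, hf x w hw, rfl⟩
  have hle : P ≤ p'.comap (D.proj ρ) := by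
    refine iSup_le fun t => ?_
    rintro _ ⟨w, hw, rfl⟩
    rw [Submodule.mem_comap, ← (D.mem_range_proj_iff ρ).1 (hp' w hw), ← Module.End.mul_apply,
      ← Module.End.mul_apply]
    by_cases ht : t = 0
    · rw [ht, D.arm_zero, map_one, mul_one, D.proj_mul_proj,
        (D.mem_range_proj_iff ρ).1 (hp' w hw)]
      exact hw
    · rw [D.proj_mul_arm_mul_proj hlam hlam1 ht]
      exact zero_mem _
  have hPp : p' ≤ P := by
    refine le_trans ?_ (le_iSup _ (0 : F))
    rintro w hw
    exact ⟨w, hw, by rw [D.arm_zero, map_one, Module.End.one_apply]⟩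
  rcases h P hP with h1 | h1
  · exfalso
    apply hne
    rw [h1, le_bot_iff] at hPp
    exact Submodule.map_injective_of_injective (Submodule.injective_subtype _)
      (hPp.trans (Submodule.map_bot _).symm)
  · rw [eq_top_iff]
    rintro ⟨v, hv⟩ _
    have h2 : v ∈ P := by rw [h1]; trivial
    have h3 := hle h2
    rw [Submodule.mem_comap, (D.mem_range_proj_iff ρ).1 hv] at h3
    obtain ⟨w, hw, hwv⟩ := h3
    rwa [show (⟨v, hv⟩ : LinearMap.range (D.proj ρ)) = w from Subtype.ext hwv.symm]

end Representation


/-- The extension by zero of a function along `f`. -/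
def extendZero {M : Type*} [AddCommMonoid M] (_D : ArmLeg F f π) (χ : H → M) (g : G) : M :=
  ∑ᶠ (h : H) (_ : f h = g), χ h

lemma extendZero_map {M : Type*} [AddCommMonoid M] (χ : H → M) (h : H) :
    D.extendZero χ (f h) = χ h := by
  rw [extendZero, finsum_eq_single _ h]
  · simp
  · intro h' hh'
    simp [D.injective.eq_iff, hh']

lemma extendZero_of_forall_ne {M : Type*} [AddCommMonoid M] (χ : H → M) {g : G}
    (hg : ∀ h, f h ≠ g) : D.extendZero χ g = 0 := by
  rw [extendZero, finsum_eq_zero_of_forall_eq_zero]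
  intro h
  simp [hg h]

lemma extendZero_conj {M : Type*} [AddCommMonoid M] {χ : H → M}
    (hχ : ∀ x h, χ (h⁻¹ * x * h) = χ x) (g : G) (h : H) :
    D.extendZero χ ((f h)⁻¹ * g * f h) = D.extendZero χ g := by
  by_cases hg : ∃ x, f x = g
  · obtain ⟨x, rfl⟩ := hg
    rw [← map_inv, ← map_mul, ← map_mul, D.extendZero_map, D.extendZero_map, hχ]
  · push Not at hg
    rw [D.extendZero_of_forall_ne _ hg, D.extendZero_of_forall_ne]
    intro x hx
    apply hg (h * x * h⁻¹)
    rw [map_mul, map_mul, hx, map_inv]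
    group

/-- The arm is a transversal of H in G. On each coset the summand is constant because χ is a class
function, which cancels the factor |H|⁻¹. -/
lemma induce_apply [Fintype F] [Finite H] {χ : H → ℂ} (hχ : ∀ x h, χ (h⁻¹ * x * h) = χ x)
    (harm : ∀ t, t ≠ 0 → ∀ h, f h ≠ D.arm t) (g : G) :
    induce f χ g = ∑ t, D.extendZero χ ((D.arm t)⁻¹ * g * D.arm t) := by
  have hbij : Function.Bijective fun x : F × H => D.arm x.1 * f x.2 := by
    constructor
    · rintro ⟨t, h⟩ ⟨t', h'⟩ hh
      have h1 : f (h * h'⁻¹) = D.arm (-t + t') := by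
        rw [D.arm_add, D.arm_neg, map_mul, map_inv, eq_inv_mul_iff_mul_eq, ← mul_assoc,
          mul_inv_eq_iff_eq_mul]
        exact hh
      have h2 : -t + t' = 0 := by
        by_contra h2
        exact harm _ h2 _ h1
      rw [h2, D.arm_zero, ← map_one f] at h1
      exact Prod.ext (neg_add_eq_zero.1 h2) (mul_inv_eq_one.1 (D.injective h1))
    · intro g
      obtain ⟨t, h, rfl⟩ := D.exists_eq_mul g
      exact ⟨(t, h), rfl⟩
  have := Fintype.ofFinite H
  have hq : (Nat.card H : ℂ) ≠ 0 := by simp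
  rw [induce, ← finsum_eq_of_bijective (f := fun x : F × H =>
    D.extendZero χ ((D.arm x.1)⁻¹ * g * D.arm x.1)) _ hbij, finsum_eq_sum_of_fintype,
    Fintype.sum_prod_type]
  · simp only [Finset.sum_const, Finset.card_univ, nsmul_eq_mul, ← Nat.card_eq_fintype_card]
    rw [← Finset.mul_sum, inv_mul_cancel_left₀ hq]
  · rintro ⟨t, h⟩
    dsimp only
    rw [← D.extendZero_conj hχ _ h, mul_inv_rev]
    simp only [mul_assoc, extendZero]

omit [Field F] [Group G] D in
lemma isConjInvariant_inflate_character {W : Type*} [AddCommGroup W] [Module ℂ W]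
    (σ : Representation ℂ Q W) (x h : H) :
    inflate π σ.character (h⁻¹ * x * h) = inflate π σ.character x := by
  have := σ.char_conj (π x) (π h)⁻¹
  rw [inv_inv] at this
  rw [inflate, inflate, map_mul, map_mul, map_inv, this]

lemma center_comm (s : F) (h : H) : D.center s * h = h * D.center s :=
  D.injective (by rw [map_mul, map_mul, D.center_central])

/-- The homomorphism θ is left free so that the central character is available both on G (θ = f) and
on Q (θ = π). -/
lemma exists_addChar {V : Type*} [AddCommGroup V] [Module ℂ V] [FiniteDimensional ℂ V]
    {K : Type*} [Group K] {ρ : Representation ℂ K V} (hρ : ρ.IsIrreducible) {θ : H →* K}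
    (hc : ∀ s k, θ (D.center s) * k = k * θ (D.center s)) :
    ∃ lam : AddChar F ℂ, ∀ u, ρ (θ (D.center u)) = lam u • 1 := by
  have hV := ((isIrreducible_iff_forall_invariant ρ).1 hρ).1
  choose c hc using fun s => exists_eq_smul_one_of_central hρ (hc s)
  have hinj : ∀ a b : ℂ, a • (1 : Module.End ℂ V) = b • 1 → a = b := fun a b h =>
    smul_left_injective ℂ one_ne_zero h
  refine ⟨⟨c, ?_, fun s t => ?_⟩, hc⟩
  · apply hinj
    rw [← hc, D.center_zero, map_one, map_one, one_smul]
  · apply hinj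
    rw [← hc, D.center_add, map_mul, map_mul, hc, hc, smul_mul_smul_comm, one_mul]

omit D in
lemma addChar_ne_one {V : Type*} [AddCommGroup V] [Module ℂ V] {K : Type*} [Group K]
    {ρ : Representation ℂ K V} {k : F → K} {lam : AddChar F ℂ}
    (hlam : ∀ u, ρ (k u) = lam u • 1) {u : F} (hu : ρ.character (k u) ≠ ρ.character 1) :
    lam ≠ 1 := by
  rintro rfl
  apply hu
  rw [Representation.character, Representation.character, hlam, map_one]
  simp

lemma arm_notMem_range_of_irreducible {W : Type*} [AddCommGroup W] [Module ℂ W] [Nontrivial W]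
    {σ : Representation ℂ Q W} {lam : AddChar F ℂ}
    (hlam : ∀ u, σ (π (D.center u)) = lam u • 1) (hlam1 : lam ≠ 1) (t : F) (ht : t ≠ 0) (h : H) :
    f h ≠ D.arm t := by
  intro hh
  obtain ⟨s, hs⟩ := AddChar.ne_one_iff.1 hlam1
  -- With this leg parameter the commutator with the arm is `center s`. It is trivial, since the leg
  -- commutes with H, although λ(s) ≠ 1.
  have h1 := D.leg_mul_arm (s * t⁻¹) t
  rw [← hh, ← map_mul, D.leg_central, map_mul, mul_right_inj, left_eq_mul, ← map_one f,
    inv_mul_cancel_right₀ ht] at h1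
  have h2 := hlam s
  rw [D.injective h1, map_one, map_one] at h2
  apply hs
  apply smul_left_injective ℂ (one_ne_zero (α := Module.End ℂ W))
  simp only [one_smul, ← h2]

/-! ### Induced characters of groups with an arm and a leg -/

section Induction

variable [Fintype F] [Finite H]

/-- Both sides are sums over the arm that agree term by term: a conjugate in H contributes the
character of the leg invariants, and one outside H contributes zero on either side. -/
lemma character_eq_induce {V : Type*} [AddCommGroup V] [Module ℂ V] [FiniteDimensional ℂ V]
    [Nontrivial V] {ρ : Representation ℂ G V} {lam : AddChar F ℂ}
    (hlam : ∀ u, ρ (f (D.center u)) = lam u • 1) (hlam1 : lam ≠ 1) :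
    ρ.character = induce f (inflate π (D.legInvariants ρ).character) := by
  have harm := fun t (ht : t ≠ 0) h => D.arm_notMem_range hlam hlam1 ht h
  ext g
  rw [D.character_eq_sum hlam hlam1, D.induce_apply (isConjInvariant_inflate_character _) harm]
  refine Finset.sum_congr rfl fun t _ => ?_
  obtain ⟨u, h, hh⟩ := D.exists_eq_mul ((D.arm t)⁻¹ * g * D.arm t)
  rw [hh]
  by_cases hu : u = 0
  · rw [hu, D.arm_zero, one_mul, D.extendZero_map, D.trace_map_mul_proj, inflate]
  · rw [D.trace_arm_mul_map_mul_proj hlam hlam1 hu, D.extendZero_of_forall_ne]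
    intro x hx
    apply harm u hu (x * h⁻¹)
    rw [map_mul, hx, map_inv, mul_inv_cancel_right]

lemma induce_inflate_apply_of_central {W : Type*} [AddCommGroup W] [Module ℂ W] [Nontrivial W]
    {σ : Representation ℂ Q W} {lam : AddChar F ℂ}
    (hlam : ∀ u, σ (π (D.center u)) = lam u • 1) (hlam1 : lam ≠ 1) {h : H}
    (hh : ∀ g, f h * g = g * f h) :
    induce f (inflate π σ.character) (f h) = Fintype.card F * σ.character (π h) := by
  rw [D.induce_apply (isConjInvariant_inflate_character _)
    (D.arm_notMem_range_of_irreducible hlam hlam1)]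
  simp_rw [mul_assoc, hh, inv_mul_cancel_left, D.extendZero_map, inflate]
  simp

/-- This inverts the induction and yields injectivity. In the induced character the term of the arm
parameter t picks up the factor λ(st), whose sum over s vanishes unless t = 0. -/
lemma sum_induce_inflate_mul_leg {W : Type*} [AddCommGroup W] [Module ℂ W] [Nontrivial W]
    {σ : Representation ℂ Q W} {lam : AddChar F ℂ}
    (hlam : ∀ u, σ (π (D.center u)) = lam u • 1) (hlam1 : lam ≠ 1) (h : H) :
    ∑ s, induce f (inflate π σ.character) (f (h * D.leg s)) =
      Fintype.card F * σ.character (π h) := by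
  classical
  simp_rw [D.induce_apply (isConjInvariant_inflate_character _)
    (D.arm_notMem_range_of_irreducible hlam hlam1)]
  rw [Finset.sum_comm]
  have key : ∀ t, ∃ h', ((t = 0) → h' = h) ∧
      ∀ s, D.extendZero (inflate π σ.character) ((D.arm t)⁻¹ * f (h * D.leg s) * D.arm t) =
        lam (s * t) * σ.character (π h') := by
    intro t
    obtain ⟨h', hh'⟩ := D.normal h (D.arm t)
    refine ⟨h', ?_, fun s => ?_⟩
    · rintro rfl
      rw [D.arm_zero, mul_one, one_mul] at hh'
      exact (D.injective hh').symm
    · have : (D.arm t)⁻¹ * f (h * D.leg s) * D.arm t =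
          f (h' * (D.leg s * D.center (s * t))) := by
        rw [map_mul, mul_assoc, mul_assoc, D.leg_mul_arm, ← mul_assoc (f h), hh', mul_assoc,
          inv_mul_cancel_left, ← map_mul, ← map_mul]
      rw [this, D.extendZero_map, inflate, map_mul, map_mul, D.map_leg, one_mul,
        Representation.character, map_mul, hlam, mul_smul_comm, mul_one, map_smul, smul_eq_mul,
        Representation.character]
  choose h' hh' key using key
  simp_rw [key, ← Finset.sum_mul,
    AddChar.sum_mulShift _ (AddChar.IsPrimitive.of_ne_one hlam1)]
  rw [Finset.sum_eq_single 0]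
  · simp [hh' 0 rfl]
  · intro t _ ht
    simp [ht]
  · simp

end Induction

/-! ### Leg invariants of a coinduced representation -/

section Coinduction

variable {W : Type*} [AddCommGroup W] [Module ℂ W] (σ : Representation ℂ Q W)

lemma coind_center_apply {lam : AddChar F ℂ} (hlam : ∀ u, σ (π (D.center u)) = lam u • 1) (u : F) :
    coind f (σ.comp π) (f (D.center u)) = lam u • 1 := by
  ext v x
  have := v.2 (D.center u) x
  simp only [MonoidHom.comp_apply, hlam] at this
  simp [← D.center_central, this]

variable [Fintype F]

/-- Evaluation at `1` on the leg invariants of the coinduced representation. -/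
def evalOne : LinearMap.range (D.proj (coind f (σ.comp π))) →ₗ[ℂ] W :=
  LinearMap.proj (1 : G) ∘ₗ Submodule.subtype _ ∘ₗ Submodule.subtype _

lemma evalOne_apply (v : LinearMap.range (D.proj (coind f (σ.comp π)))) :
    D.evalOne σ v = v.1.1 1 := rfl

lemma evalOne_legInvariants (x : Q) (v : LinearMap.range (D.proj (coind f (σ.comp π)))) :
    D.evalOne σ (D.legInvariants _ x v) = σ x (D.evalOne σ v) := by
  obtain ⟨h, rfl⟩ := D.surjective x
  rw [evalOne_apply, evalOne_apply, D.legInvariants_apply]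
  have := v.1.2 h 1
  rw [MonoidHom.comp_apply, mul_one] at this
  rw [← this]
  exact congrArg v.1.1 (one_mul _)

/-- A function in the coinduced representation is determined by its values on the arm. Invariance
under the leg makes it vanish at all arm elements other than 1. -/
lemma evalOne_injective {lam : AddChar F ℂ} (hlam : ∀ u, σ (π (D.center u)) = lam u • 1)
    (hlam1 : lam ≠ 1) : Function.Injective (D.evalOne σ) := by
  have harm : ∀ v ∈ LinearMap.range (D.proj (coind f (σ.comp π))), ∀ t ≠ 0,
      v.1 (D.arm t) = 0 := by
    intro v hv t ht
    obtain ⟨s, hs⟩ := AddChar.ne_one_iff.1 hlam1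
    -- Moving this leg element to the left past `arm t` produces `center s`, so the value there is
    -- multiplied by λ(s) ≠ 1.
    have h2 := congrArg (fun w => w.1 (D.arm t)) (D.map_leg_apply_of_mem _ hv (-s * t⁻¹))
    change v.1 (D.arm t * f (D.leg (-s * t⁻¹))) = v.1 (D.arm t) at h2
    have h3 : D.arm t * f (D.leg (-s * t⁻¹)) =
        f (D.leg (-s * t⁻¹) * D.center s) * D.arm t := by
      rw [map_mul, mul_assoc, D.center_central, ← mul_assoc, D.leg_mul_arm,
        inv_mul_cancel_right₀ ht, mul_assoc, mul_assoc, ← map_mul f (D.center _), ← D.center_add,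
        neg_add_cancel, D.center_zero, map_one, mul_one]
    rw [h3, v.2, MonoidHom.comp_apply, map_mul, D.map_leg, one_mul, hlam] at h2
    have h4 : (lam s - 1) • v.1 (D.arm t) = 0 := by
      rw [sub_smul, one_smul, sub_eq_zero]
      exact h2
    exact (smul_eq_zero.1 h4).resolve_left (sub_ne_zero.2 hs)
  rintro ⟨v, hv⟩ ⟨v', hv'⟩ h1
  rw [evalOne_apply, evalOne_apply] at h1
  ext g
  -- The inverse is decomposed because equivariance needs the factor from H on the left.
  obtain ⟨t, h, hh⟩ := D.exists_eq_mul g⁻¹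
  have : g = f h⁻¹ * D.arm (-t) := by
    rw [map_inv, D.arm_neg, ← mul_inv_rev, ← hh, inv_inv]
  rw [this, v.2, v'.2]
  by_cases ht : t = 0
  · rw [ht, neg_zero, D.arm_zero]
    exact congrArg _ h1
  · rw [harm v hv _ (neg_ne_zero.2 ht), harm v' hv' _ (neg_ne_zero.2 ht)]

lemma evalOne_surjective : Function.Surjective (D.evalOne σ) := by
  intro w
  have h1 : D.extendZero (fun h => σ (π h) w) ∈ coindV f (σ.comp π) := by
    intro h g
    by_cases hg : ∃ x, f x = g
    · obtain ⟨x, rfl⟩ := hg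
      rw [← map_mul, D.extendZero_map, D.extendZero_map, map_mul, map_mul]
      rfl
    · push Not at hg
      rw [D.extendZero_of_forall_ne _ hg, map_zero, D.extendZero_of_forall_ne]
      intro x hx
      exact hg (h⁻¹ * x) (by rw [map_mul, hx, map_inv, inv_mul_cancel_left])
  refine ⟨⟨⟨_, h1⟩, ?_⟩, ?_⟩
  · rw [mem_range_proj_iff]
    apply D.proj_apply_of_forall
    intro s
    ext g
    change D.extendZero (fun h => σ (π h) w) (g * f (D.leg s)) = D.extendZero (fun h => σ (π h) w) g
    by_cases hg : ∃ x, f x = g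
    · obtain ⟨x, rfl⟩ := hg
      rw [← map_mul, D.extendZero_map, D.extendZero_map, map_mul, D.map_leg, mul_one]
    · push Not at hg
      rw [D.extendZero_of_forall_ne _ hg, D.extendZero_of_forall_ne]
      intro x hx
      exact hg (x * (D.leg s)⁻¹) (by rw [map_mul, hx, map_inv, mul_inv_cancel_right])
  · rw [evalOne_apply]
    dsimp only
    rw [← map_one f, D.extendZero_map, map_one, map_one]
    rfl

end Coinduction

lemma legInvariants_center [Fintype F] {V : Type*} [AddCommGroup V] [Module ℂ V]
    {ρ : Representation ℂ G V} {lam : AddChar F ℂ}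
    (hlam : ∀ u, ρ (f (D.center u)) = lam u • 1) (u : F) :
    D.legInvariants ρ (π (D.center u)) = lam u • 1 := by
  ext v
  rw [D.legInvariants_apply, hlam]
  rfl

lemma isIrreducible_and_character_eq [Fintype F] [Finite H] {V : Type*} [AddCommGroup V]
    [Module ℂ V] [FiniteDimensional ℂ V] {ρ : Representation ℂ G V} {lam : AddChar F ℂ}
    (hlam : ∀ u, ρ (f (D.center u)) = lam u • 1) (hlam1 : lam ≠ 1)
    {W : Type*} [AddCommGroup W] [Module ℂ W] {σ : Representation ℂ Q W} (hσ : σ.IsIrreducible)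
    (e : LinearMap.range (D.proj ρ) →ₗ[ℂ] W) (he : Function.Bijective e)
    (heq : ∀ x v, e (D.legInvariants ρ x v) = σ x (e v)) :
    ρ.IsIrreducible ∧ ρ.character = induce f (inflate π σ.character) := by
  let e' := LinearEquiv.ofBijective e he
  have he' : ∀ x v, e' (D.legInvariants _ x v) = σ x (e' v) := heq
  have hirr : (D.legInvariants ρ).IsIrreducible := by
    refine isIrreducible_of_linearEquiv e'.symm (fun x v => ?_) hσ
    rw [LinearEquiv.symm_apply_eq, he', LinearEquiv.apply_symm_apply]
  have hρ := D.isIrreducible_of_legInvariants hlam hlam1 hirr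
  have : Nontrivial V := ((isIrreducible_iff_forall_invariant _).1 hρ).1
  refine ⟨hρ, ?_⟩
  rw [D.character_eq_induce hlam hlam1, character_eq_of_linearEquiv e' he']

/-- At central elements, 1 among them, the induced character is |F| times the original one, so
kernels meet central subsets alike. -/
lemma induce_inflate_ne_iff [Fintype F] [Finite H] {W : Type*} [AddCommGroup W] [Module ℂ W]
    [Nontrivial W] {σ : Representation ℂ Q W} {lam : AddChar F ℂ}
    (hlam : ∀ u, σ (π (D.center u)) = lam u • 1) (hlam1 : lam ≠ 1) {h : H}
    (hh : ∀ g, f h * g = g * f h) :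
    induce f (inflate π σ.character) (f h) ≠ induce f (inflate π σ.character) 1 ↔
      σ.character (π h) ≠ σ.character 1 := by
  have hq : (Fintype.card F : ℂ) ≠ 0 := by simp
  rw [← map_one f, D.induce_inflate_apply_of_central hlam hlam1 hh,
    D.induce_inflate_apply_of_central hlam hlam1 (by simp), map_one, Ne, mul_right_inj' hq]

/-- Inflation along the leg followed by induction along the arm is a bijection on irreducible
characters that are nontrivial on given central subsets. -/
theorem bijOn_induce_inflate [Finite F] [Finite G] {κ : Type*} (Z : Set κ) (S : κ → Set H)
    (hS : ∀ α ∈ Z, ∀ u ∈ S α, ∀ g, f u * g = g * f u) {γ : κ} (hγ : γ ∈ Z)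
    (hSγ : ∀ u ∈ S γ, ∃ s, D.center s = u) :
    Set.BijOn (fun χ : Q → ℂ => induce f (inflate π χ))
      {χ | χ ∈ Irr Q ∧ ∀ α ∈ Z, ∃ u ∈ S α, χ (π u) ≠ χ 1}
      {χ | χ ∈ Irr G ∧ ∀ α ∈ Z, ∃ u ∈ S α, χ (f u) ≠ χ 1} := by
  have := Fintype.ofFinite F
  have : Finite H := Finite.of_injective f D.injective
  have hq : (Fintype.card F : ℂ) ≠ 0 := by simp
  have hcomm : ∀ s (x : Q), π (D.center s) * x = x * π (D.center s) := by
    intro s x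
    obtain ⟨h, rfl⟩ := D.surjective x
    rw [← map_mul, D.center_comm, map_mul]
  have hchar : ∀ χ ∈ Irr Q, (∀ α ∈ Z, ∃ u ∈ S α, χ (π u) ≠ χ 1) →
      ∃ (n : ℕ) (σ : Representation ℂ Q (Fin n → ℂ)) (lam : AddChar F ℂ), σ.IsIrreducible ∧
        χ = σ.character ∧ (∀ u, σ (π (D.center u)) = lam u • 1) ∧ lam ≠ 1 ∧
        Nontrivial (Fin n → ℂ) := by
    rintro χ ⟨n, σ, hσ, rfl⟩ h
    obtain ⟨lam, hlam⟩ := D.exists_addChar hσ hcomm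
    obtain ⟨u, hu, hu1⟩ := h γ hγ
    obtain ⟨s, rfl⟩ := hSγ u hu
    exact ⟨n, σ, lam, hσ, rfl, hlam, addChar_ne_one hlam hu1,
      ((isIrreducible_iff_forall_invariant σ).1 hσ).1⟩
  refine ⟨?_, ?_, ?_⟩
  · rintro χ ⟨hχ, hχZ⟩
    obtain ⟨n, σ, lam, hσ, rfl, hlam, hlam1, hn⟩ := hchar χ hχ hχZ
    have hlam' := D.coind_center_apply σ hlam
    obtain ⟨hirr, heq⟩ := D.isIrreducible_and_character_eq hlam' hlam1 hσ (D.evalOne σ)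
      ⟨D.evalOne_injective σ hlam hlam1, D.evalOne_surjective σ⟩ (D.evalOne_legInvariants σ)
    refine ⟨?_, fun α hα => ?_⟩
    · dsimp only
      rw [← heq]
      exact character_mem_Irr hirr
    · obtain ⟨u, hu, hu1⟩ := hχZ α hα
      exact ⟨u, hu, (D.induce_inflate_ne_iff hlam hlam1 (hS α hα u hu)).2 hu1⟩
  · rintro χ ⟨hχ, hχZ⟩ χ' ⟨hχ', hχZ'⟩ heq
    obtain ⟨n, σ, lam, hσ, rfl, hlam, hlam1, hn⟩ := hchar χ hχ hχZ
    obtain ⟨n', σ', lam', hσ', rfl, hlam', hlam1', hn'⟩ := hchar χ' hχ' hχZ'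
    dsimp only at heq
    ext x
    obtain ⟨h, rfl⟩ := D.surjective x
    rw [← mul_right_inj' hq, ← D.sum_induce_inflate_mul_leg hlam hlam1,
      ← D.sum_induce_inflate_mul_leg hlam' hlam1', heq]
  · rintro χ ⟨⟨n, ρ, hρ, rfl⟩, hχZ⟩
    obtain ⟨lam, hlam⟩ := D.exists_addChar hρ D.center_central
    have hlam1 : lam ≠ 1 := by
      obtain ⟨u, hu, hu1⟩ := hχZ γ hγ
      obtain ⟨s, rfl⟩ := hSγ u hu
      exact addChar_ne_one hlam hu1
    have hn := ((isIrreducible_iff_forall_invariant ρ).1 hρ).1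
    have hirr := D.legInvariants_isIrreducible hlam hlam1 hρ
    have hm := ((isIrreducible_iff_forall_invariant _).1 hirr).1
    have heq := D.character_eq_induce hlam hlam1
    refine ⟨_, ⟨character_mem_Irr hirr, fun α hα => ?_⟩, heq.symm⟩
    obtain ⟨u, hu, hu1⟩ := hχZ α hα
    rw [heq] at hu1
    exact ⟨u, hu, (D.induce_inflate_ne_iff (D.legInvariants_center hlam) hlam1
      (hS α hα u hu)).1 hu1⟩

end ArmLeg
end ArmLeg

/-! ### Sums of roots, primitive coroots and root strings -/

section RootCombinatorics

variable {ι X Y : Type*} [AddCommGroup X] [AddCommGroup Y] {Φ : RootDatum ι X Y} {b : Φ.Base}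

lemma RootDatum.isAddTorsionFree (Φ : RootDatum ι X Y) : IsAddTorsionFree X :=
  have : Module.IsReflexive ℤ X := .of_isPerfPair Φ.toLinearMap
  .of_isTorsionFree ℤ X

lemma RootDatum.pairingIn_int (Φ : RootDatum ι X Y) (α β : ι) :
    Φ.pairingIn ℤ α β = Φ.pairing α β :=
  Φ.algebraMap_pairingIn ℤ α β

variable [Φ.IsReduced]

lemma RootPairing.Base.IsPos.linearIndependent {α β : ι} (hα : b.IsPos α) (hβ : b.IsPos β)
    (h : α ≠ β) : LinearIndependent ℤ ![Φ.root α, Φ.root β] := by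
  refine RootPairing.IsReduced.linearIndependent Φ h fun hn => ?_
  let := Φ.indexNeg
  have h1 : α = -β := by rw [← Φ.root.injective.eq_iff]; simpa using hn
  rw [RootPairing.Base.isPos_iff] at hα hβ
  rw [h1, b.height_reflectionPerm_self] at hα
  lia

variable [Finite ι]

/-- The roots among the positive combinations of two linearly independent roots are reached from
their sum by successive additions. -/
lemma RootDatum.induction_of_linearIndependent {α β : ι}
    (h : LinearIndependent ℤ ![Φ.root α, Φ.root β]) {M : ι → Prop}
    (hadd : ∀ ε, Φ.root ε = Φ.root α + Φ.root β → M ε)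
    (hleft : ∀ ε ε', M ε → Φ.root ε' = Φ.root ε + Φ.root α → M ε')
    (hright : ∀ ε ε', M ε → Φ.root ε' = Φ.root ε + Φ.root β → M ε') {i j : ℕ} (hi : 1 ≤ i)
    (hj : 1 ≤ j) {ε : ι} (hε : Φ.root ε = i • Φ.root α + j • Φ.root β) : M ε := by
  have := Φ.isAddTorsionFree
  have h' := LinearIndependent.pair_iff.1 h
  have hone : ∀ {μ : ι} {k : ℕ}, ∀ ε, Φ.root ε = k • Φ.root μ → k = 1 := by
    intro μ k ε hε
    by_contra hk
    rcases Nat.lt_or_gt_of_ne hk with hk | hk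
    · rw [Nat.lt_one_iff.1 hk, zero_smul] at hε
      exact Φ.ne_zero _ hε
    · have := Nat.AtLeastTwo.mk hk
      exact Φ.nsmul_notMem_range_root (n := k) (i := μ) ⟨ε, hε⟩
  induction hn : i + j using Nat.strong_induction_on generalizing i j ε with
  | _ n ih =>
    -- Since ⟨ε, ε^∨⟩ = 2 is positive, α or β pairs positively with ε^∨ and can be subtracted from ε
    -- within the roots.
    have key : 0 < Φ.pairing α ε ∨ 0 < Φ.pairing β ε := by
      have h2 := Φ.root_coroot_two ε
      rw [hε, map_add, map_nsmul, map_nsmul, LinearMap.add_apply, LinearMap.smul_apply,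
        LinearMap.smul_apply, Φ.root_coroot_eq_pairing, Φ.root_coroot_eq_pairing] at h2
      by_contra! hc
      have h3 := smul_nonpos_of_nonneg_of_nonpos (Nat.zero_le i) hc.1
      have h4 := smul_nonpos_of_nonneg_of_nonpos (Nat.zero_le j) hc.2
      lia
    have hne : ε ≠ α ∧ ε ≠ β := by
      constructor <;> rintro rfl
      · have := h' (i - 1) j (by linear_combination (norm := module) -hε)
        lia
      · have := h' i (j - 1) (by linear_combination (norm := module) -hε)
        lia
    rw [← Φ.pairingIn_int, ← Φ.pairingIn_int, Φ.zero_lt_pairingIn_iff' (S := ℤ),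
      Φ.zero_lt_pairingIn_iff' (S := ℤ) (i := β)] at key
    rcases key with key | key
    · obtain ⟨ε', hε'⟩ := Φ.root_sub_root_mem_of_pairingIn_pos key hne.1
      obtain ⟨k, rfl⟩ := Nat.exists_eq_add_of_le' hi
      have h1 : Φ.root ε' = k • Φ.root α + j • Φ.root β := by
        rw [hε', hε, add_smul, one_smul]; abel
      -- If α is used up, the remaining root is jβ, so j = 1 by reducedness and ε was α + β.
      rcases Nat.eq_zero_or_pos k with rfl | hk
      · rw [zero_smul, zero_add] at h1
        obtain rfl := hone ε' h1
        exact hadd ε (by simpa using hε)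
      · exact hleft ε' ε (ih _ (by lia) hk hj h1 rfl) (by rw [hε']; abel)
    · obtain ⟨ε', hε'⟩ := Φ.root_sub_root_mem_of_pairingIn_pos key hne.2
      obtain ⟨k, rfl⟩ := Nat.exists_eq_add_of_le' hj
      have h1 : Φ.root ε' = i • Φ.root α + k • Φ.root β := by
        rw [hε', hε, add_smul, one_smul]; abel
      rcases Nat.eq_zero_or_pos k with rfl | hk
      · rw [zero_smul, add_zero] at h1
        obtain rfl := hone ε' h1
        exact hadd ε (by simpa using hε)
      · exact hright ε' ε (ih _ (by lia) hi hk h1 rfl) (by rw [hε']; abel)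

/-- Coroots are primitive in the coroot lattice. -/
lemma RootDatum.isUnit_of_coroot_eq_smul (b : Φ.Base) (α : ι) {d : ℤ} {v : Y}
    (hv : v ∈ Submodule.span ℤ (Φ.coroot '' b.support)) (h : Φ.coroot α = d • v) : IsUnit d := by
  have hrefl : ∀ (β : ι) (v : Y), v ∈ Submodule.span ℤ (Φ.coroot '' b.support) →
      Φ.coreflection β v ∈ Submodule.span ℤ (Φ.coroot '' b.support) := by
    intro β v hv
    rw [RootPairing.coreflection_apply]
    exact sub_mem hv (Submodule.smul_mem _ _ (b.coroot_mem_span_int β))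
  have hperm : ∀ (β α : ι), (∀ v ∈ Submodule.span ℤ (Φ.coroot '' b.support),
      Φ.coroot α = d • v → IsUnit d) → ∀ v ∈ Submodule.span ℤ (Φ.coroot '' b.support),
      Φ.coroot (Φ.reflectionPerm β α) = d • v → IsUnit d := by
    intro β α hα v hv h
    rw [RootPairing.coroot_reflectionPerm] at h
    refine hα _ (hrefl β v hv) ?_
    rw [← map_smul, ← h, Φ.coreflection_same]
  revert v
  suffices ∀ v ∈ Submodule.span ℤ (Φ.coroot '' b.support), Φ.coroot α = d • v → IsUnit d from
    fun {v} => this v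
  -- Reflections preserve the coroot lattice, so it suffices to treat a simple coroot, which is a
  -- member of a basis of that lattice.
  refine b.induction_reflect α (p := fun α => ∀ v ∈ Submodule.span ℤ (Φ.coroot '' b.support),
      Φ.coroot α = d • v → IsUnit d) (fun i => hperm i i) (fun i hi v hv h => ?_)
      (fun i j hi _ => hperm j i hi)
  obtain ⟨c, hc⟩ := (Submodule.mem_span_image_finset_iff_exists_fun ℤ).1 hv
  classical
  have h1 := Fintype.linearIndependent_iff.1 b.linearIndepOn_coroot
    (fun j => d * c j - if j = ⟨i, hi⟩ then 1 else 0) (by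
      have h2 : ∑ j : b.support, (if j = ⟨i, hi⟩ then 1 else 0 : ℤ) • Φ.coroot j = Φ.coroot i := by
        simp [ite_smul]
      simp only [sub_smul, mul_smul]
      rw [Finset.sum_sub_distrib, ← Finset.smul_sum]
      exact sub_eq_zero.2 ((congrArg (d • ·) hc).trans (h.symm.trans h2.symm))) ⟨i, hi⟩
  rw [if_pos rfl, sub_eq_zero] at h1
  exact IsUnit.of_mul_eq_one _ h1

-- The root form is anisotropic on the root lattice, and the simple coroots span all coroots.
omit [Φ.IsReduced] in
lemma RootDatum.exists_pairing_ne_zero (b : Φ.Base) {μ : X}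
    (hμ : μ ∈ Submodule.span ℤ (Set.range Φ.root)) (hμ0 : μ ≠ 0) :
    ∃ i : b.support, Φ.toLinearMap μ (Φ.coroot i) ≠ 0 := by
  have := Fintype.ofFinite ι
  by_contra! hc
  have h1 : ∀ α, Φ.toLinearMap μ (Φ.coroot α) = 0 := by
    intro α
    have h2 : Submodule.span ℤ (Φ.coroot '' b.support) ≤ LinearMap.ker (Φ.toLinearMap μ) := by
      rw [Submodule.span_le]
      rintro _ ⟨i, hi, rfl⟩
      exact hc ⟨i, hi⟩
    exact h2 (b.coroot_mem_span_int α)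
  apply hμ0
  apply Φ.eq_zero_of_mem_rootSpan_of_rootForm_self_eq_zero hμ
  rw [RootPairing.rootForm_apply_apply]
  refine Finset.sum_eq_zero fun α _ => ?_
  have : Φ.coroot' α μ = 0 := h1 α
  rw [this, zero_mul]

/-- The top root of the α-string through β pairs with α^∨ to r + q, where q ≥ 1 since α + β is a
root. This is what makes the structure constant ±(r + 1) invertible in F. -/
lemma NotVeryBad.chainBotCoeff_add_one_lt {p : ℕ} (hp : NotVeryBad Φ p) {α β γ : ι}
    (h : Φ.root γ = Φ.root α + Φ.root β) : Φ.chainBotCoeff α β + 1 < p := by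
  have := Φ.isAddTorsionFree
  have hr : Φ.root α + Φ.root β ∈ Set.range Φ.root := ⟨γ, h⟩
  have hind := Φ.linearIndependent_of_add_mem_range_root' hr
  have h1 := Φ.one_le_chainTopCoeff_of_root_add_mem hr
  have h2 := Φ.chainBotCoeff_add_chainTopCoeff_eq_pairingIn_chainTopIdx hind
  rw [Φ.pairingIn_int] at h2
  have hind' := LinearIndependent.pair_iff.1 hind
  have h3 := hp (Φ.chainTopIdx α β) α (by
    intro hh
    rw [Φ.root_chainTopIdx] at hh
    have := hind' (Φ.chainTopCoeff α β - 1) 1 (by linear_combination (norm := module) hh)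
    simp at this) (by
    intro hh
    rw [Φ.root_chainTopIdx] at hh
    have := hind' (Φ.chainTopCoeff α β + 1) 1 (by linear_combination (norm := module) hh)
    simp at this)
  have h4 := (le_abs_self _).trans_lt h3
  lia

end RootCombinatorics

/-! ### Truncated exponentials of divided powers -/

section DividedPowers

/-- The exponential of a sequence of divided powers that vanishes from the fourth term on. -/
def dividedExp {R S : Type*} [CommRing R] [Ring S] [Algebra R S] (d : ℕ → S) (t : R) : S :=
  ∑ k ∈ Finset.range 4, t ^ k • d k

lemma dividedExp_zero {R S : Type*} [CommRing R] [Ring S] [Algebra R S] {d : ℕ → S}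
    (h0 : d 0 = 1) : dividedExp d (0 : R) = 1 := by
  simp [dividedExp, Finset.sum_range_succ, h0]

lemma dividedExp_add {R S : Type*} [CommRing R] [Ring S] [Algebra R S] {d : ℕ → S}
    (hmul : ∀ i j, d i * d j = (i + j).choose i • d (i + j)) (h4 : ∀ k, 4 ≤ k → d k = 0)
    (s t : R) : dividedExp d (s + t) = dividedExp d s * dividedExp d t := by
  simp only [dividedExp, Finset.sum_range_succ, Finset.sum_range_zero, mul_add, add_mul,
    smul_mul_smul_comm, hmul]
  -- Degrees 4 to 6 are those that occur in a product of two truncations but not in the truncation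
  -- itself.
  have e4 := h4 4 le_rfl
  have e5 := h4 5 (by norm_num)
  have e6 := h4 6 (by norm_num)
  norm_num [Nat.choose, e4, e5, e6, -nsmul_eq_mul]
  module

end DividedPowers

/-! ### Root elements over ℤ as automorphisms of the Lie ring -/

section ChevalleyExp

variable {ι X Y : Type*} [AddCommGroup X] [AddCommGroup Y] [Fintype ι] [DecidableEq ι]
  {Φ : RootDatum ι X Y} {b : Φ.Base} {L : Type*} [LieRing L] (C : ChevalleyBasis Φ b L)

namespace ChevalleyBasis

/-- `ad e_α` as an endomorphism of the Lie ring. -/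
def adRoot (α : ι) : Module.End ℤ L := LieAlgebra.ad ℤ L (C.basis (Sum.inr α))

/-- The divided powers of `ad e_α` as endomorphisms of the Lie ring. -/
def divEnd (α : ι) (k : ℕ) : Module.End ℤ L := Matrix.toLin C.basis C.basis (C.divPow α k)

omit [DecidableEq ι] in
lemma adRoot_apply (α : ι) (x : L) : C.adRoot α x = ⁅C.basis (Sum.inr α), x⁆ := rfl

omit [Fintype ι] [DecidableEq ι] in
lemma exists_coroot_eq_sum (b : Φ.Base) (α : ι) :
    ∃ c : b.support → ℤ, Φ.coroot α = ∑ i, c i • Φ.coroot i := by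
  obtain ⟨c, hc⟩ := (Submodule.mem_span_image_finset_iff_exists_fun ℤ).1 (b.coroot_mem_span_int α)
  exact ⟨c, hc.symm⟩

omit [DecidableEq ι] in
lemma adRoot_cartan (α : ι) (i : b.support) :
    C.adRoot α (C.basis (Sum.inl i)) = -(Φ.pairing α i • C.basis (Sum.inr α)) := by
  rw [adRoot_apply, ← lie_skew, C.lie_h_e]

omit [DecidableEq ι] in
lemma adRoot_self (α : ι) : C.adRoot α (C.basis (Sum.inr α)) = 0 := by
  rw [adRoot_apply, lie_self]

omit [DecidableEq ι] in
lemma adRoot_adRoot_neg {α β : ι} (h : Φ.root β = -Φ.root α) :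
    C.adRoot α (C.adRoot α (C.basis (Sum.inr β))) = -((2 : ℤ) • C.basis (Sum.inr α)) := by
  obtain ⟨c, hc⟩ := exists_coroot_eq_sum b α
  rw [adRoot_apply _ _ (C.basis (Sum.inr β)), C.lie_e_e_neg α β c h hc, map_sum]
  simp_rw [map_smul, C.adRoot_cartan, smul_neg, smul_smul, Finset.sum_neg_distrib,
    ← Finset.sum_smul]
  congr 2
  rw [← Φ.root_coroot_two α, hc, map_sum]
  simp [Φ.root_coroot_eq_pairing]

variable [Φ.IsReduced]

-- Along the α-string the structure constants are, up to sign, the consecutive integers r + 1, r +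
-- 2, …, and the product of k consecutive integers is divisible by k!.
omit [Φ.IsReduced] [DecidableEq ι] in
lemma adRoot_pow_of_linearIndependent {α ν : ι}
    (h : LinearIndependent ℤ ![Φ.root α, Φ.root ν]) (k : ℕ) :
    ∃ w, (C.adRoot α ^ k) (C.basis (Sum.inr ν)) =
      ((Φ.chainBotCoeff α ν + 1).ascFactorial k : ℤ) • w ∧
      (w = 0 ∨ ∃ κ, Φ.root κ = Φ.root ν + k • Φ.root α ∧
        Φ.chainBotCoeff α κ = Φ.chainBotCoeff α ν + k ∧
        (w = C.basis (Sum.inr κ) ∨ w = -C.basis (Sum.inr κ))) := by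
  induction k with
  | zero => exact ⟨C.basis (Sum.inr ν), by simp, Or.inr ⟨ν, by simp, by simp, Or.inl rfl⟩⟩
  | succ k ih =>
    obtain ⟨w, hw, hw'⟩ := ih
    rw [pow_succ', Module.End.mul_apply, hw, map_smul, Nat.ascFactorial_succ]
    rcases hw' with rfl | ⟨κ, hκ, hr, hw'⟩
    · exact ⟨0, by simp, Or.inl rfl⟩
    have hind : LinearIndependent ℤ ![Φ.root α, Φ.root κ] := by
      rw [hκ, add_comm, ← natCast_zsmul, LinearIndependent.pair_add_smul_right_iff]
      exact h
    by_cases hs : Φ.root α + Φ.root κ ∈ Set.range Φ.root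
    · obtain ⟨κ', hκ'⟩ := hs
      have hbr := C.lie_e_e_add α κ κ' hκ'
      rw [hr] at hbr
      have hbot := Φ.chainBotCoeff_of_add hind (k := κ') (by rw [hκ', add_comm])
      have key : ∃ w', (w' = C.basis (Sum.inr κ') ∨ w' = -C.basis (Sum.inr κ')) ∧
          C.adRoot α w = ((Φ.chainBotCoeff α ν + 1 + k : ℕ) : ℤ) • w' := by
        have hcast : ((Φ.chainBotCoeff α ν + k : ℕ) : ℤ) + 1 =
            ((Φ.chainBotCoeff α ν + 1 + k : ℕ) : ℤ) := by push_cast; ring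
        rw [hcast] at hbr
        rcases hw' with rfl | rfl <;> rcases hbr with hbr | hbr
        · exact ⟨_, Or.inl rfl, hbr⟩
        · exact ⟨_, Or.inr rfl, by rw [adRoot_apply, hbr, smul_neg]⟩
        · exact ⟨_, Or.inr rfl, by rw [map_neg, adRoot_apply, hbr, smul_neg]⟩
        · exact ⟨_, Or.inl rfl, by rw [map_neg, adRoot_apply, hbr, neg_neg]⟩
      obtain ⟨w', hw'', h1⟩ := key
      refine ⟨w', ?_, Or.inr ⟨κ', ?_, ?_, hw''⟩⟩
      · rw [h1, smul_smul]
        push_cast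
        rw [mul_comm]
      · rw [hκ', hκ]; module
      · rw [hbot, hr]; ring
    · refine ⟨0, ?_, Or.inl rfl⟩
      have hne : Φ.root α + Φ.root κ ≠ 0 := by
        intro h0
        have := LinearIndependent.pair_iff.1 hind 1 1 (by simpa using h0)
        simp at this
      have := C.lie_e_e_zero α κ hs hne
      rcases hw' with rfl | rfl <;> simp [adRoot_apply, this]

omit [Fintype ι] in
lemma eq_or_neg_or_linearIndependent (Φ : RootDatum ι X Y) [Φ.IsReduced] (α ν : ι) :
    ν = α ∨ Φ.root ν = -Φ.root α ∨ LinearIndependent ℤ ![Φ.root α, Φ.root ν] := by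
  by_cases h1 : ν = α
  · exact Or.inl h1
  by_cases h2 : Φ.root ν = -Φ.root α
  · exact Or.inr (Or.inl h2)
  · exact Or.inr (Or.inr (RootPairing.IsReduced.linearIndependent Φ (Ne.symm h1)
      fun h => h2 (by rw [h, neg_neg])))

/-- This integrality makes the division in `divPow` exact. Off the independent strings the only
nonzero power with k ≥ 2 is (ad e_α)² e_{-α} = -2e_α, divisible by 2!. -/
lemma exists_adRoot_pow_eq (α : ι) (k : ℕ) (j : b.support ⊕ ι) :
    ∃ w, (C.adRoot α ^ k) (C.basis j) = (k ! : ℤ) • w := by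
  rcases Nat.lt_or_ge k 2 with hk | hk
  · exact ⟨(C.adRoot α ^ k) (C.basis j), by rw [Nat.factorial_eq_one.2 (by lia)]; simp⟩
  obtain ⟨k, rfl⟩ := Nat.exists_eq_add_of_le' hk
  rcases j with i | ν
  · refine ⟨0, ?_⟩
    rw [pow_add, pow_two, Module.End.mul_apply, Module.End.mul_apply, adRoot_cartan, map_neg,
      map_smul, adRoot_self]
    simp
  · rcases eq_or_neg_or_linearIndependent Φ α ν with rfl | h | h
    · refine ⟨0, ?_⟩
      rw [pow_add, pow_two, Module.End.mul_apply, Module.End.mul_apply, adRoot_self]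
      simp
    · rw [pow_add, pow_two, Module.End.mul_apply, Module.End.mul_apply, C.adRoot_adRoot_neg h]
      rcases Nat.eq_zero_or_pos k with rfl | hk'
      · exact ⟨-C.basis (Sum.inr α), by simp⟩
      · refine ⟨0, ?_⟩
        obtain ⟨k, rfl⟩ := Nat.exists_eq_add_of_le' hk'
        rw [pow_succ, Module.End.mul_apply, map_neg, map_smul, adRoot_self]
        simp
    · obtain ⟨w, hw, -⟩ := C.adRoot_pow_of_linearIndependent h (k + 2)
      obtain ⟨c, hc⟩ := Nat.factorial_dvd_ascFactorial (Φ.chainBotCoeff α ν + 1) (k + 2)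
      exact ⟨(c : ℤ) • w, by rw [hw, hc, smul_smul]; push_cast; rfl⟩

lemma adRoot_pow_four (α : ι) : C.adRoot α ^ 4 = 0 := by
  refine C.basis.ext fun j => ?_
  rw [LinearMap.zero_apply]
  rcases j with i | ν
  · rw [pow_add _ 2 2, pow_two, Module.End.mul_apply, Module.End.mul_apply, Module.End.mul_apply,
      adRoot_cartan, map_neg, map_smul, adRoot_self]
    simp
  · rcases eq_or_neg_or_linearIndependent Φ α ν with rfl | h | h
    · rw [pow_succ, Module.End.mul_apply, adRoot_self, map_zero]
    · rw [pow_succ, pow_succ, Module.End.mul_apply, Module.End.mul_apply, C.adRoot_adRoot_neg h,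
        pow_two, Module.End.mul_apply, map_neg, map_smul, adRoot_self]
      simp
    · obtain ⟨w, hw, rfl | ⟨κ, hκ, -, -⟩⟩ := C.adRoot_pow_of_linearIndependent h 4
      · rw [hw, smul_zero]
      · have h1 := (Φ.root_add_nsmul_mem_range_iff_le_chainTopCoeff h (n := 4)).1 ⟨κ, hκ⟩
        have h2 := Φ.chainBotCoeff_add_chainTopCoeff_le_three (i := α) (j := ν)
        lia

omit [Φ.IsReduced] in
lemma divPow_apply (α : ι) (k : ℕ) (i j : b.support ⊕ ι) :
    C.divPow α k i j = C.basis.repr ((C.adRoot α ^ k) (C.basis j)) i / (k ! : ℤ) := by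
  have h := LinearMap.toMatrix_pow C.basis (C.adRoot α) k
  rw [← LinearMap.toMatrix_apply, ← h]
  rfl

lemma factorial_smul_divEnd (α : ι) (k : ℕ) : (k ! : ℤ) • C.divEnd α k = C.adRoot α ^ k := by
  refine C.basis.ext fun j => ?_
  obtain ⟨w, hw⟩ := C.exists_adRoot_pow_eq α k j
  have hk : (k ! : ℤ) ≠ 0 := by exact_mod_cast k.factorial_ne_zero
  rw [LinearMap.smul_apply, hw]
  congr 1
  apply C.basis.repr.injective
  ext i
  rw [divEnd, Matrix.toLin_self]
  simp only [map_sum, map_smul, Module.Basis.repr_self, Finsupp.coe_finsetSum, Finset.sum_apply,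
    Finsupp.smul_apply, Finsupp.single_apply, smul_eq_mul, mul_ite, mul_one, mul_zero,
    Finset.sum_ite_eq', Finset.mem_univ, if_true]
  rw [divPow_apply, hw, map_smul, Finsupp.smul_apply, smul_eq_mul, Int.mul_ediv_cancel_left _ hk]

-- Identities between divided powers can thus be checked after clearing factorials, where they
-- concern ordinary powers of ad e_α.
omit [DecidableEq ι] [Φ.IsReduced] in
include C in
lemma end_smul_injective {n : ℕ} (hn : n ≠ 0) {f g : Module.End ℤ L} (h : (n : ℤ) • f = (n : ℤ) • g) :
    f = g := by
  have := Module.Free.of_basis C.basis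
  refine LinearMap.ext fun x => ?_
  exact smul_right_injective L (by exact_mod_cast hn : (n : ℤ) ≠ 0) (congrArg (fun T => T x) h)

lemma divEnd_zero (α : ι) : C.divEnd α 0 = 1 := by
  have := C.factorial_smul_divEnd α 0
  simpa using this

lemma divEnd_one (α : ι) : C.divEnd α 1 = C.adRoot α := by
  have := C.factorial_smul_divEnd α 1
  simpa using this

lemma divEnd_of_four_le (α : ι) {k : ℕ} (hk : 4 ≤ k) : C.divEnd α k = 0 := by
  apply C.end_smul_injective k.factorial_ne_zero
  rw [C.factorial_smul_divEnd, smul_zero, pow_eq_zero_of_le hk (C.adRoot_pow_four α)]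

lemma divEnd_mul (α : ι) (i j : ℕ) :
    C.divEnd α i * C.divEnd α j = (i + j).choose i • C.divEnd α (i + j) := by
  apply C.end_smul_injective (mul_ne_zero i.factorial_ne_zero j.factorial_ne_zero)
  have h1 : ((i ! * j ! : ℕ) : ℤ) • (C.divEnd α i * C.divEnd α j) = C.adRoot α ^ (i + j) := by
    rw [pow_add, ← C.factorial_smul_divEnd, ← C.factorial_smul_divEnd, smul_mul_smul_comm]
    push_cast
    rfl
  rw [h1, ← C.factorial_smul_divEnd, ← natCast_zsmul, smul_smul,
    ← Nat.add_choose_mul_factorial_mul_factorial, Nat.choose_symm_add]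
  push_cast
  ring_nf

lemma divEnd_lie (α : ι) (n : ℕ) (x y : L) :
    C.divEnd α n ⁅x, y⁆ =
      ∑ ij ∈ Finset.HasAntidiagonal.antidiagonal n, ⁅C.divEnd α ij.1 x, C.divEnd α ij.2 y⁆ := by
  have := Module.Free.of_basis C.basis
  apply smul_right_injective L (by exact_mod_cast n.factorial_ne_zero : (n ! : ℤ) ≠ 0)
  dsimp only
  have h1 : ∀ (k : ℕ) (x : L), (k ! : ℤ) • C.divEnd α k x =
      (LieDerivation.ad ℤ L (C.basis (Sum.inr α)))^[k] x := by
    intro k x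
    have h2 : ⇑(C.adRoot α) = ⇑(LieDerivation.ad ℤ L (C.basis (Sum.inr α))) :=
      funext fun x => by rw [adRoot_apply, LieDerivation.ad_apply_apply]
    rw [← LinearMap.smul_apply, C.factorial_smul_divEnd, Module.End.pow_apply, h2]
  rw [h1, LieDerivation.iterate_apply_lie, Finset.smul_sum]
  refine Finset.sum_congr rfl fun ij hij => ?_
  obtain ⟨i, j⟩ := ij
  obtain rfl : i + j = n := Finset.HasAntidiagonal.mem_antidiagonal.1 hij
  dsimp only
  rw [← h1, ← h1, lie_smul, smul_lie, smul_smul, ← natCast_zsmul,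
    ← Nat.add_choose_mul_factorial_mul_factorial, Nat.choose_symm_add]
  push_cast
  module

/-- The root element `x_α(c)`, `c ∈ ℤ`, as an endomorphism of the Lie ring. -/
def rootEnd (α : ι) (c : ℤ) : Module.End ℤ L := dividedExp (C.divEnd α) c

lemma rootEnd_zero (α : ι) : C.rootEnd α 0 = 1 := dividedExp_zero (C.divEnd_zero α)

lemma rootEnd_add (α : ι) (s t : ℤ) : C.rootEnd α (s + t) = C.rootEnd α s * C.rootEnd α t :=
  dividedExp_add (C.divEnd_mul α) (fun _ => C.divEnd_of_four_le α) s t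

lemma rootEnd_lie (α : ι) (c : ℤ) (x y : L) :
    C.rootEnd α c ⁅x, y⁆ = ⁅C.rootEnd α c x, C.rootEnd α c y⁆ := by
  -- The bracket of two exponentials truncated after degree 3 has terms up to degree 6, so the left
  -- side is padded by vanishing terms to match.
  have h : ∀ x, C.rootEnd α c x = ∑ k ∈ Finset.range 7, c ^ k • C.divEnd α k x := by
    intro x
    have e4 := C.divEnd_of_four_le α le_rfl
    have e5 := C.divEnd_of_four_le α (k := 5) (by norm_num)
    have e6 := C.divEnd_of_four_le α (k := 6) (by norm_num)
    simp only [rootEnd, dividedExp, Finset.sum_range_succ, LinearMap.add_apply, e4, e5, e6,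
      LinearMap.smul_apply, Finset.sum_range_zero, LinearMap.zero_apply, smul_zero, add_zero]
  rw [h]
  simp_rw [C.divEnd_lie]
  have e4 := C.divEnd_of_four_le α le_rfl
  have e5 := C.divEnd_of_four_le α (k := 5) (by norm_num)
  have e6 := C.divEnd_of_four_le α (k := 6) (by norm_num)
  simp only [rootEnd, dividedExp, Finset.sum_range_succ, Finset.sum_range_zero,
    Finset.Nat.sum_antidiagonal_eq_sum_range_succ_mk, LinearMap.add_apply,
    LinearMap.smul_apply, add_lie, lie_add, smul_lie, lie_smul, Nat.reduceSub,
    e4, e5, e6, LinearMap.zero_apply, zero_lie, lie_zero, zero_add]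
  module

end ChevalleyBasis
end ChevalleyExp

/-! ### The weight grading of the Lie ring and of its endomorphisms -/

section Weights

variable {ι X Y : Type*} [AddCommGroup X] [AddCommGroup Y] [Fintype ι] [DecidableEq ι]
  {Φ : RootDatum ι X Y} {b : Φ.Base} {L : Type*} [LieRing L] (C : ChevalleyBasis Φ b L)

/-- The weights of the elements of a Chevalley basis. -/
def RootDatum.basisWeight (Φ : RootDatum ι X Y) (b : Φ.Base) : b.support ⊕ ι → X :=
  Sum.elim 0 Φ.root

namespace ChevalleyBasis

/-- All weights of `x` lie in `S`. -/
def WeightsIn (x : L) (S : Set X) : Prop :=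
  ∀ i, C.basis.repr x i ≠ 0 → Φ.basisWeight b i ∈ S

/-- All weights of the endomorphism `f` lie in `S`. -/
def EndWeightsIn (f : Module.End ℤ L) (S : Set X) : Prop :=
  ∀ i j, C.basis.repr (f (C.basis j)) i ≠ 0 → Φ.basisWeight b i - Φ.basisWeight b j ∈ S

variable {C}

omit [DecidableEq ι] in
lemma WeightsIn.mono {x : L} {S T : Set X} (h : C.WeightsIn x S) (hST : S ⊆ T) :
    C.WeightsIn x T := fun i hi => hST (h i hi)

omit [DecidableEq ι] in
lemma WeightsIn.zero (S : Set X) : C.WeightsIn 0 S := fun i hi => by simp at hi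

omit [DecidableEq ι] in
lemma WeightsIn.add {x y : L} {S : Set X} (hx : C.WeightsIn x S) (hy : C.WeightsIn y S) :
    C.WeightsIn (x + y) S := by
  intro i hi
  rw [map_add, Finsupp.add_apply] at hi
  by_cases h : C.basis.repr x i = 0
  · exact hy i (by simpa [h] using hi)
  · exact hx i h

omit [DecidableEq ι] in
lemma WeightsIn.smul {x : L} {S : Set X} (c : ℤ) (hx : C.WeightsIn x S) :
    C.WeightsIn (c • x) S := by
  intro i hi
  rw [map_smul, Finsupp.smul_apply] at hi
  exact hx i (right_ne_zero_of_smul hi)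

omit [DecidableEq ι] in
lemma WeightsIn.sum {κ : Type*} {s : Finset κ} {x : κ → L} {S : Set X}
    (hx : ∀ k ∈ s, C.WeightsIn (x k) S) : C.WeightsIn (∑ k ∈ s, x k) S :=
  Finset.sum_induction _ (fun x => C.WeightsIn x S) (fun _ _ => WeightsIn.add) (WeightsIn.zero S) hx

lemma weightsIn_basis (i : b.support ⊕ ι) : C.WeightsIn (C.basis i) {Φ.basisWeight b i} := by
  intro j hj
  rw [C.basis.repr_self, Finsupp.single_apply] at hj
  have : i = j := by by_contra h; simp [h] at hj
  rw [this]; rfl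

lemma weightsIn_lie_basis (i j : b.support ⊕ ι) :
    C.WeightsIn ⁅C.basis i, C.basis j⁆ {Φ.basisWeight b i + Φ.basisWeight b j} := by
  have hhe : ∀ (i : b.support) (α : ι), C.WeightsIn ⁅C.basis (Sum.inl i), C.basis (Sum.inr α)⁆
      {Φ.root α} := by
    intro i α
    rw [C.lie_h_e]
    exact (weightsIn_basis (Sum.inr α)).smul _
  rcases i with i | α <;> rcases j with j | β
  · rw [C.lie_h_h]
    exact WeightsIn.zero _
  · simpa [RootDatum.basisWeight] using hhe i β
  · rw [← lie_skew, ← neg_one_smul ℤ]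
    simpa [RootDatum.basisWeight] using (hhe j α).smul (-1)
  · simp only [RootDatum.basisWeight, Sum.elim_inr]
    by_cases hs : Φ.root α + Φ.root β ∈ Set.range Φ.root
    · obtain ⟨γ, hγ⟩ := hs
      rw [← hγ]
      rcases C.lie_e_e_add α β γ hγ with h | h <;> rw [h]
      · exact (weightsIn_basis (Sum.inr γ)).smul _
      · rw [← neg_one_smul ℤ]
        exact ((weightsIn_basis (Sum.inr γ)).smul _).smul _
    · by_cases h0 : Φ.root α + Φ.root β = 0
      · obtain ⟨c, hc⟩ := exists_coroot_eq_sum b α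
        rw [C.lie_e_e_neg α β c (eq_neg_of_add_eq_zero_right h0) hc, h0]
        exact WeightsIn.sum fun i _ => (weightsIn_basis (Sum.inl i)).smul _
      · rw [C.lie_e_e_zero α β hs h0]
        exact WeightsIn.zero _

lemma WeightsIn.lie {x y : L} {S T : Set X} (hx : C.WeightsIn x S) (hy : C.WeightsIn y T) :
    C.WeightsIn ⁅x, y⁆ (S + T) := by
  rw [← C.basis.sum_repr x, ← C.basis.sum_repr y, sum_lie]
  refine WeightsIn.sum fun i _ => ?_
  rw [lie_sum]
  refine WeightsIn.sum fun j _ => ?_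
  rw [smul_lie, lie_smul]
  by_cases hi : C.basis.repr x i = 0
  · rw [hi, zero_smul]; exact WeightsIn.zero _
  by_cases hj : C.basis.repr y j = 0
  · rw [hj, zero_smul, smul_zero]; exact WeightsIn.zero _
  refine (((weightsIn_lie_basis i j).mono ?_).smul _).smul _
  rw [Set.singleton_subset_iff]
  exact Set.add_mem_add (hx i hi) (hy j hj)

omit [DecidableEq ι] in
lemma endWeightsIn_iff {f : Module.End ℤ L} {S : Set X} :
    C.EndWeightsIn f S ↔ ∀ j, C.WeightsIn (f (C.basis j)) ({Φ.basisWeight b j} + S) := by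
  refine ⟨fun h j i hi => ?_, fun h i j hi => ?_⟩
  · exact Set.mem_add.2 ⟨_, rfl, _, h i j hi, by abel⟩
  · obtain ⟨_, rfl, s, hs, hss⟩ := Set.mem_add.1 (h j i hi)
    rw [← hss, add_sub_cancel_left]
    exact hs

omit [DecidableEq ι] in
lemma EndWeightsIn.apply {f : Module.End ℤ L} {S T : Set X} (hf : C.EndWeightsIn f S) {x : L}
    (hx : C.WeightsIn x T) : C.WeightsIn (f x) (T + S) := by
  rw [← C.basis.sum_repr x, map_sum]
  refine WeightsIn.sum fun i _ => ?_
  rw [map_smul]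
  by_cases hi : C.basis.repr x i = 0
  · rw [hi, zero_smul]; exact WeightsIn.zero _
  · refine ((endWeightsIn_iff.1 hf i).mono ?_).smul _
    exact Set.add_subset_add_right (Set.singleton_subset_iff.2 (hx i hi))

-- Only differences of basis weights can occur, so an infinite set of weights may be replaced by a
-- finite one.
omit [DecidableEq ι] in
lemma EndWeightsIn.mono {f : Module.End ℤ L} {S T : Set X} (h : C.EndWeightsIn f S)
    (hST : ∀ i j, Φ.basisWeight b i - Φ.basisWeight b j ∈ S →
      Φ.basisWeight b i - Φ.basisWeight b j ∈ T) : C.EndWeightsIn f T :=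
  fun i j hi => hST i j (h i j hi)

omit [DecidableEq ι] in
lemma EndWeightsIn.mono_subset {f : Module.End ℤ L} {S T : Set X} (h : C.EndWeightsIn f S)
    (hST : S ⊆ T) : C.EndWeightsIn f T :=
  h.mono fun _ _ hs => hST hs

omit [DecidableEq ι] in
lemma EndWeightsIn.add {f g : Module.End ℤ L} {S : Set X} (hf : C.EndWeightsIn f S)
    (hg : C.EndWeightsIn g S) : C.EndWeightsIn (f + g) S := by
  rw [endWeightsIn_iff] at *
  exact fun j => (hf j).add (hg j)

omit [DecidableEq ι] in
lemma EndWeightsIn.smul {f : Module.End ℤ L} {S : Set X} (c : ℤ) (hf : C.EndWeightsIn f S) :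
    C.EndWeightsIn (c • f) S := by
  rw [endWeightsIn_iff] at *
  exact fun j => (hf j).smul c

omit [DecidableEq ι] in
lemma EndWeightsIn.sub {f g : Module.End ℤ L} {S : Set X} (hf : C.EndWeightsIn f S)
    (hg : C.EndWeightsIn g S) : C.EndWeightsIn (f - g) S := by
  rw [sub_eq_add_neg, ← neg_one_smul ℤ]
  exact hf.add (hg.smul _)

lemma endWeightsIn_one : C.EndWeightsIn 1 {0} := by
  rw [endWeightsIn_iff]
  intro j
  rw [Set.singleton_add_singleton, add_zero]
  exact weightsIn_basis j

omit [DecidableEq ι] in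
lemma EndWeightsIn.mul {f g : Module.End ℤ L} {S T : Set X} (hf : C.EndWeightsIn f S)
    (hg : C.EndWeightsIn g T) : C.EndWeightsIn (f * g) (S + T) := by
  rw [endWeightsIn_iff] at *
  intro j
  rw [add_comm S, ← add_assoc]
  exact (endWeightsIn_iff.2 hf).apply (hg j)

lemma endWeightsIn_adRoot (α : ι) : C.EndWeightsIn (C.adRoot α) {Φ.root α} := by
  rw [endWeightsIn_iff]
  intro j
  rw [Set.singleton_add_singleton, add_comm]
  exact weightsIn_lie_basis (Sum.inr α) j

lemma endWeightsIn_divEnd [Φ.IsReduced] (α : ι) (k : ℕ) :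
    C.EndWeightsIn (C.divEnd α k) {k • Φ.root α} := by
  have h : C.EndWeightsIn (C.adRoot α ^ k) {k • Φ.root α} := by
    induction k with
    | zero => simpa using endWeightsIn_one
    | succ k ih =>
      rw [pow_succ, succ_nsmul, ← Set.singleton_add_singleton]
      exact ih.mul (endWeightsIn_adRoot α)
  intro i j hij
  apply h i j
  rw [← C.factorial_smul_divEnd, LinearMap.smul_apply, map_smul, Finsupp.smul_apply, smul_eq_mul]
  exact mul_ne_zero (by exact_mod_cast k.factorial_ne_zero) hij

variable (C)

/-- The projection to the weight space of `μ`. -/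
def weightProj (μ : X) : Module.End ℤ L :=
  open scoped Classical in
  C.basis.constr ℤ fun i => if Φ.basisWeight b i = μ then C.basis i else 0

variable {C}

omit [DecidableEq ι] in
lemma weightProj_basis_of_eq (i : b.support ⊕ ι) :
    C.weightProj (Φ.basisWeight b i) (C.basis i) = C.basis i := by
  rw [weightProj, Module.Basis.constr_basis, if_pos rfl]

omit [DecidableEq ι] in
lemma weightProj_basis_of_ne {i : b.support ⊕ ι} {μ : X} (h : Φ.basisWeight b i ≠ μ) :
    C.weightProj μ (C.basis i) = 0 := by
  rw [weightProj, Module.Basis.constr_basis, if_neg h]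

omit [DecidableEq ι] in
lemma WeightsIn.weightProj_eq_self {x : L} {μ : X} (hx : C.WeightsIn x {μ}) :
    C.weightProj μ x = x := by
  conv_rhs => rw [← C.basis.sum_repr x]
  conv_lhs => rw [← C.basis.sum_repr x]
  rw [map_sum]
  refine Finset.sum_congr rfl fun i _ => ?_
  rw [map_smul]
  by_cases hi : C.basis.repr x i = 0
  · rw [hi, zero_smul, zero_smul]
  · have : Φ.basisWeight b i = μ := hx i hi
    rw [← this, weightProj_basis_of_eq]

omit [DecidableEq ι] in
lemma WeightsIn.weightProj_eq_zero {x : L} {μ : X} {S : Set X} (hx : C.WeightsIn x S)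
    (hμ : μ ∉ S) : C.weightProj μ x = 0 := by
  rw [← C.basis.sum_repr x, map_sum]
  refine Finset.sum_eq_zero fun i _ => ?_
  rw [map_smul]
  by_cases hi : C.basis.repr x i = 0
  · rw [hi, zero_smul]
  · rw [weightProj_basis_of_ne, smul_zero]
    rintro rfl
    exact hμ (hx i hi)

lemma weightsIn_weightProj (x : L) (μ : X) : C.WeightsIn (C.weightProj μ x) {μ} := by
  rw [← C.basis.sum_repr x, map_sum]
  refine WeightsIn.sum fun i _ => ?_
  rw [map_smul]
  by_cases hi : Φ.basisWeight b i = μ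
  · subst hi
    rw [weightProj_basis_of_eq]
    exact (weightsIn_basis i).smul _
  · rw [weightProj_basis_of_ne hi]
    exact (WeightsIn.zero _).smul _

lemma WeightsIn.sub_weightProj {x : L} {S : Set X} (hx : C.WeightsIn x S) (μ : X) :
    C.WeightsIn (x - C.weightProj μ x) (S \ {μ}) := by
  have h : x - C.weightProj μ x =
      ∑ i, C.basis.repr x i • (C.basis i - C.weightProj μ (C.basis i)) := by
    simp_rw [smul_sub, Finset.sum_sub_distrib, ← map_smul, ← map_sum, C.basis.sum_repr]
  rw [h]
  refine WeightsIn.sum fun i _ => ?_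
  by_cases hi : C.basis.repr x i = 0
  · rw [hi, zero_smul]; exact WeightsIn.zero _
  by_cases hi' : Φ.basisWeight b i = μ
  · subst hi'
    rw [weightProj_basis_of_eq, sub_self]
    exact (WeightsIn.zero _).smul _
  · rw [weightProj_basis_of_ne hi', sub_zero]
    refine WeightsIn.smul _ ((weightsIn_basis i).mono ?_)
    exact Set.singleton_subset_iff.2 ⟨hx i hi, hi'⟩

omit [DecidableEq ι] in
/-- Induction on elements through the Chevalley basis. -/
lemma induction_basis {M : L → Prop} (hzero : M 0) (hadd : ∀ x y, M x → M y → M (x + y))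
    (hsmul : ∀ (c : ℤ) x, M x → M (c • x)) (hbasis : ∀ i, M (C.basis i)) (x : L) : M x := by
  rw [← C.basis.sum_repr x]
  exact Finset.sum_induction _ M hadd hzero fun i _ => hsmul _ _ (hbasis i)

lemma weightProj_lie {y : L} {κ ν : X} (hy : C.WeightsIn y {ν}) (x : L) :
    C.weightProj (κ + ν) ⁅x, y⁆ = ⁅C.weightProj κ x, y⁆ := by
  induction x using C.induction_basis with
  | hzero => simp
  | hadd x x' h h' => simp only [add_lie, map_add, h, h']
  | hsmul c x h => simp only [smul_lie, map_smul, h]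
  | hbasis i =>
    have h := (weightsIn_basis i).lie hy
    rw [Set.singleton_add_singleton] at h
    by_cases hi : Φ.basisWeight b i = κ
    · subst hi
      rw [weightProj_basis_of_eq, h.weightProj_eq_self]
    · rw [weightProj_basis_of_ne hi, zero_lie, h.weightProj_eq_zero]
      simpa using Ne.symm hi

lemma weightProj_lie' {x : L} {κ ν : X} (hx : C.WeightsIn x {ν}) (y : L) :
    C.weightProj (ν + κ) ⁅x, y⁆ = ⁅x, C.weightProj κ y⁆ := by
  rw [← lie_skew, map_neg, add_comm, weightProj_lie hx, lie_skew]

variable (C)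

/-- The homogeneous component of weight `μ` of an endomorphism. -/
def endComponent (μ : X) (f : Module.End ℤ L) : Module.End ℤ L :=
  C.basis.constr ℤ fun j => C.weightProj (Φ.basisWeight b j + μ) (f (C.basis j))

variable {C}

omit [DecidableEq ι] in
lemma endComponent_basis (μ : X) (f : Module.End ℤ L) (j : b.support ⊕ ι) :
    C.endComponent μ f (C.basis j) = C.weightProj (Φ.basisWeight b j + μ) (f (C.basis j)) := by
  rw [endComponent, Module.Basis.constr_basis]

omit [DecidableEq ι] in
lemma endComponent_apply {μ ν : X} (f : Module.End ℤ L) {x : L} (hx : C.WeightsIn x {ν}) :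
    C.endComponent μ f x = C.weightProj (ν + μ) (f x) := by
  rw [← C.basis.sum_repr x]
  simp only [map_sum, map_smul]
  refine Finset.sum_congr rfl fun i _ => ?_
  by_cases hi : C.basis.repr x i = 0
  · rw [hi, zero_smul, zero_smul]
  · have : Φ.basisWeight b i = ν := hx i hi
    rw [endComponent_basis, this]

lemma endWeightsIn_endComponent (μ : X) (f : Module.End ℤ L) :
    C.EndWeightsIn (C.endComponent μ f) {μ} := by
  rw [endWeightsIn_iff]
  intro j
  rw [endComponent_basis, Set.singleton_add_singleton]
  exact weightsIn_weightProj _ _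

lemma EndWeightsIn.sub_endComponent {f : Module.End ℤ L} {S : Set X} (hf : C.EndWeightsIn f S)
    (μ : X) : C.EndWeightsIn (f - C.endComponent μ f) (S \ {μ}) := by
  rw [endWeightsIn_iff] at *
  intro j
  rw [LinearMap.sub_apply, endComponent_basis]
  refine ((hf j).sub_weightProj (Φ.basisWeight b j + μ)).mono ?_
  rintro _ ⟨⟨_, rfl, s, hs, rfl⟩, h⟩
  refine ⟨_, rfl, s, ⟨hs, ?_⟩, rfl⟩
  rintro rfl
  exact h rfl

/-- A homogeneous component of lowest weight of an automorphism is a derivation. -/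
lemma endComponent_lie {g : Module.End ℤ L} (hg : ∀ x y, g ⁅x, y⁆ = ⁅g x, g y⁆) {U : Set X}
    (hU : C.EndWeightsIn (g - 1) U) {μ : X} (hμ : μ ∉ U + U) (x y : L) :
    C.endComponent μ (g - 1) ⁅x, y⁆ =
      ⁅C.endComponent μ (g - 1) x, y⁆ + ⁅x, C.endComponent μ (g - 1) y⁆ := by
  induction x using C.induction_basis with
  | hzero => simp
  | hadd x x' h h' => simp only [add_lie, map_add, h, h']; abel
  | hsmul c x h => simp only [smul_lie, map_smul, h, smul_add]
  | hbasis i =>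
  induction y using C.induction_basis with
  | hzero => simp
  | hadd x x' h h' => simp only [lie_add, map_add, h, h']; abel
  | hsmul c x h => simp only [lie_smul, map_smul, h, smul_add]
  | hbasis j =>
    set ν := Φ.basisWeight b i
    set ν' := Φ.basisWeight b j
    have hb : C.WeightsIn ⁅C.basis i, C.basis j⁆ {ν + ν'} := weightsIn_lie_basis i j
    -- For an automorphism g, the Leibniz rule for g - 1 fails only by the quadratic last term. Its
    -- weights are shifted by elements of U + U, so it has no part of degree μ.
    have hexp : (g - 1) ⁅C.basis i, C.basis j⁆ = ⁅(g - 1) (C.basis i), C.basis j⁆ +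
        ⁅C.basis i, (g - 1) (C.basis j)⁆ + ⁅(g - 1) (C.basis i), (g - 1) (C.basis j)⁆ := by
      simp only [LinearMap.sub_apply, Module.End.one_apply, hg, sub_lie, lie_sub]
      abel
    rw [endComponent_apply _ hb, hexp, map_add, map_add, endComponent_basis, endComponent_basis,
      ← weightProj_lie (weightsIn_basis j), ← weightProj_lie' (weightsIn_basis i)]
    have hz : C.weightProj (ν + ν' + μ) ⁅(g - 1) (C.basis i), (g - 1) (C.basis j)⁆ = 0 := by
      refine ((endWeightsIn_iff.1 hU i).lie (endWeightsIn_iff.1 hU j)).weightProj_eq_zero ?_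
      rintro ⟨_, ⟨_, rfl, s, hs, rfl⟩, _, ⟨_, rfl, t, ht, rfl⟩, h⟩
      apply hμ
      refine ⟨s, hs, t, ht, ?_⟩
      dsimp only at h
      have h2 : (ν + ν') + (s + t) = (ν + ν') + μ := by rw [← h]; abel
      exact add_left_cancel h2
    rw [hz, add_zero]
    congr 3 <;> abel

end ChevalleyBasis
end Weights

/-! ### Homogeneous derivations of nonzero weight over ℤ -/

section Derivations

variable {ι X Y : Type*} [AddCommGroup X] [AddCommGroup Y] [Fintype ι] [DecidableEq ι]
  {Φ : RootDatum ι X Y} {b : Φ.Base} {L : Type*} [LieRing L] {C : ChevalleyBasis Φ b L}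

namespace ChevalleyBasis

omit [DecidableEq ι] in
lemma WeightsIn.lie_cartan {x : L} {ν : X} (hx : C.WeightsIn x {ν}) (i : b.support) :
    ⁅C.basis (Sum.inl i), x⁆ = Φ.toLinearMap ν (Φ.coroot i) • x := by
  rw [← C.basis.sum_repr x, lie_sum, Finset.smul_sum]
  refine Finset.sum_congr rfl fun j _ => ?_
  by_cases hj : C.basis.repr x j = 0
  · rw [hj, zero_smul, lie_zero, smul_zero]
  have hν : Φ.basisWeight b j = ν := hx j hj
  rw [lie_smul, smul_comm]
  congr 1
  rcases j with j | α
  · rw [C.lie_h_h, ← hν]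
    simp [RootDatum.basisWeight]
  · rw [C.lie_h_e, ← hν]
    simp [RootDatum.basisWeight, Φ.root_coroot_eq_pairing]

omit [DecidableEq ι] in
lemma WeightsIn.eq_smul {x : L} {α : ι} (hx : C.WeightsIn x {Φ.root α}) :
    x = C.basis.repr x (Sum.inr α) • C.basis (Sum.inr α) := by
  conv_lhs => rw [← C.basis.sum_repr x]
  refine Finset.sum_eq_single _ (fun j _ hj => ?_) (by simp)
  by_contra hne
  have h : Φ.basisWeight b j = Φ.root α := hx j fun h => hne (by rw [h, zero_smul])
  rcases j with j | β
  · exact Φ.ne_zero α h.symm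
  · exact hj (congrArg Sum.inr (Φ.root.injective h))

omit [DecidableEq ι] in
lemma WeightsIn.eq_zero {x : L} {μ : X} (hx : C.WeightsIn x {μ}) (h0 : μ ≠ 0)
    (hμ : μ ∉ Set.range Φ.root) : x = 0 := by
  rw [← C.basis.sum_repr x]
  refine Finset.sum_eq_zero fun j _ => ?_
  by_contra hne
  have h : Φ.basisWeight b j = μ := hx j fun h => hne (by rw [h, zero_smul])
  rcases j with j | β
  · exact h0 h.symm
  · exact hμ ⟨β, h⟩

variable {δ : Module.End ℤ L} (hδ : ∀ x y, δ ⁅x, y⁆ = ⁅δ x, y⁆ + ⁅x, δ y⁆) {μ : X}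
  (hw : C.EndWeightsIn δ {μ})

include hw

omit [DecidableEq ι] in
lemma weightsIn_derivation_cartan (i : b.support) :
    C.WeightsIn (δ (C.basis (Sum.inl i))) {μ} := by
  have := endWeightsIn_iff.1 hw (Sum.inl i)
  rwa [Set.singleton_add_singleton, RootDatum.basisWeight, Sum.elim_inl, Pi.zero_apply,
    zero_add] at this

include hδ

/-- Such a δ commutes with ad h_i but shifts the eigenvalues of ad h_i by ⟨μ, α_i^∨⟩, which is
nonzero for some i. -/
lemma derivation_eq_zero (hμ : μ ∈ Submodule.span ℤ (Set.range Φ.root)) (hμ0 : μ ≠ 0)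
    (h0 : ∀ i : b.support, δ (C.basis (Sum.inl i)) = 0) : δ = 0 := by
  have := Module.Free.of_basis C.basis
  obtain ⟨i, hi⟩ := Φ.exists_pairing_ne_zero b hμ hμ0
  refine C.basis.ext fun j => ?_
  rw [LinearMap.zero_apply]
  have h1 := hδ (C.basis (Sum.inl i)) (C.basis j)
  have h2 := endWeightsIn_iff.1 hw j
  rw [Set.singleton_add_singleton] at h2
  rw [h0, zero_lie, zero_add, (weightsIn_basis j).lie_cartan, h2.lie_cartan, map_smul, map_add,
    LinearMap.add_apply, add_smul, left_eq_add] at h1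
  exact (smul_eq_zero.1 h1).resolve_left hi

/-- The homogeneous derivations of nonzero weight over `ℤ` are the multiples of the `ad e_α`. -/
lemma exists_derivation_eq_smul [Φ.IsReduced] {α : ι} (hα : Φ.root α = μ) :
    ∃ c : ℤ, δ = c • C.adRoot α := by
  have := Module.Free.of_basis C.basis
  have hμ : μ ∈ Submodule.span ℤ (Set.range Φ.root) :=
    hα ▸ Submodule.subset_span ⟨α, rfl⟩
  have hμ0 : μ ≠ 0 := hα ▸ Φ.ne_zero α
  obtain ⟨i, hi⟩ := Φ.exists_pairing_ne_zero b hμ hμ0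
  rw [← hα, Φ.root_coroot_eq_pairing] at hi
  have hd : ∀ j : b.support, ∃ d : ℤ, δ (C.basis (Sum.inl j)) = d • C.basis (Sum.inr α) :=
    fun j => ⟨_, (hα ▸ weightsIn_derivation_cartan hw j :
      C.WeightsIn (δ (C.basis (Sum.inl j))) {Φ.root α}).eq_smul⟩
  choose d hd using hd
  have hne : C.basis (Sum.inr α) ≠ 0 := C.basis.ne_zero _
  -- Applying δ to [h_i, h_j] = 0 shows that the values of δ on the Cartan part are proportional to
  -- those of ad e_α.
  have hdd : ∀ j, Φ.pairing α i * d j = d i * Φ.pairing α j := by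
    intro j
    have h1 := hδ (C.basis (Sum.inl i)) (C.basis (Sum.inl j))
    rw [C.lie_h_h, map_zero, hd, hd, smul_lie, lie_smul, ← lie_skew, C.lie_h_e, C.lie_h_e,
      smul_neg, smul_smul, smul_smul, ← neg_smul, ← add_smul] at h1
    have h2 := (smul_eq_zero.1 h1.symm).resolve_right hne
    linarith
  have hlin : Φ.pairing α i • δ + d i • C.adRoot α = 0 := by
    refine derivation_eq_zero (C := C) (μ := μ) (fun x y => ?_) ?_ hμ hμ0 fun j => ?_
    · have h1 := leibniz_lie (C.basis (Sum.inr α)) x y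
      simp only [LinearMap.add_apply, LinearMap.smul_apply, hδ, adRoot_apply,
        add_lie, lie_add, smul_lie, lie_smul, h1]
      module
    · exact (hw.smul _).add ((hα ▸ endWeightsIn_adRoot α).smul _)
    · rw [LinearMap.add_apply, LinearMap.smul_apply, LinearMap.smul_apply, hd, adRoot_cartan,
        smul_neg, smul_smul, smul_smul, hdd, add_neg_cancel]
  -- So far δ is a rational multiple of ad e_α. Evaluation at e_{-α} gives ⟨α, α_i^∨⟩ ∣ d_i c_j for
  -- all coefficients c_j of α^∨, and primitivity of the coroot removes the c_j.
  have hdvd : Φ.pairing α i ∣ d i := by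
    obtain ⟨c, hc⟩ := exists_coroot_eq_sum b α
    have hneg : Φ.root (Φ.reflectionPerm α α) = -Φ.root α := by simp
    have h1 := congrArg (fun T => T (C.basis (Sum.inr (Φ.reflectionPerm α α)))) hlin
    simp only [LinearMap.add_apply, LinearMap.smul_apply, LinearMap.zero_apply] at h1
    rw [adRoot_apply, C.lie_e_e_neg α _ c hneg hc] at h1
    set x := δ (C.basis (Sum.inr (Φ.reflectionPerm α α)))
    have h2 : ∀ j, Φ.pairing α i ∣ d i * c j := by
      intro j
      have h3 := congrArg (fun v => C.basis.repr v (Sum.inl j)) h1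
      simp only [map_add, map_smul, map_sum, Finsupp.add_apply, Finsupp.smul_apply,
        Finsupp.finsetSum_apply, Module.Basis.repr_self, smul_eq_mul, map_zero,
        Finsupp.zero_apply, Finsupp.single_apply, Sum.inl.injEq] at h3
      rw [Finset.sum_eq_single j (by intro k _ hk; simp [hk]) (by simp), if_pos rfl, mul_one] at h3
      exact ⟨-C.basis.repr x (Sum.inl j), by linarith⟩
    have hn : Int.gcd (Φ.pairing α i) (d i) ≠ 0 := fun h => hi (Int.gcd_eq_zero_iff.1 h).1
    obtain ⟨m, e, hcop, hm, he⟩ := Int.exists_gcd_one (Nat.pos_of_ne_zero hn)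
    set k : ℤ := (Int.gcd (Φ.pairing α i) (d i) : ℤ)
    have hk : k ≠ 0 := Int.natCast_ne_zero.2 hn
    -- Here m is ⟨α, α_i^∨⟩ divided by its gcd with d_i; a common divisor of all coefficients of α^∨
    -- is a unit.
    have h3 : ∀ j, m ∣ c j := by
      intro j
      have h4 := h2 j
      rw [hm, he, mul_comm e, mul_assoc, mul_comm m] at h4
      exact (Int.isCoprime_iff_gcd_eq_one.2 hcop).dvd_of_dvd_mul_left
        ((mul_dvd_mul_iff_left hk).1 h4)
    choose c' hc' using h3
    have hu : IsUnit m := by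
      refine Φ.isUnit_of_coroot_eq_smul b α (v := ∑ j : b.support, c' j • Φ.coroot j) ?_ ?_
      · exact Submodule.sum_mem _ fun j _ => Submodule.smul_mem _ _
          (Submodule.subset_span ⟨j, j.2, rfl⟩)
      · rw [hc, Finset.smul_sum]
        simp_rw [smul_smul, ← hc']
    rw [hm, he]
    exact mul_dvd_mul (hu.dvd) dvd_rfl
  obtain ⟨e, he⟩ := hdvd
  refine ⟨-e, ?_⟩
  have h1 : Φ.pairing α i • δ = Φ.pairing α i • ((-e) • C.adRoot α) := by
    rw [he] at hlin
    rw [eq_neg_of_add_eq_zero_left hlin]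
    module
  refine LinearMap.ext fun x => ?_
  exact smul_right_injective L hi (congrArg (fun T => T x) h1)

end ChevalleyBasis
end Derivations

/-! ### Unipotent automorphisms as products of root elements -/

section Unipotent

variable {ι X Y : Type*} [AddCommGroup X] [AddCommGroup Y] [Fintype ι] [DecidableEq ι]
  {Φ : RootDatum ι X Y} {b : Φ.Base} {L : Type*} [LieRing L] {C : ChevalleyBasis Φ b L}

namespace ChevalleyBasis

omit [DecidableEq ι] in
lemma EndWeightsIn.mul_of_forall {f g : Module.End ℤ L} {S T V : Set X} (hf : C.EndWeightsIn f S)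
    (hg : C.EndWeightsIn g T) (h : ∀ μ ∈ S, ∀ ν ∈ T, ∀ i j,
      Φ.basisWeight b i - Φ.basisWeight b j = μ + ν → μ + ν ∈ V) : C.EndWeightsIn (f * g) V := by
  refine (hf.mul hg).mono ?_
  rintro i j ⟨μ, hμ, ν, hν, hs⟩
  rw [← hs]
  exact h μ hμ ν hν i j hs.symm

variable [Φ.IsReduced]

lemma EndWeightsIn.divEnd {α : ι} {k : ℕ} {S : Set X} (h : C.EndWeightsIn (C.adRoot α ^ k) S) :
    C.EndWeightsIn (C.divEnd α k) S := by
  intro i j hij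
  apply h i j
  rw [← C.factorial_smul_divEnd, LinearMap.smul_apply, map_smul, Finsupp.smul_apply, smul_eq_mul]
  exact mul_ne_zero (by exact_mod_cast k.factorial_ne_zero) hij

lemma rootEnd_sub_one_sub (α : ι) (c : ℤ) :
    C.rootEnd α c - 1 - c • C.adRoot α = c ^ 2 • C.divEnd α 2 + c ^ 3 • C.divEnd α 3 := by
  simp only [rootEnd, dividedExp, Finset.sum_range_succ, Finset.sum_range_zero, C.divEnd_zero,
    C.divEnd_one]
  module

lemma endWeightsIn_rootEnd_sub_one_sub {α : ι} (c : ℤ) {S T : Set X} (hα : Φ.root α ∈ S)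
    (hT : T ⊆ S)
    (h : ∀ μ ∈ S, ∀ ν ∈ S, ∀ i j, Φ.basisWeight b i - Φ.basisWeight b j = μ + ν → μ + ν ∈ T) :
    C.EndWeightsIn (C.rootEnd α c - 1 - c • C.adRoot α) T := by
  have h1 : C.EndWeightsIn (C.adRoot α) S :=
    (endWeightsIn_adRoot α).mono_subset (Set.singleton_subset_iff.2 hα)
  have h2 : C.EndWeightsIn (C.adRoot α ^ 2) T := by
    rw [pow_two]
    exact h1.mul_of_forall h1 h
  have h3 : C.EndWeightsIn (C.adRoot α ^ 3) T := by
    rw [pow_succ]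
    exact (h2.mono_subset hT).mul_of_forall h1 h
  rw [rootEnd_sub_one_sub]
  exact (h2.divEnd.smul _).add (h3.divEnd.smul _)

/-- The linear term -c ad e_α of x_α(-c) cancels that of g. What remains consists of products, with
weights in sums of two elements of S, and of the rest of g. -/
lemma rootEnd_mul_sub_one {α : ι} (c : ℤ) {g : Module.End ℤ L} {S T : Set X}
    (hg : C.EndWeightsIn (g - 1) S) (hg' : C.EndWeightsIn (g - 1 - c • C.adRoot α) T)
    (hα : Φ.root α ∈ S) (hT : T ⊆ S)
    (h : ∀ μ ∈ S, ∀ ν ∈ S, ∀ i j, Φ.basisWeight b i - Φ.basisWeight b j = μ + ν → μ + ν ∈ T) :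
    C.EndWeightsIn (C.rootEnd α (-c) * g - 1) T := by
  have h1 := endWeightsIn_rootEnd_sub_one_sub (C := C) (-c) hα hT h
  have h2 : C.EndWeightsIn (C.rootEnd α (-c) - 1) S := by
    have h3 := (h1.mono_subset hT).add
      (((endWeightsIn_adRoot (C := C) α).mono_subset (Set.singleton_subset_iff.2 hα)).smul (-c))
    rwa [sub_add_cancel] at h3
  have : C.rootEnd α (-c) * g - 1 = (C.rootEnd α (-c) - 1) * (g - 1) +
      (C.rootEnd α (-c) - 1 - (-c) • C.adRoot α) + (g - 1 - c • C.adRoot α) := by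
    rw [sub_mul, mul_sub, one_mul, mul_one]
    module
  rw [this]
  exact ((h2.mul_of_forall hg h).add h1).add hg'

/-- A unipotent automorphism with weights in a set closed under addition is a product of root
elements. -/
theorem mem_closure_rootEnd (ht : X → ℕ) (U : Finset X) (hpos : ∀ μ ∈ U, 0 < ht μ)
    (hadd : ∀ μ ∈ U, ∀ ν ∈ U, ht (μ + ν) = ht μ + ht ν)
    (hclosed : ∀ μ ∈ U, ∀ ν ∈ U, ∀ i j,
      Φ.basisWeight b i - Φ.basisWeight b j = μ + ν → μ + ν ∈ U)
    (hspan : ∀ μ ∈ U, μ ∈ Submodule.span ℤ (Set.range Φ.root) ∧ μ ≠ 0) {g : Module.End ℤ L}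
    (hg : ∀ x y, g ⁅x, y⁆ = ⁅g x, g y⁆) (hw : C.EndWeightsIn (g - 1) U) :
    g ∈ Submonoid.closure {f | ∃ α c, Φ.root α ∈ U ∧ f = C.rootEnd α c} := by
  classical
  induction hn : U.card using Nat.strong_induction_on generalizing U g with
  | _ n ih =>
  rcases U.eq_empty_or_nonempty with rfl | hne
  · have : g - 1 = 0 := by
      refine C.basis.ext fun j => C.basis.repr.injective (Finsupp.ext fun i => ?_)
      by_contra hc
      have := hw i j (by simpa using hc)
      simp at this
    rw [sub_eq_zero.1 this]
    exact one_mem _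
  -- A weight of least height is not a sum of two weights of U. So the component of weight μ is a
  -- derivation, and μ can be dropped from U without losing closedness.
  obtain ⟨μ, hμ, hmin⟩ := U.exists_min_image ht hne
  have hμU : ∀ ν ∈ U, ∀ ν' ∈ U, ν + ν' ≠ μ := by
    rintro ν hν ν' hν' rfl
    have := hadd ν hν ν' hν'
    have := hmin ν hν
    have := hpos ν' hν'
    lia
  have hclosed' : ∀ ν ∈ U, ∀ ν' ∈ U, ∀ i j,
      Φ.basisWeight b i - Φ.basisWeight b j = ν + ν' → ν + ν' ∈ U.erase μ :=
    fun ν hν ν' hν' i j hij => Finset.mem_erase.2 ⟨hμU ν hν ν' hν', hclosed ν hν ν' hν' i j hij⟩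
  have hsub : U.erase μ ⊆ U := Finset.erase_subset _ _
  have key : ∀ {g : Module.End ℤ L}, (∀ x y, g ⁅x, y⁆ = ⁅g x, g y⁆) →
      C.EndWeightsIn (g - 1) (U.erase μ) →
      g ∈ Submonoid.closure {f | ∃ α c, Φ.root α ∈ U ∧ f = C.rootEnd α c} := by
    intro g hg hw
    refine Submonoid.closure_mono ?_ (ih _ (hn ▸ Finset.card_erase_lt_of_mem hμ) (U.erase μ)
      (fun ν hν => hpos ν (hsub hν)) (fun ν hν ν' hν' => hadd ν (hsub hν) ν' (hsub hν'))
      (fun ν hν ν' hν' => hclosed' ν (hsub hν) ν' (hsub hν')) (fun ν hν => hspan ν (hsub hν))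
      hg hw rfl)
    rintro _ ⟨α, c, hα, rfl⟩
    exact ⟨α, c, hsub hα, rfl⟩
  have hder := endComponent_lie hg hw (μ := μ) (by
    rintro ⟨ν, hν, ν', hν', h⟩
    exact hμU ν hν ν' hν' h)
  have hcomp := endWeightsIn_endComponent (C := C) μ (g - 1)
  have hrest := hw.sub_endComponent μ
  rw [← Finset.coe_erase] at hrest
  by_cases hroot : μ ∈ Set.range Φ.root
  · obtain ⟨α, hα⟩ := hroot
    obtain ⟨c, hc⟩ := exists_derivation_eq_smul hder hcomp hα
    rw [hc] at hrest
    have h1 : C.EndWeightsIn (C.rootEnd α (-c) * g - 1) (U.erase μ) :=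
      rootEnd_mul_sub_one c hw hrest (hα ▸ hμ) hsub hclosed'
    have h2 := key (g := C.rootEnd α (-c) * g)
      (fun x y => by simp only [Module.End.mul_apply, hg, C.rootEnd_lie]) h1
    have h3 : g = C.rootEnd α c * (C.rootEnd α (-c) * g) := by
      rw [← mul_assoc, ← C.rootEnd_add, add_neg_cancel, C.rootEnd_zero, one_mul]
    rw [h3]
    exact mul_mem (Submonoid.subset_closure ⟨α, c, hα ▸ hμ, rfl⟩) h2
  -- If μ is not a root, its weight space is zero; the derivation then kills the Cartan part and
  -- hence vanishes.
  · have h0 : C.endComponent μ (g - 1) = 0 :=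
      derivation_eq_zero hder hcomp (hspan μ hμ).1 (hspan μ hμ).2 fun i =>
        (weightsIn_derivation_cartan hcomp i).eq_zero (hspan μ hμ).2 hroot
    rw [h0, sub_zero] at hrest
    exact key hg hrest

end ChevalleyBasis
end Unipotent

/-! ### The commutator of two root elements over ℤ -/

section Commutator

variable {ι X Y : Type*} [AddCommGroup X] [AddCommGroup Y] {Φ : RootDatum ι X Y} {b : Φ.Base}

/-- The combinations `i α + j β` with `(i, j) ∈ V`. -/
def rootCone (Φ : RootDatum ι X Y) (α β : ι) (V : Set (ℕ × ℕ)) : Set X :=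
  {μ | ∃ p ∈ V, μ = p.1 • Φ.root α + p.2 • Φ.root β}

lemma add_mem_rootCone {α β : ι} {V V' W : Set (ℕ × ℕ)} (h : ∀ p ∈ V, ∀ q ∈ V', p + q ∈ W)
    {μ ν : X} (hμ : μ ∈ rootCone Φ α β V) (hν : ν ∈ rootCone Φ α β V') :
    μ + ν ∈ rootCone Φ α β W := by
  obtain ⟨p, hp, rfl⟩ := hμ
  obtain ⟨q, hq, rfl⟩ := hν
  exact ⟨p + q, h p hp q hq, by rw [Prod.fst_add, Prod.snd_add, add_smul, add_smul]; abel⟩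

lemma rootCone_mono {α β : ι} {V W : Set (ℕ × ℕ)} (h : V ⊆ W) :
    rootCone Φ α β V ⊆ rootCone Φ α β W := fun _ ⟨p, hp, hμ⟩ => ⟨p, h hp, hμ⟩

lemma root_left_mem_rootCone {α β : ι} {V : Set (ℕ × ℕ)} (h : (1, 0) ∈ V) :
    Φ.root α ∈ rootCone Φ α β V := ⟨_, h, by simp⟩

lemma root_right_mem_rootCone {α β : ι} {V : Set (ℕ × ℕ)} (h : (0, 1) ∈ V) :
    Φ.root β ∈ rootCone Φ α β V := ⟨_, h, by simp⟩

lemma smul_add_smul_injective {α β : ι} (h : LinearIndependent ℤ ![Φ.root α, Φ.root β])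
    {p q : ℕ × ℕ} (hpq : p.1 • Φ.root α + p.2 • Φ.root β = q.1 • Φ.root α + q.2 • Φ.root β) :
    p = q := by
  have := LinearIndependent.pair_iff.1 h (p.1 - q.1 : ℤ) (p.2 - q.2 : ℤ) (by
    linear_combination (norm := module) hpq)
  ext <;> lia

variable [Fintype ι] [DecidableEq ι] {L : Type*} [LieRing L] {C : ChevalleyBasis Φ b L}

namespace ChevalleyBasis

omit [DecidableEq ι] in
lemma EndWeightsIn.mul_rootCone {α β : ι} {V V' W : Set (ℕ × ℕ)} {f g : Module.End ℤ L}
    (hf : C.EndWeightsIn f (rootCone Φ α β V)) (hg : C.EndWeightsIn g (rootCone Φ α β V'))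
    (h : ∀ p ∈ V, ∀ q ∈ V', p + q ∈ W) : C.EndWeightsIn (f * g) (rootCone Φ α β W) :=
  hf.mul_of_forall hg fun _ hμ _ hν _ _ _ => add_mem_rootCone h hμ hν

variable [Φ.IsReduced]

/-- By linear independence i + j is a well-defined height of iα + jβ, and only the finitely many
differences of basis weights in the cone matter. -/
theorem mem_closure_rootEnd_of_rootCone {α β : ι}
    (h : LinearIndependent ℤ ![Φ.root α, Φ.root β]) {V : Set (ℕ × ℕ)}
    (hV : ∀ p ∈ V, ∀ q ∈ V, p + q ∈ V) (hV0 : (0, 0) ∉ V) {g : Module.End ℤ L}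
    (hg : ∀ x y, g ⁅x, y⁆ = ⁅g x, g y⁆) (hw : C.EndWeightsIn (g - 1) (rootCone Φ α β V)) :
    g ∈ Submonoid.closure {f | ∃ ε c, Φ.root ε ∈ rootCone Φ α β V ∧ f = C.rootEnd ε c} := by
  classical
  let ht : X → ℕ := fun μ => if hμ : ∃ p : ℕ × ℕ, μ = p.1 • Φ.root α + p.2 • Φ.root β then
    hμ.choose.1 + hμ.choose.2 else 0
  have hht : ∀ p : ℕ × ℕ, ht (p.1 • Φ.root α + p.2 • Φ.root β) = p.1 + p.2 := by
    intro p
    have hp : ∃ q : ℕ × ℕ, p.1 • Φ.root α + p.2 • Φ.root β = q.1 • Φ.root α + q.2 • Φ.root β :=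
      ⟨p, rfl⟩
    dsimp only [ht]
    rw [dif_pos hp, ← smul_add_smul_injective h hp.choose_spec]
  let U : Finset X := ((Finset.univ : Finset ((b.support ⊕ ι) × (b.support ⊕ ι))).image
    fun ij => Φ.basisWeight b ij.1 - Φ.basisWeight b ij.2).filter (· ∈ rootCone Φ α β V)
  have hU : ∀ μ ∈ U, μ ∈ rootCone Φ α β V := fun μ hμ => (Finset.mem_filter.1 hμ).2
  have hU' : ∀ i j, Φ.basisWeight b i - Φ.basisWeight b j ∈ rootCone Φ α β V →
      Φ.basisWeight b i - Φ.basisWeight b j ∈ U := fun i j hij =>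
    Finset.mem_filter.2 ⟨Finset.mem_image.2 ⟨(i, j), Finset.mem_univ _, rfl⟩, hij⟩
  refine Submonoid.closure_mono ?_ (mem_closure_rootEnd ht U ?_ ?_ ?_ ?_ hg
    (hw.mono fun i j hij => hU' i j hij))
  · rintro _ ⟨ε, c, hε, rfl⟩
    exact ⟨ε, c, hU _ hε, rfl⟩
  · intro μ hμ
    obtain ⟨p, hp, rfl⟩ := hU μ hμ
    rw [hht]
    by_contra hc
    have : p = (0, 0) := by ext <;> dsimp only <;> lia
    exact hV0 (this ▸ hp)
  · intro μ hμ ν hν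
    obtain ⟨p, hp, rfl⟩ := hU μ hμ
    obtain ⟨q, hq, rfl⟩ := hU ν hν
    have : p.1 • Φ.root α + p.2 • Φ.root β + (q.1 • Φ.root α + q.2 • Φ.root β) =
        (p + q).1 • Φ.root α + (p + q).2 • Φ.root β := by
      rw [Prod.fst_add, Prod.snd_add, add_smul, add_smul]; abel
    rw [this, hht, hht, hht, Prod.fst_add, Prod.snd_add]
    ring
  · intro μ hμ ν hν i j hij
    rw [← hij]
    apply hU'
    rw [hij]
    exact add_mem_rootCone hV (hU μ hμ) (hU ν hν)
  · intro μ hμ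
    obtain ⟨p, hp, rfl⟩ := hU μ hμ
    refine ⟨add_mem (nsmul_mem (Submodule.subset_span (Set.mem_range_self α)) _)
      (nsmul_mem (Submodule.subset_span (Set.mem_range_self β)) _), fun h0 => hV0 ?_⟩
    have := smul_add_smul_injective h (q := (0, 0)) (h0.trans (by simp))
    exact this ▸ hp

lemma endWeightsIn_rootEnd_sub_one {α : ι} (c : ℤ) {S : Set X} (hα : Φ.root α ∈ S)
    (h : ∀ μ ∈ S, ∀ ν ∈ S, μ + ν ∈ S) : C.EndWeightsIn (C.rootEnd α c - 1) S := by
  have h1 := (endWeightsIn_rootEnd_sub_one_sub (C := C) c hα subset_rfl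
    fun μ hμ ν hν _ _ _ => h μ hμ ν hν).add
    (((endWeightsIn_adRoot (C := C) α).mono_subset (Set.singleton_subset_iff.2 hα)).smul c)
  rwa [sub_add_cancel] at h1

variable (C)

/-- The commutator of two root elements over `ℤ`. -/
def commutatorEnd (α β : ι) : Module.End ℤ L :=
  C.rootEnd α 1 * C.rootEnd β 1 * C.rootEnd α (-1) * C.rootEnd β (-1)

lemma commutatorEnd_lie (α β : ι) (x y : L) :
    C.commutatorEnd α β ⁅x, y⁆ = ⁅C.commutatorEnd α β x, C.commutatorEnd α β y⁆ := by
  simp only [commutatorEnd, Module.End.mul_apply, C.rootEnd_lie]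

lemma rootEnd_mul_rootEnd_neg (α : ι) (c : ℤ) : C.rootEnd α c * C.rootEnd α (-c) = 1 := by
  rw [← C.rootEnd_add, add_neg_cancel, C.rootEnd_zero]

/-- In this form every term contains both x_α(1) - 1 and x_β(1) - 1, so its weights have i, j ≥ 1.
-/
lemma commutatorEnd_sub_one (α β : ι) : C.commutatorEnd α β - 1 =
    ((C.rootEnd α 1 - 1) * (C.rootEnd β 1 - 1) - (C.rootEnd β 1 - 1) * (C.rootEnd α 1 - 1)) *
      (C.rootEnd α (-1) * C.rootEnd β (-1)) := by
  have h : C.rootEnd β 1 * C.rootEnd α 1 * (C.rootEnd α (-1) * C.rootEnd β (-1)) = 1 := by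
    rw [mul_assoc, ← mul_assoc (C.rootEnd α 1), C.rootEnd_mul_rootEnd_neg, one_mul,
      C.rootEnd_mul_rootEnd_neg]
  have h2 : (C.rootEnd α 1 - 1) * (C.rootEnd β 1 - 1) -
      (C.rootEnd β 1 - 1) * (C.rootEnd α 1 - 1) =
      C.rootEnd α 1 * C.rootEnd β 1 - C.rootEnd β 1 * C.rootEnd α 1 := by noncomm_ring
  rw [h2, sub_mul, h, commutatorEnd, ← mul_assoc]

variable {C}

lemma endWeightsIn_rootEnd_mul_sub_one (α β : ι) (s t : ℤ) :
    C.EndWeightsIn (C.rootEnd α s * C.rootEnd β t - 1) (rootCone Φ α β {p | p ≠ 0}) := by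
  have hadd : ∀ p ∈ {p : ℕ × ℕ | p ≠ 0}, ∀ q ∈ {p : ℕ × ℕ | p ≠ 0}, p + q ∈ {p : ℕ × ℕ | p ≠ 0} :=
    fun p hp q _ h => hp (by rw [Prod.ext_iff] at h ⊢; simp at h ⊢; lia)
  have ha : C.EndWeightsIn (C.rootEnd α s - 1) (rootCone Φ α β {p | p ≠ 0}) :=
    endWeightsIn_rootEnd_sub_one s (root_left_mem_rootCone (by simp))
      fun _ hμ _ hν => add_mem_rootCone hadd hμ hν
  have hb : C.EndWeightsIn (C.rootEnd β t - 1) (rootCone Φ α β {p | p ≠ 0}) :=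
    endWeightsIn_rootEnd_sub_one t (root_right_mem_rootCone (by simp))
      fun _ hμ _ hν => add_mem_rootCone hadd hμ hν
  have h : C.rootEnd α s * C.rootEnd β t - 1 =
      (C.rootEnd α s - 1) * (C.rootEnd β t - 1) + (C.rootEnd α s - 1) + (C.rootEnd β t - 1) := by
    noncomm_ring
  rw [h]
  exact ((ha.mul_rootCone hb hadd).add ha).add hb

lemma endWeightsIn_rootEnd_mul (α β : ι) (s t : ℤ) :
    C.EndWeightsIn (C.rootEnd α s * C.rootEnd β t) (rootCone Φ α β Set.univ) := by
  have h := ((endWeightsIn_rootEnd_mul_sub_one (C := C) α β s t).mono_subset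
    (rootCone_mono (Set.subset_univ _))).add (endWeightsIn_one.mono_subset (C := C)
      (T := rootCone Φ α β Set.univ) (Set.singleton_subset_iff.2 ⟨0, trivial, by simp⟩))
  rwa [sub_add_cancel] at h

lemma endWeightsIn_commutatorEnd (α β : ι) :
    C.EndWeightsIn (C.commutatorEnd α β - 1) (rootCone Φ α β {p | 1 ≤ p.1 ∧ 1 ≤ p.2}) ∧
    C.EndWeightsIn (C.commutatorEnd α β - 1 -
      (C.adRoot α * C.adRoot β - C.adRoot β * C.adRoot α))
      (rootCone Φ α β {p | (1 ≤ p.1 ∧ 1 ≤ p.2) ∧ p ≠ (1, 1)}) := by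
  set a := C.rootEnd α 1
  set d := C.rootEnd β 1
  set A := C.adRoot α
  set B := C.adRoot β
  set w := C.rootEnd α (-1) * C.rootEnd β (-1) with hw
  have ha : C.EndWeightsIn (a - 1) (rootCone Φ α β {p | 1 ≤ p.1}) :=
    endWeightsIn_rootEnd_sub_one 1 (root_left_mem_rootCone (by simp))
      fun _ hμ _ hν => add_mem_rootCone (by
        rintro p hp q -; simp only [Set.mem_ofPred_eq, Prod.fst_add] at *; lia) hμ hν
  have hd : C.EndWeightsIn (d - 1) (rootCone Φ α β {p | 1 ≤ p.2}) :=
    endWeightsIn_rootEnd_sub_one 1 (root_right_mem_rootCone (by simp))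
      fun _ hμ _ hν => add_mem_rootCone (by
        rintro p hp q -; simp only [Set.mem_ofPred_eq, Prod.snd_add] at *; lia) hμ hν
  have hA : C.EndWeightsIn A (rootCone Φ α β {p | 1 ≤ p.1}) :=
    (endWeightsIn_adRoot α).mono_subset
      (Set.singleton_subset_iff.2 (root_left_mem_rootCone (by simp)))
  have hB : C.EndWeightsIn B (rootCone Φ α β {p | 1 ≤ p.2}) :=
    (endWeightsIn_adRoot β).mono_subset
      (Set.singleton_subset_iff.2 (root_right_mem_rootCone (by simp)))
  have haA : C.EndWeightsIn (a - 1 - A) (rootCone Φ α β {p | 2 ≤ p.1}) := by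
    have := endWeightsIn_rootEnd_sub_one_sub (C := C) (α := α) 1
      (S := rootCone Φ α β {p | 1 ≤ p.1}) (T := rootCone Φ α β {p | 2 ≤ p.1})
      (root_left_mem_rootCone (by simp)) (rootCone_mono (by
        rintro p hp; simp only [Set.mem_ofPred_eq] at *; lia))
      fun _ hμ _ hν _ _ _ => add_mem_rootCone (by
        rintro p hp q hq; simp only [Set.mem_ofPred_eq, Prod.fst_add] at *; lia) hμ hν
    rwa [one_smul] at this
  have hdB : C.EndWeightsIn (d - 1 - B) (rootCone Φ α β {p | 2 ≤ p.2}) := by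
    have := endWeightsIn_rootEnd_sub_one_sub (C := C) (α := β) 1
      (S := rootCone Φ α β {p | 1 ≤ p.2}) (T := rootCone Φ α β {p | 2 ≤ p.2})
      (root_right_mem_rootCone (by simp)) (rootCone_mono (by
        rintro p hp; simp only [Set.mem_ofPred_eq] at *; lia))
      fun _ hμ _ hν _ _ _ => add_mem_rootCone (by
        rintro p hp q hq; simp only [Set.mem_ofPred_eq, Prod.snd_add] at *; lia) hμ hν
    rwa [one_smul] at this
  have hw1 : C.EndWeightsIn (w - 1) (rootCone Φ α β {p | p ≠ 0}) :=
    endWeightsIn_rootEnd_mul_sub_one α β (-1) (-1)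
  have hwu : C.EndWeightsIn w (rootCone Φ α β Set.univ) := endWeightsIn_rootEnd_mul α β (-1) (-1)
  rw [C.commutatorEnd_sub_one]
  constructor
  · refine EndWeightsIn.mul_rootCone (V := {p | 1 ≤ p.1 ∧ 1 ≤ p.2}) (V' := Set.univ) ?_ hwu ?_
    · refine (ha.mul_rootCone hd ?_).sub (hd.mul_rootCone ha ?_) <;>
      · rintro p hp q hq
        simp only [Set.mem_ofPred_eq, Prod.fst_add, Prod.snd_add] at *
        lia
    · rintro p hp q -
      simp only [Set.mem_ofPred_eq, Prod.fst_add, Prod.snd_add] at *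
      lia
  -- The factors a - 1, d - 1 and w are replaced by A, B and 1 one at a time; each error raises the
  -- weight above α + β.
  · have key : ((a - 1) * (d - 1) - (d - 1) * (a - 1)) * w - (A * B - B * A) =
        ((a - 1 - A) * (d - 1) + A * (d - 1 - B) - (d - 1 - B) * (a - 1) - B * (a - 1 - A)) * w +
        (A * B - B * A) * (w - 1) := by noncomm_ring
    rw [key]
    refine EndWeightsIn.add ?_ ?_
    · refine EndWeightsIn.mul_rootCone (V := {p | (1 ≤ p.1 ∧ 1 ≤ p.2) ∧ p ≠ (1, 1)})
        (V' := Set.univ) ?_ hwu ?_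
      · refine (((haA.mul_rootCone hd ?_).add (hA.mul_rootCone hdB ?_)).sub
          (hdB.mul_rootCone ha ?_)).sub (hB.mul_rootCone haA ?_) <;>
        · rintro ⟨p, p'⟩ hp ⟨q, q'⟩ hq
          simp only [Set.mem_ofPred_eq, Prod.mk_add_mk, ne_eq, Prod.mk.injEq] at *
          lia
      · rintro ⟨p, p'⟩ hp ⟨q, q'⟩ -
        simp only [Set.mem_ofPred_eq, Prod.mk_add_mk, ne_eq, Prod.mk.injEq] at *
        lia
    · refine EndWeightsIn.mul_rootCone (V := {p | 1 ≤ p.1 ∧ 1 ≤ p.2}) ?_ hw1 ?_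
      · refine (hA.mul_rootCone hB ?_).sub (hB.mul_rootCone hA ?_) <;>
        · rintro p hp q hq
          simp only [Set.mem_ofPred_eq, Prod.fst_add, Prod.snd_add] at *
          lia
      · rintro ⟨p, p'⟩ hp ⟨q, q'⟩ hq
        simp only [Set.mem_ofPred_eq, Prod.mk_add_mk, ne_eq, Prod.mk.injEq, Prod.mk_eq_zero] at *
        lia

theorem commutatorEnd_mem_closure {α β : ι} (h : LinearIndependent ℤ ![Φ.root α, Φ.root β]) :
    C.commutatorEnd α β ∈ Submonoid.closure {f | ∃ ε c,
      Φ.root ε ∈ rootCone Φ α β {p | 1 ≤ p.1 ∧ 1 ≤ p.2} ∧ f = C.rootEnd ε c} := by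
  refine mem_closure_rootEnd_of_rootCone h ?_ (by simp) (C.commutatorEnd_lie α β)
    (endWeightsIn_commutatorEnd α β).1
  rintro p hp q -
  simp only [Set.mem_ofPred_eq, Prod.fst_add, Prod.snd_add] at *
  lia

/-- The component of weight α + β is the commutator of ad e_α and ad e_β, that is n ad e_γ, so
x_γ(-n) removes it. -/
theorem exists_rootEnd_mul_commutatorEnd_mem_closure {α β γ : ι}
    (h : LinearIndependent ℤ ![Φ.root α, Φ.root β]) (hγ : Φ.root γ = Φ.root α + Φ.root β) :
    ∃ n : ℤ, (n = Φ.chainBotCoeff α β + 1 ∨ n = -(Φ.chainBotCoeff α β + 1)) ∧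
      C.rootEnd γ (-n) * C.commutatorEnd α β ∈ Submonoid.closure {f | ∃ ε c,
      Φ.root ε ∈ rootCone Φ α β {p | (1 ≤ p.1 ∧ 1 ≤ p.2) ∧ p ≠ (1, 1)} ∧ f = C.rootEnd ε c} := by
  have hn : ∃ n : ℤ, (n = Φ.chainBotCoeff α β + 1 ∨ n = -(Φ.chainBotCoeff α β + 1)) ∧
      ⁅C.basis (Sum.inr α), C.basis (Sum.inr β)⁆ = n • C.basis (Sum.inr γ) := by
    rcases C.lie_e_e_add α β γ hγ with h1 | h1
    · exact ⟨_, Or.inl rfl, h1⟩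
    · exact ⟨_, Or.inr rfl, by rw [h1, neg_smul]⟩
  obtain ⟨n, hn, hbr⟩ := hn
  have had : C.adRoot α * C.adRoot β - C.adRoot β * C.adRoot α = n • C.adRoot γ := by
    ext x
    rw [LinearMap.sub_apply, Module.End.mul_apply, Module.End.mul_apply, LinearMap.smul_apply,
      adRoot_apply, adRoot_apply, adRoot_apply, adRoot_apply, adRoot_apply, ← smul_lie, ← hbr,
      lie_lie]
  refine ⟨n, hn, mem_closure_rootEnd_of_rootCone h ?_ (by simp) (fun x y => ?_) ?_⟩
  · rintro ⟨p, p'⟩ hp ⟨q, q'⟩ hq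
    simp only [Set.mem_ofPred_eq, Prod.mk_add_mk, ne_eq, Prod.mk.injEq] at *
    lia
  · rw [Module.End.mul_apply, commutatorEnd_lie, rootEnd_lie, Module.End.mul_apply,
      Module.End.mul_apply]
  · obtain ⟨h1, h2⟩ := endWeightsIn_commutatorEnd (C := C) α β
    rw [had] at h2
    refine rootEnd_mul_sub_one n h1 h2 ⟨(1, 1), by simp, by simpa using hγ⟩
      (rootCone_mono fun p hp => hp.1) fun _ hμ _ hν _ _ _ => add_mem_rootCone ?_ hμ hν
    rintro ⟨p, p'⟩ hp ⟨q, q'⟩ hq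
    simp only [Set.mem_ofPred_eq, Prod.mk_add_mk, ne_eq, Prod.mk.injEq] at *
    lia

end ChevalleyBasis
end Commutator

/-! ### Root groups over F and the Chevalley commutator formula -/

section RootGroups

variable {ι X Y : Type*} [AddCommGroup X] [AddCommGroup Y] {Φ : RootDatum ι X Y}

/-- The diagonal matrix of χ scales x_ε(c), ε = iα + jβ, to x_ε(s^i t^j c), so it transports
commutators with parameters (1, 1) to (s, t). A homomorphism X → Fˣ might require roots of s and t;
since only equivariance is needed, χ is chosen coset by coset of ⟨α, β⟩. -/
lemma exists_torus_character {F : Type*} [Field F] {α β : ι}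
    (h : LinearIndependent ℤ ![Φ.root α, Φ.root β]) {s t : F} (hs : s ≠ 0) (ht : t ≠ 0) :
    ∃ χ : X → F, (∀ μ, χ μ ≠ 0) ∧
      ∀ (μ : X) (i j : ℕ), χ (μ + (i • Φ.root α + j • Φ.root β)) = s ^ i * t ^ j * χ μ := by
  classical
  set W : Submodule ℤ X := Submodule.span ℤ {Φ.root α, Φ.root β}
  have hW : ∀ μ : X, ∃ p : ℤ × ℤ,
      p.1 • Φ.root α + p.2 • Φ.root β = μ - Quotient.out (W.mkQ μ) := by
    intro μ
    have : μ - Quotient.out (W.mkQ μ) ∈ W := by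
      rw [← Submodule.Quotient.mk_eq_zero, Submodule.Quotient.mk_sub, sub_eq_zero]
      exact (Quotient.out_eq (W.mkQ μ)).symm
    obtain ⟨m, n, hmn⟩ := Submodule.mem_span_pair.1 this
    exact ⟨(m, n), hmn⟩
  choose p hp using hW
  refine ⟨fun μ => s ^ (p μ).1 * t ^ (p μ).2,
    fun μ => mul_ne_zero (zpow_ne_zero _ hs) (zpow_ne_zero _ ht), fun μ i j => ?_⟩
  have hq : W.mkQ (μ + (i • Φ.root α + j • Φ.root β)) = W.mkQ μ := by
    rw [map_add, add_eq_left, Submodule.mkQ_apply, Submodule.Quotient.mk_eq_zero]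
    exact add_mem (nsmul_mem (Submodule.subset_span (by simp)) _)
      (nsmul_mem (Submodule.subset_span (by simp)) _)
  have h1 := hp (μ + (i • Φ.root α + j • Φ.root β))
  rw [hq] at h1
  have h2 := LinearIndependent.pair_iff.1 h
    ((p (μ + (i • Φ.root α + j • Φ.root β))).1 - (p μ).1 - i)
    ((p (μ + (i • Φ.root α + j • Φ.root β))).2 - (p μ).2 - j) (by
      linear_combination (norm := module) h1 - hp μ)
  dsimp only
  rw [show (p (μ + (i • Φ.root α + j • Φ.root β))).1 = i + (p μ).1 by lia,
    show (p (μ + (i • Φ.root α + j • Φ.root β))).2 = j + (p μ).2 by lia, zpow_add₀ hs,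
    zpow_add₀ ht, zpow_natCast, zpow_natCast]
  ring

variable [Fintype ι] [DecidableEq ι] {b : Φ.Base} {L : Type*} [LieRing L]
  (C : ChevalleyBasis Φ b L) (F : Type*) [Field F]

namespace ChevalleyBasis

/-- The matrix over `F` of an endomorphism of the Lie ring in the Chevalley basis. -/
def toMat : Module.End ℤ L →+* Matrix (b.support ⊕ ι) (b.support ⊕ ι) F :=
  (Int.castRingHom F).mapMatrix.comp (LinearMap.toMatrixAlgEquiv C.basis).toRingEquiv.toRingHom

lemma toMat_apply (f : Module.End ℤ L) (i j : b.support ⊕ ι) :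
    C.toMat F f i j = (C.basis.repr (f (C.basis j)) i : F) := by
  have := LinearMap.toMatrixAlgEquiv_apply C.basis f i j
  exact congrArg (Int.cast : ℤ → F) this

lemma toMat_divEnd (α : ι) (k : ℕ) :
    C.toMat F (C.divEnd α k) = (C.divPow α k).map (Int.cast : ℤ → F) := by
  ext i j
  rw [toMat_apply, Matrix.map_apply, divEnd, ← LinearMap.toMatrix_apply, LinearMap.toMatrix_toLin]

lemma rootElt_eq_dividedExp (α : ι) (t : F) :
    C.rootElt F α t = dividedExp (fun k => C.toMat F (C.divEnd α k)) t := by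
  simp only [rootElt, dividedExp, toMat_divEnd]

variable [Φ.IsReduced]

omit [Φ.IsReduced] in
lemma toMat_rootEnd (α : ι) (c : ℤ) : C.toMat F (C.rootEnd α c) = C.rootElt F α (c : F) := by
  rw [rootElt_eq_dividedExp, rootEnd, dividedExp, dividedExp, map_sum]
  refine Finset.sum_congr rfl fun k _ => ?_
  rw [map_zsmul, ← Int.cast_smul_eq_zsmul F, Int.cast_pow]

lemma rootElt_zero (α : ι) : C.rootElt F α 0 = 1 := by
  rw [rootElt_eq_dividedExp, dividedExp_zero]
  rw [C.divEnd_zero, map_one]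

lemma rootElt_add (α : ι) (s t : F) :
    C.rootElt F α (s + t) = C.rootElt F α s * C.rootElt F α t := by
  simp only [rootElt_eq_dividedExp]
  refine dividedExp_add (fun i j => ?_) (fun k hk => ?_) s t
  · rw [← map_mul, C.divEnd_mul, map_nsmul]
  · rw [C.divEnd_of_four_le α hk, map_zero]

/-- The root element `x_α(t)` as an element of the general linear group. -/
def rootGL (α : ι) (t : F) : GL (b.support ⊕ ι) F where
  val := C.rootElt F α t
  inv := C.rootElt F α (-t)
  val_inv := by rw [← rootElt_add, add_neg_cancel, rootElt_zero]
  inv_val := by rw [← rootElt_add, neg_add_cancel, rootElt_zero]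

lemma coe_rootGL (α : ι) (t : F) :
    (C.rootGL F α t : Matrix (b.support ⊕ ι) (b.support ⊕ ι) F) = C.rootElt F α t := rfl

lemma rootGL_add (α : ι) (s t : F) :
    C.rootGL F α (s + t) = C.rootGL F α s * C.rootGL F α t :=
  Units.ext (C.rootElt_add F α s t)

lemma rootGL_zero (α : ι) : C.rootGL F α 0 = 1 := Units.ext (C.rootElt_zero F α)

lemma rootGL_neg (α : ι) (t : F) : C.rootGL F α (-t) = (C.rootGL F α t)⁻¹ :=
  Units.ext rfl

lemma rootGL_comm (α : ι) (s t : F) :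
    C.rootGL F α s * C.rootGL F α t = C.rootGL F α t * C.rootGL F α s := by
  rw [← rootGL_add, ← rootGL_add, add_comm]

lemma mem_rootSubgroup {α : ι} {u : GL (b.support ⊕ ι) F} :
    u ∈ C.rootSubgroup F α ↔ ∃ t, C.rootGL F α t = u := by
  refine ⟨fun h => ?_, fun ⟨t, ht⟩ => Subgroup.subset_closure ⟨t, by rw [← ht, coe_rootGL]⟩⟩
  induction h using Subgroup.closure_induction with
  | mem u hu =>
    obtain ⟨t, ht⟩ := hu
    exact ⟨t, Units.ext ht.symm⟩
  | one => exact ⟨0, C.rootGL_zero F α⟩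
  | mul u v _ _ hu hv =>
    obtain ⟨s, rfl⟩ := hu
    obtain ⟨t, rfl⟩ := hv
    exact ⟨s + t, C.rootGL_add F α s t⟩
  | inv u _ hu =>
    obtain ⟨s, rfl⟩ := hu
    exact ⟨-s, C.rootGL_neg F α s⟩

lemma rootGL_mem_patternSubgroup {P : Set ι} {α : ι} (h : α ∈ P) (t : F) :
    C.rootGL F α t ∈ C.patternSubgroup F P :=
  Subgroup.mem_iSup_of_mem α (Subgroup.mem_iSup_of_mem h ((C.mem_rootSubgroup F).2 ⟨t, rfl⟩))

lemma patternSubgroup_le {P : Set ι} {A : Subgroup (GL (b.support ⊕ ι) F)}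
    (h : ∀ α ∈ P, ∀ t, C.rootGL F α t ∈ A) : C.patternSubgroup F P ≤ A := by
  refine iSup₂_le fun α hα u hu => ?_
  obtain ⟨t, rfl⟩ := (C.mem_rootSubgroup F).1 hu
  exact h α hα t

variable {F}

omit [Φ.IsReduced] in
lemma diagonal_mul_toMat {α β : ι} {s t : F} {χ : X → F}
    (hχ : ∀ (μ : X) (i j : ℕ), χ (μ + (i • Φ.root α + j • Φ.root β)) = s ^ i * t ^ j * χ μ)
    {f : Module.End ℤ L} {i j : ℕ} (hf : C.EndWeightsIn f {i • Φ.root α + j • Φ.root β}) :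
    Matrix.diagonal (fun x => χ (Φ.basisWeight b x)) * C.toMat F f =
      (s ^ i * t ^ j) • C.toMat F f * Matrix.diagonal (fun x => χ (Φ.basisWeight b x)) := by
  ext x y
  rw [Matrix.diagonal_mul, Matrix.mul_diagonal, Matrix.smul_apply, toMat_apply, smul_eq_mul]
  by_cases h0 : C.basis.repr (f (C.basis y)) x = 0
  · rw [h0]; simp
  · have h1 := Set.mem_singleton_iff.1 (hf x y h0)
    rw [← add_sub_cancel (Φ.basisWeight b y) (Φ.basisWeight b x), h1, hχ]
    ring

lemma diagonal_mul_rootElt {α β ε : ι} {s t : F} {χ : X → F}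
    (hχ : ∀ (μ : X) (i j : ℕ), χ (μ + (i • Φ.root α + j • Φ.root β)) = s ^ i * t ^ j * χ μ)
    {i j : ℕ} (hε : Φ.root ε = i • Φ.root α + j • Φ.root β) (c : F) :
    Matrix.diagonal (fun x => χ (Φ.basisWeight b x)) * C.rootElt F ε c =
      C.rootElt F ε (s ^ i * t ^ j * c) * Matrix.diagonal (fun x => χ (Φ.basisWeight b x)) := by
  rw [rootElt_eq_dividedExp, rootElt_eq_dividedExp, dividedExp, dividedExp, Finset.mul_sum,
    Finset.sum_mul]
  refine Finset.sum_congr rfl fun k _ => ?_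
  have hw := endWeightsIn_divEnd (C := C) ε k
  rw [hε, smul_add, smul_smul, smul_smul] at hw
  rw [mul_smul_comm, C.diagonal_mul_toMat hχ hw, smul_mul_assoc, smul_mul_assoc, smul_smul]
  congr 1
  ring

/-- A product of root elements with integral parameters becomes, after reduction to F and torus
conjugation, a product of root elements for the same roots. -/
lemma exists_mem_patternSubgroup_of_mem_closure {α β : ι} {s t : F} {χ : X → F}
    (hχ : ∀ (μ : X) (i j : ℕ), χ (μ + (i • Φ.root α + j • Φ.root β)) = s ^ i * t ^ j * χ μ)
    {V : Set (ℕ × ℕ)} {f : Module.End ℤ L}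
    (hf : f ∈ Submonoid.closure {f | ∃ ε c, Φ.root ε ∈ rootCone Φ α β V ∧ f = C.rootEnd ε c}) :
    ∃ u ∈ C.patternSubgroup F {ε | Φ.root ε ∈ rootCone Φ α β V},
      Matrix.diagonal (fun x => χ (Φ.basisWeight b x)) * C.toMat F f =
        (u : Matrix (b.support ⊕ ι) (b.support ⊕ ι) F) *
          Matrix.diagonal (fun x => χ (Φ.basisWeight b x)) := by
  induction hf using Submonoid.closure_induction with
  | mem f hf =>
    obtain ⟨ε, c, hε, rfl⟩ := hf
    obtain ⟨⟨i, j⟩, hij, h⟩ := id hε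
    exact ⟨C.rootGL F ε (s ^ i * t ^ j * c), C.rootGL_mem_patternSubgroup F hε _, by
      rw [toMat_rootEnd, C.diagonal_mul_rootElt hχ h, coe_rootGL]⟩
  | one => exact ⟨1, one_mem _, by rw [map_one, mul_one, Units.val_one, one_mul]⟩
  | mul f g _ _ hf hg =>
    obtain ⟨u, hu, hu'⟩ := hf
    obtain ⟨v, hv, hv'⟩ := hg
    exact ⟨u * v, mul_mem hu hv, by
      rw [map_mul, ← mul_assoc, hu', mul_assoc, hv', Units.val_mul, mul_assoc]⟩

lemma diagonal_mul_commutatorEnd {α β : ι} {s t : F} {χ : X → F}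
    (hχ : ∀ (μ : X) (i j : ℕ), χ (μ + (i • Φ.root α + j • Φ.root β)) = s ^ i * t ^ j * χ μ) :
    Matrix.diagonal (fun x => χ (Φ.basisWeight b x)) * C.toMat F (C.commutatorEnd α β) =
      ((⁅C.rootGL F α s, C.rootGL F β t⁆ : GL (b.support ⊕ ι) F) :
        Matrix (b.support ⊕ ι) (b.support ⊕ ι) F) *
          Matrix.diagonal (fun x => χ (Φ.basisWeight b x)) := by
  have hα : ∀ c, Matrix.diagonal (fun x => χ (Φ.basisWeight b x)) * C.rootElt F α c =
      C.rootElt F α (s * c) * Matrix.diagonal (fun x => χ (Φ.basisWeight b x)) := by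
    simpa using C.diagonal_mul_rootElt (ε := α) hχ (i := 1) (j := 0) (by simp)
  have hβ : ∀ c, Matrix.diagonal (fun x => χ (Φ.basisWeight b x)) * C.rootElt F β c =
      C.rootElt F β (t * c) * Matrix.diagonal (fun x => χ (Φ.basisWeight b x)) := by
    simpa using C.diagonal_mul_rootElt (ε := β) hχ (i := 0) (j := 1) (by simp)
  rw [commutatorElement_def, ← rootGL_neg, ← rootGL_neg, commutatorEnd]
  simp only [map_mul, toMat_rootEnd, Units.val_mul, coe_rootGL]
  have := (((SemiconjBy.mul_right (hα 1) (hβ 1)).mul_right (hα (-1))).mul_right (hβ (-1))).eq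
  simpa using this

omit [Φ.IsReduced] in
lemma eq_of_mul_diagonal_eq {χ : X → F} (hχ0 : ∀ μ, χ μ ≠ 0)
    {u v : GL (b.support ⊕ ι) F}
    (h : (u : Matrix (b.support ⊕ ι) (b.support ⊕ ι) F) *
        Matrix.diagonal (fun x => χ (Φ.basisWeight b x)) =
      v * Matrix.diagonal (fun x => χ (Φ.basisWeight b x))) : u = v := by
  ext x y
  have := congrFun (congrFun h x) y
  rw [Matrix.mul_diagonal, Matrix.mul_diagonal] at this
  exact mul_right_cancel₀ (hχ0 _) this

/-- The Chevalley commutator formula: `[x_α(s), x_β(t)]` is a product of elements of the root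
subgroups of the roots `i α + j β`, `i, j ≥ 1`. -/
theorem commutator_rootGL_mem {α β : ι} (h : LinearIndependent ℤ ![Φ.root α, Φ.root β]) (s t : F) :
    ⁅C.rootGL F α s, C.rootGL F β t⁆ ∈
      C.patternSubgroup F {ε | Φ.root ε ∈ rootCone Φ α β {p | 1 ≤ p.1 ∧ 1 ≤ p.2}} := by
  by_cases hs : s = 0
  · rw [hs, rootGL_zero, commutatorElement_one_left]
    exact one_mem _
  by_cases ht : t = 0
  · rw [ht, rootGL_zero, commutatorElement_one_right]
    exact one_mem _
  obtain ⟨χ, hχ0, hχ⟩ := exists_torus_character h hs ht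
  obtain ⟨u, hu, hu'⟩ := C.exists_mem_patternSubgroup_of_mem_closure hχ
    (commutatorEnd_mem_closure (C := C) h)
  rw [C.diagonal_mul_commutatorEnd hχ] at hu'
  rwa [eq_of_mul_diagonal_eq hχ0 hu']

/-- The Chevalley commutator formula with its first factor. -/
theorem exists_rootGL_mul_commutator_mem {α β γ : ι} (h : LinearIndependent ℤ ![Φ.root α, Φ.root β])
    (hγ : Φ.root γ = Φ.root α + Φ.root β) :
    ∃ n : ℤ, (n = Φ.chainBotCoeff α β + 1 ∨ n = -(Φ.chainBotCoeff α β + 1)) ∧ ∀ s t : F,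
      (C.rootGL F γ (n * (s * t)))⁻¹ * ⁅C.rootGL F α s, C.rootGL F β t⁆ ∈ C.patternSubgroup F
        {ε | Φ.root ε ∈ rootCone Φ α β {p | (1 ≤ p.1 ∧ 1 ≤ p.2) ∧ p ≠ (1, 1)}} := by
  obtain ⟨n, hn, hmem⟩ := exists_rootEnd_mul_commutatorEnd_mem_closure (C := C) h hγ
  refine ⟨n, hn, fun s t => ?_⟩
  by_cases hs : s = 0
  · rw [hs, zero_mul, mul_zero, rootGL_zero, rootGL_zero, commutatorElement_one_left, inv_one,
      one_mul]
    exact one_mem _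
  by_cases ht : t = 0
  · rw [ht, mul_zero, mul_zero, rootGL_zero, rootGL_zero, commutatorElement_one_right, inv_one,
      one_mul]
    exact one_mem _
  obtain ⟨χ, hχ0, hχ⟩ := exists_torus_character h hs ht
  obtain ⟨u, hu, hu'⟩ := C.exists_mem_patternSubgroup_of_mem_closure hχ hmem
  rw [map_mul, ← mul_assoc, toMat_rootEnd, C.diagonal_mul_rootElt hχ (i := 1) (j := 1)
    (by simpa using hγ), mul_assoc, C.diagonal_mul_commutatorEnd hχ, ← mul_assoc, ← coe_rootGL,
    ← Units.val_mul] at hu'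
  have h1 := eq_of_mul_diagonal_eq hχ0 hu'
  rw [← rootGL_neg]
  rw [← h1] at hu
  convert hu using 3
  push_cast
  ring

end ChevalleyBasis
end RootGroups

/-! ### Pattern subgroups, quattern groups and their root elements -/

section PatternGroups

variable {ι X Y : Type*} [AddCommGroup X] [AddCommGroup Y] {Φ : RootDatum ι X Y}
  [Fintype ι] [DecidableEq ι] {b : Φ.Base} {L : Type*} [LieRing L]
  (C : ChevalleyBasis Φ b L) (F : Type*) [Field F] [Φ.IsReduced]

namespace ChevalleyBasis

/-- The roots iα + jκ in the commutator formula are reached from α + κ by adding α or κ, so K need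
only be closed under these additions. -/
lemma commutator_rootGL_mem_patternSubgroup {α κ : ι} (hα : b.IsPos α) (hκ : b.IsPos κ) {K : Set ι}
    (hadd : ∀ ε, Φ.root ε = Φ.root α + Φ.root κ → ε ∈ K)
    (hleft : ∀ ε ε', ε ∈ K → Φ.root ε' = Φ.root ε + Φ.root α → ε' ∈ K)
    (hright : ∀ ε ε', ε ∈ K → Φ.root ε' = Φ.root ε + Φ.root κ → ε' ∈ K) (s t : F) :
    ⁅C.rootGL F α s, C.rootGL F κ t⁆ ∈ C.patternSubgroup F K := by
  by_cases h : α = κ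
  · rw [h, commutatorElement_eq_one_iff_mul_comm.2 (C.rootGL_comm F κ s t)]
    exact one_mem _
  · have hind := hα.linearIndependent hκ h
    refine C.patternSubgroup_mono F ?_ (C.commutator_rootGL_mem hind s t)
    rintro ε ⟨p, hp, hε⟩
    exact Φ.induction_of_linearIndependent hind (M := (· ∈ K)) hadd hleft hright hp.1 hp.2 hε

variable {P K : Set ι}

theorem normal_patternSubgroup (hP : IsPattern b P) (hK : IsNormalIn Φ K P) :
    ((C.patternSubgroup F K).subgroupOf (C.patternSubgroup F P)).Normal := by
  have hconj : ∀ α ∈ P, ∀ s, C.patternSubgroup F K ≤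
      (C.patternSubgroup F K).comap (MulAut.conj (C.rootGL F α s)).toMonoidHom := by
    intro α hα s
    refine C.patternSubgroup_le F fun κ hκ t => ?_
    have h : (MulAut.conj (C.rootGL F α s)).toMonoidHom (C.rootGL F κ t) =
        ⁅C.rootGL F α s, C.rootGL F κ t⁆ * C.rootGL F κ t := by
      simp [commutatorElement_def]
    rw [Subgroup.mem_comap, h]
    refine mul_mem (C.commutator_rootGL_mem_patternSubgroup F (hP.1 α hα) (hP.1 κ (hK.1 hκ))
      (fun ε hε => hK.2 κ hκ α hα ε (by rw [hε, add_comm])) (fun ε ε' hε h => hK.2 ε hε α hα ε' h)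
      (fun ε ε' hε h => hK.2 ε hε κ (hK.1 hκ) ε' h) s t) (C.rootGL_mem_patternSubgroup F hκ t)
  rw [Subgroup.normal_subgroupOf_iff_le_normalizer (C.patternSubgroup_mono F hK.1)]
  refine C.patternSubgroup_le F fun α hα s => ?_
  rw [Subgroup.mem_normalizer_iff]
  refine fun u => ⟨fun hu => hconj α hα s hu, fun hu => ?_⟩
  have := hconj α hα (-s) hu
  rw [Subgroup.mem_comap, rootGL_neg] at this
  simpa [mul_assoc] using this

variable {F}

/-- The root element `x_α(t)` as an element of the pattern subgroup `X_P`. -/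
def patternElt {α : ι} (hα : α ∈ P) (t : F) : C.patternSubgroup F P :=
  ⟨C.rootGL F α t, C.rootGL_mem_patternSubgroup F hα t⟩

variable (K)

/-- The image of the root element `x_α(t)` in the quattern group `X_P / X_K`. -/
def quatternElt {α : ι} (hα : α ∈ P) : Multiplicative F →* C.QuatternGroup F P K where
  toFun t := QuotientGroup.mk (C.patternElt hα t.toAdd)
  map_one' := by
    rw [← QuotientGroup.mk_one]
    exact congrArg _ (Subtype.ext (C.rootGL_zero F α))
  map_mul' s t := by
    rw [← QuotientGroup.mk_mul]
    exact congrArg _ (Subtype.ext (C.rootGL_add F α _ _))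

lemma quatternElt_ofAdd {α : ι} (hα : α ∈ P) (t : F) :
    C.quatternElt K hα (Multiplicative.ofAdd t) = QuotientGroup.mk (C.patternElt hα t) := rfl

variable {K}

lemma patternElt_mem_iff {α : ι} (hα : α ∈ P) {A : Subgroup (C.patternSubgroup F P)} (t : F) :
    C.rootGL F α t ∈ A.map (C.patternSubgroup F P).subtype ↔ C.patternElt hα t ∈ A := by
  constructor
  · rintro ⟨v, hv, h⟩
    rwa [show C.patternElt hα t = v from Subtype.ext h.symm]
  · exact fun h => ⟨_, h, rfl⟩

/-- A subgroup of `X_P / X_K` contains the images of the elements of `X_T` if it contains the root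
elements belonging to `T`. -/
lemma mk_mem_of_quatternElt_mem {T : Set ι} (hT : T ⊆ P) {A : Subgroup (C.QuatternGroup F P K)}
    (h : ∀ α, ∀ hα : α ∈ T, ∀ t, C.quatternElt K (hT hα) t ∈ A) {u : C.patternSubgroup F P}
    (hu : (u : GL (b.support ⊕ ι) F) ∈ C.patternSubgroup F T) :
    (QuotientGroup.mk u : C.QuatternGroup F P K) ∈ A := by
  have hle : C.patternSubgroup F T ≤
      (A.comap (QuotientGroup.mk' _)).map (C.patternSubgroup F P).subtype := by
    refine C.patternSubgroup_le F fun α hα t => ?_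
    rw [C.patternElt_mem_iff (hT hα)]
    exact h α hα (Multiplicative.ofAdd t)
  obtain ⟨v, hv, h⟩ := hle hu
  rwa [show u = v from Subtype.ext h.symm]

lemma eq_top_of_quatternElt_mem {A : Subgroup (C.QuatternGroup F P K)}
    (h : ∀ α, ∀ hα : α ∈ P, ∀ t, C.quatternElt K hα t ∈ A) : A = ⊤ := by
  rw [eq_top_iff]
  rintro x -
  obtain ⟨u, rfl⟩ := QuotientGroup.mk_surjective x
  exact C.mk_mem_of_quatternElt_mem subset_rfl h u.2

omit [Φ.IsReduced] in
lemma quatternGroup_mk_eq_one_iff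
    (hN : ((C.patternSubgroup F K).subgroupOf (C.patternSubgroup F P)).Normal)
    (u : C.patternSubgroup F P) : (QuotientGroup.mk u : C.QuatternGroup F P K) = 1 ↔
      (u : GL (b.support ⊕ ι) F) ∈ C.patternSubgroup F K := by
  rw [QuotientGroup.eq_one_iff, Subgroup.normalClosure_eq_self, Subgroup.mem_subgroupOf]

omit [Φ.IsReduced] in
lemma quatternMap_mk {P' K' : Set ι} (hPP : P' ⊆ P) (hKK : K' ⊆ K) (u : C.patternSubgroup F P') :
    C.quatternMap F hPP hKK (QuotientGroup.mk u) =
      QuotientGroup.mk (Subgroup.inclusion (C.patternSubgroup_mono F hPP) u) := rfl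

lemma quatternMap_quatternElt {P' K' : Set ι} (hPP : P' ⊆ P) (hKK : K' ⊆ K) {α : ι} (hα : α ∈ P')
    (t : Multiplicative F) :
    C.quatternMap F hPP hKK (C.quatternElt K' hα t) = C.quatternElt K (hPP hα) t := rfl

/-- Root elements are central in the quattern group if sums with their root fall into `K`. -/
theorem quatternElt_mul_comm (hP : IsPattern b P) (hK : IsNormalIn Φ K P) {γ : ι} (hγ : γ ∈ P)
    (h : ∀ α ∈ P, ∀ ε, Φ.root ε = Φ.root γ + Φ.root α → ε ∈ K) (t : Multiplicative F)
    (g : C.QuatternGroup F P K) : C.quatternElt K hγ t * g = g * C.quatternElt K hγ t := by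
  have htop : Subgroup.centralizer {C.quatternElt K hγ t} = ⊤ := by
    refine C.eq_top_of_quatternElt_mem fun α hα s => ?_
    rw [Subgroup.mem_centralizer_singleton_iff]
    have hcomm := (C.quatternGroup_mk_eq_one_iff (C.normal_patternSubgroup F hP hK)
      ⁅C.patternElt hγ t.toAdd, C.patternElt hα s.toAdd⁆).2
        (C.commutator_rootGL_mem_patternSubgroup F (hP.1 γ hγ) (hP.1 α hα) (h α hα)
          (fun ε ε' hε h => hK.2 ε hε γ hγ ε' h) (fun ε ε' hε h => hK.2 ε hε α hα ε' h) _ _)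
    exact (commutatorElement_eq_one_iff_mul_comm.1 hcomm).symm
  exact (Subgroup.mem_centralizer_singleton_iff.1 (htop ▸ Subgroup.mem_top g)).symm

omit [Φ.IsReduced] in
lemma quatternMap_injective {P' : Set ι} (hPP : P' ⊆ P)
    (hN : ((C.patternSubgroup F K).subgroupOf (C.patternSubgroup F P)).Normal)
    (hN' : ((C.patternSubgroup F K).subgroupOf (C.patternSubgroup F P')).Normal) :
    Function.Injective (C.quatternMap F hPP (subset_refl K)) := by
  rw [injective_iff_map_eq_one]
  intro x hx
  obtain ⟨u, rfl⟩ := QuotientGroup.mk_surjective x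
  rw [quatternMap_mk, C.quatternGroup_mk_eq_one_iff hN, Subgroup.coe_inclusion] at hx
  exact (C.quatternGroup_mk_eq_one_iff hN' u).2 hx

omit [Φ.IsReduced] in
lemma quatternMap_surjective {K' : Set ι} (hKK : K' ⊆ K) :
    Function.Surjective (C.quatternMap F (subset_refl P) hKK) := by
  intro x
  obtain ⟨u, rfl⟩ := QuotientGroup.mk_surjective x
  exact ⟨QuotientGroup.mk u, rfl⟩

lemma quatternMap_range_normal {P' : Set ι} (hP : IsPattern b P) (hPP : IsNormalIn Φ P' P) :
    (C.quatternMap F hPP.1 (subset_refl K)).range.Normal := by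
  have hN := C.normal_patternSubgroup F hP hPP
  have hr : (C.quatternMap F hPP.1 (subset_refl K)).range =
      ((C.patternSubgroup F P').subgroupOf (C.patternSubgroup F P)).map (QuotientGroup.mk' _) := by
    ext x
    constructor
    · rintro ⟨y, rfl⟩
      obtain ⟨u, rfl⟩ := QuotientGroup.mk_surjective y
      refine ⟨Subgroup.inclusion (C.patternSubgroup_mono F hPP.1) u, ?_, ?_⟩
      · rw [SetLike.mem_coe, Subgroup.mem_subgroupOf, Subgroup.coe_inclusion]
        exact u.2
      · rw [quatternMap_mk, QuotientGroup.mk'_apply]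
    · rintro ⟨v, hv, rfl⟩
      rw [SetLike.mem_coe, Subgroup.mem_subgroupOf] at hv
      refine ⟨QuotientGroup.mk ⟨v, hv⟩, ?_⟩
      rw [quatternMap_mk, QuotientGroup.mk'_apply]
      exact congrArg _ (Subtype.ext (Subgroup.coe_inclusion _ _))
  rw [hr]
  exact hN.map _ (QuotientGroup.mk'_surjective _)

end ChevalleyBasis
end PatternGroups

/-! ### From the hypotheses on β, δ, γ to an arm and a leg -/

section ArmLegPairs

variable {ι X Y : Type*} [AddCommGroup X] [AddCommGroup Y] {Φ : RootDatum ι X Y}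

/-- In the quattern `S = P \ K`, the roots `β` and `δ` are an arm and a leg for the central root
`γ = δ + β`. -/
structure IsArmLegPair (b : Φ.Base) (P K : Set ι) (β δ γ : ι) : Prop where
  isPattern : IsPattern b P
  isNormalIn : IsNormalIn Φ K P
  arm_mem : β ∈ P \ K
  leg_mem : δ ∈ P \ K
  center_mem : γ ∈ centralRoots Φ (P \ K)
  sum_eq : Φ.root δ + Φ.root β = Φ.root γ
  add_ne_arm : ∀ α ∈ (P \ K) \ {β, δ}, ∀ α' ∈ (P \ K) \ {β, δ}, Φ.root α + Φ.root α' ≠ Φ.root β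
  leg_add_ne : ∀ α ∈ (P \ K) \ {β}, ∀ ε ∈ P \ K, Φ.root δ + Φ.root α ≠ Φ.root ε

namespace IsArmLegPair

variable {b : Φ.Base} {P K : Set ι} {β δ γ : ι} (h : IsArmLegPair b P K β δ γ)

include h

lemma arm_notMem : β ∉ K := h.arm_mem.2

lemma leg_ne_center : δ ≠ γ := fun e => Φ.ne_zero β (by simpa [e] using h.sum_eq)

/-- Otherwise γ would be twice the root δ. -/
lemma leg_ne_arm [Fintype ι] [Φ.IsReduced] : δ ≠ β := by
  rintro rfl
  have h1 := (h.isPattern.1 δ h.leg_mem.1).linearIndependent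
    (h.isPattern.1 γ h.center_mem.1.1) h.leg_ne_center
  have := LinearIndependent.pair_iff.1 h1 2 (-1) (by
    linear_combination (norm := module) h.sum_eq)
  lia

lemma ne_leg_of_mem_centralRoots {α : ι} (hα : α ∈ centralRoots Φ (P \ K)) : α ≠ δ := by
  rintro rfl
  exact hα.2 β h.arm_mem γ h.center_mem.1 h.sum_eq.symm

lemma ne_arm_of_mem_centralRoots {α : ι} (hα : α ∈ centralRoots Φ (P \ K)) : α ≠ β := by
  rintro rfl
  exact hα.2 δ h.leg_mem γ h.center_mem.1 (by rw [add_comm, h.sum_eq])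

lemma mem_sdiff_arm_of_mem_centralRoots {α : ι} (hα : α ∈ centralRoots Φ (P \ K)) :
    α ∈ P \ {β} := ⟨hα.1.1, h.ne_arm_of_mem_centralRoots hα⟩

lemma mem_of_central {α : ι} (hα : α ∈ centralRoots Φ (P \ K)) {κ : ι} (hκ : κ ∈ P) {ε : ι}
    (hε : Φ.root ε = Φ.root α + Φ.root κ) : ε ∈ K := by
  by_cases hκ' : κ ∈ K
  · exact h.isNormalIn.2 κ hκ' α hα.1.1 ε (by rw [hε, add_comm])
  · by_contra hεK
    exact hα.2 κ ⟨hκ, hκ'⟩ ε ⟨h.isPattern.2 α hα.1.1 κ hκ ε hε, hεK⟩ hε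

lemma leg_add_mem {α : ι} (hα : α ∈ P \ {β}) {ε : ι} (hε : Φ.root ε = Φ.root δ + Φ.root α) :
    ε ∈ K := by
  by_cases hα' : α ∈ K
  · exact h.isNormalIn.2 α hα' δ h.leg_mem.1 ε (by rw [hε, add_comm])
  · by_contra hεK
    exact h.leg_add_ne α ⟨⟨hα.1, hα'⟩, hα.2⟩ ε
      ⟨h.isPattern.2 δ h.leg_mem.1 α hα.1 ε hε, hεK⟩ hε.symm

/-- This makes P' normal in P. The hypothesis covers summands in S other than β and δ; a summand in
K, or equal to δ, would put β into K, and α = β would make κ the zero root. -/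
lemma add_ne_arm_of_mem {κ α : ι} (hκ : κ ∈ P \ {β}) (hα : α ∈ P) :
    Φ.root β ≠ Φ.root κ + Φ.root α := by
  intro hsum
  have hκK : κ ∉ K := fun hk => h.arm_notMem (h.isNormalIn.2 κ hk α hα β hsum)
  have hαK : α ∉ K := fun hk =>
    h.arm_notMem (h.isNormalIn.2 α hk κ hκ.1 β (by rw [hsum, add_comm]))
  have hαβ : α ≠ β := by
    rintro rfl
    exact Φ.ne_zero κ (by simpa using hsum)
  have hκδ : κ ≠ δ := by
    rintro rfl
    exact h.arm_notMem (h.leg_add_mem ⟨hα, hαβ⟩ hsum)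
  have hαδ : α ≠ δ := by
    rintro rfl
    exact h.arm_notMem (h.leg_add_mem hκ (by rw [hsum, add_comm]))
  exact h.add_ne_arm κ ⟨⟨hκ.1, hκK⟩, by simpa using ⟨hκ.2, hκδ⟩⟩ α
    ⟨⟨hα, hαK⟩, by simpa using ⟨hαβ, hαδ⟩⟩ hsum.symm

lemma sdiff_arm_isNormalIn : IsNormalIn Φ (P \ {β}) P := by
  refine ⟨Set.sdiff_subset, fun κ hκ α hα ε hε => ⟨h.isPattern.2 κ hκ.1 α hα ε hε, ?_⟩⟩
  rintro rfl
  exact h.add_ne_arm_of_mem hκ hα hε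

lemma sdiff_arm_isPattern : IsPattern b (P \ {β}) :=
  ⟨fun α hα => h.isPattern.1 α hα.1,
    fun α hα α' hα' => h.sdiff_arm_isNormalIn.2 α hα α' hα'.1⟩

lemma isNormalIn_sdiff_arm : IsNormalIn Φ K (P \ {β}) :=
  ⟨fun _ hκ => ⟨h.isNormalIn.1 hκ, fun e => h.arm_notMem (Set.mem_singleton_iff.1 e ▸ hκ)⟩,
    fun _ hκ α hα => h.isNormalIn.2 _ hκ α hα.1⟩

lemma leg_mem_sdiff_arm [Fintype ι] [Φ.IsReduced] : δ ∈ P \ {β} := ⟨h.leg_mem.1, h.leg_ne_arm⟩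

lemma union_leg_isNormalIn [Fintype ι] [Φ.IsReduced] : IsNormalIn Φ (K ∪ {δ}) (P \ {β}) := by
  refine ⟨Set.union_subset h.isNormalIn_sdiff_arm.1
    (Set.singleton_subset_iff.2 h.leg_mem_sdiff_arm), ?_⟩
  rintro _ (hκ | rfl) α hα ε hε
  · exact Or.inl (h.isNormalIn_sdiff_arm.2 _ hκ α hα ε hε)
  · exact Or.inl (h.leg_add_mem hα hε)

lemma centralRoots_subset :
    centralRoots Φ (P \ K) ⊆ centralRoots Φ ((P \ {β}) \ (K ∪ {δ})) := by
  refine fun α hα => ⟨⟨⟨hα.1.1, h.ne_arm_of_mem_centralRoots hα⟩, ?_⟩, ?_⟩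
  · rintro (hK | hδ)
    · exact hα.1.2 hK
    · exact h.ne_leg_of_mem_centralRoots hα hδ
  · exact fun κ hκ ε hε => hα.2 κ ⟨hκ.1.1, fun hK => hκ.2 (Or.inl hK)⟩ ε
      ⟨hε.1.1, fun hK => hε.2 (Or.inl hK)⟩

variable [Fintype ι] [DecidableEq ι] [Φ.IsReduced] {L : Type*} [LieRing L]
  (C : ChevalleyBasis Φ b L)

-- Every root iδ + jβ is reached from γ by adding δ or β, and since γ is central the first such
-- addition already leads into K.
omit [DecidableEq ι] in
lemma mem_of_mem_rootCone {ε : ι}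
    (hε : Φ.root ε ∈ rootCone Φ δ β {p | (1 ≤ p.1 ∧ 1 ≤ p.2) ∧ p ≠ (1, 1)}) : ε ∈ K := by
  obtain ⟨p, ⟨hp, hp1⟩, hε⟩ := hε
  have hind := (h.isPattern.1 δ h.leg_mem.1).linearIndependent
    (h.isPattern.1 β h.arm_mem.1) h.leg_ne_arm
  have hM : ε = γ ∨ ε ∈ K := by
    refine Φ.induction_of_linearIndependent hind (M := fun ε => ε = γ ∨ ε ∈ K)
      (fun ε hε => Or.inl (Φ.root.injective (hε.trans h.sum_eq))) ?_ ?_ hp.1 hp.2 hε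
    · rintro κ κ' (rfl | hκ) hκ'
      · exact Or.inr (h.mem_of_central h.center_mem h.leg_mem.1 hκ')
      · exact Or.inr (h.isNormalIn.2 κ hκ δ h.leg_mem.1 κ' hκ')
    · rintro κ κ' (rfl | hκ) hκ'
      · exact Or.inr (h.mem_of_central h.center_mem h.arm_mem.1 hκ')
      · exact Or.inr (h.isNormalIn.2 κ hκ β h.arm_mem.1 κ' hκ')
  refine hM.resolve_left ?_
  rintro rfl
  exact hp1 (smul_add_smul_injective hind (q := (1, 1)) (by
    rw [← hε, ← h.sum_eq, one_smul, one_smul]))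

variable {F : Type*} [Field F]

/-- In the commutator formula all factors but that of γ die modulo X_K; the constant is n = ±(r + 1)
with r + 1 < p. -/
lemma exists_leg_mul_arm {p : ℕ} [CharP F p] (hp : NotVeryBad Φ p) :
    ∃ n : F, n ≠ 0 ∧ ∀ s t : F,
      C.quatternElt K h.leg_mem.1 (Multiplicative.ofAdd s) *
          C.quatternElt K h.arm_mem.1 (Multiplicative.ofAdd t) =
        C.quatternElt K h.arm_mem.1 (Multiplicative.ofAdd t) *
          (C.quatternElt K h.leg_mem.1 (Multiplicative.ofAdd s) *
            C.quatternElt K h.center_mem.1.1 (Multiplicative.ofAdd (n * (s * t)))) := by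
  have hind := (h.isPattern.1 δ h.leg_mem.1).linearIndependent
    (h.isPattern.1 β h.arm_mem.1) h.leg_ne_arm
  obtain ⟨n, hn, hmem⟩ := C.exists_rootGL_mul_commutator_mem (F := F) hind h.sum_eq.symm
  have hlt := hp.chainBotCoeff_add_one_lt h.sum_eq.symm
  refine ⟨n, fun h0 => ?_, fun s t => ?_⟩
  · rw [CharP.intCast_eq_zero_iff F p] at h0
    have hdvd : (p : ℤ) ∣ (Φ.chainBotCoeff δ β + 1 : ℕ) := by
      rcases hn with rfl | rfl
      · exact_mod_cast h0
      · exact_mod_cast (dvd_neg.1 h0)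
    have := Nat.le_of_dvd (Nat.succ_pos _) (Int.natCast_dvd_natCast.1 hdvd)
    lia
  · set x := C.quatternElt K h.leg_mem.1 (Multiplicative.ofAdd s) with hx
    set y := C.quatternElt K h.arm_mem.1 (Multiplicative.ofAdd t) with hy
    set z := C.quatternElt K h.center_mem.1.1 (Multiplicative.ofAdd ((n : F) * (s * t))) with hz
    have hN := C.normal_patternSubgroup F h.isPattern h.isNormalIn
    have h1 : z⁻¹ * ⁅x, y⁆ = 1 :=
      (C.quatternGroup_mk_eq_one_iff hN ((C.patternElt h.center_mem.1.1 (n * (s * t)))⁻¹ *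
        ⁅C.patternElt h.leg_mem.1 s, C.patternElt h.arm_mem.1 t⁆)).2
          (C.patternSubgroup_mono F (fun ε hε => h.mem_of_mem_rootCone hε) (hmem s t))
    have hcomm : ∀ g, z * g = g * z := C.quatternElt_mul_comm h.isPattern h.isNormalIn
      h.center_mem.1.1 (fun α hα ε hε => h.mem_of_central h.center_mem hα hε) _
    rw [inv_mul_eq_one, commutatorElement_def] at h1
    rw [← mul_assoc, ← hcomm, h1]
    group

lemma quatternMap_eq_one_iff
    (hN : ((C.patternSubgroup F (K ∪ {δ})).subgroupOf (C.patternSubgroup F (P \ {β}))).Normal)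
    (x : C.QuatternGroup F (P \ {β}) K) :
    C.quatternMap F (subset_refl (P \ {β})) (Set.subset_union_left : K ⊆ K ∪ {δ}) x = 1 ↔
      ∃ s, C.quatternElt K h.leg_mem_sdiff_arm s = x := by
  constructor
  · intro hx
    obtain ⟨u, rfl⟩ := QuotientGroup.mk_surjective x
    rw [C.quatternMap_mk, C.quatternGroup_mk_eq_one_iff hN, Subgroup.coe_inclusion] at hx
    refine C.mk_mem_of_quatternElt_mem h.union_leg_isNormalIn.1
      (A := (C.quatternElt K h.leg_mem_sdiff_arm).range) ?_ hx
    rintro α (hα | rfl) t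
    · have : C.quatternElt K (h.isNormalIn_sdiff_arm.1 hα) t = 1 :=
        (C.quatternGroup_mk_eq_one_iff
          (C.normal_patternSubgroup F h.sdiff_arm_isPattern h.isNormalIn_sdiff_arm) _).2
          (C.rootGL_mem_patternSubgroup F hα t.toAdd)
      rw [this]
      exact one_mem _
    · exact ⟨t, rfl⟩
  · rintro ⟨s, rfl⟩
    rw [C.quatternMap_quatternElt]
    exact (C.quatternGroup_mk_eq_one_iff hN _).2
      (C.rootGL_mem_patternSubgroup F (Or.inr rfl) s.toAdd)

/-- The arm and the normal subgroup H contain all root elements, hence generate, and normality turns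
this into a product. -/
lemma exists_eq_arm_mul (g : C.QuatternGroup F P K) :
    ∃ t x, g = C.quatternElt K h.arm_mem.1 t *
      C.quatternMap F (Set.sdiff_subset : P \ {β} ⊆ P) (subset_refl K) x := by
  have hr : (C.quatternMap F (Set.sdiff_subset : P \ {β} ⊆ P) (subset_refl K)).range.Normal :=
    C.quatternMap_range_normal h.isPattern h.sdiff_arm_isNormalIn
  have htop : (C.quatternElt (F := F) K h.arm_mem.1).range ⊔
      (C.quatternMap F (Set.sdiff_subset : P \ {β} ⊆ P) (subset_refl K)).range = ⊤ := by
    refine C.eq_top_of_quatternElt_mem fun α hα t => ?_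
    by_cases e : α = β
    · subst e
      exact Subgroup.mem_sup_left ⟨t, rfl⟩
    · exact Subgroup.mem_sup_right ⟨C.quatternElt K (show α ∈ P \ {β} from ⟨hα, e⟩) t,
        C.quatternMap_quatternElt _ _ _ _⟩
  have hg : g ∈ (C.quatternElt (F := F) K h.arm_mem.1).range ⊔
      (C.quatternMap F (Set.sdiff_subset : P \ {β} ⊆ P) (subset_refl K)).range :=
    htop ▸ Subgroup.mem_top g
  obtain ⟨_, ⟨t, rfl⟩, _, ⟨x, rfl⟩, hg⟩ := Subgroup.mem_sup_of_normal_right.1 hg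
  exact ⟨t, x, hg.symm⟩

end IsArmLegPair
end ArmLegPairs

/-! ### Transfer of the abstract bijection to quattern groups -/

section Bijection

variable {ι X Y : Type*} [AddCommGroup X] [AddCommGroup Y] {Φ : RootDatum ι X Y}
  [Fintype ι] [DecidableEq ι] {b : Φ.Base} {L : Type*} [LieRing L]
  (C : ChevalleyBasis Φ b L) {F : Type*} [Field F] [Φ.IsReduced]
  {P K : Set ι} {β δ γ : ι}

lemma ChevalleyBasis.mem_IrrZ_iff {Z : Set ι} {χ : C.QuatternGroup F P K → ℂ} (hZ : Z ⊆ P) :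
    χ ∈ C.IrrZ F P K Z ↔ χ ∈ Irr (C.QuatternGroup F P K) ∧
      ∀ α ∈ Z, ∃ hα : α ∈ P, ∃ t, χ (C.quatternElt K hα t) ≠ χ 1 := by
  refine and_congr_right fun _ => forall₂_congr fun α hα => ⟨?_, ?_⟩
  · rintro ⟨u, hu, h⟩
    obtain ⟨t, ht⟩ := (C.mem_rootSubgroup F).1 hu
    refine ⟨hZ hα, Multiplicative.ofAdd t, ?_⟩
    rwa [C.quatternElt_ofAdd, show C.patternElt (hZ hα) t = u from Subtype.ext ht]
  · rintro ⟨hα, t, h⟩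
    exact ⟨C.patternElt hα t.toAdd, (C.mem_rootSubgroup F).2 ⟨_, rfl⟩, h⟩

namespace IsArmLegPair

variable (h : IsArmLegPair b P K β δ γ)

include h

/-- The arm and the leg of a quattern give an arm and a leg of the quattern group. -/
def armLeg {n : F} (hn : ∀ s t : F,
      C.quatternElt K h.leg_mem.1 (Multiplicative.ofAdd s) *
          C.quatternElt K h.arm_mem.1 (Multiplicative.ofAdd t) =
        C.quatternElt K h.arm_mem.1 (Multiplicative.ofAdd t) *
          (C.quatternElt K h.leg_mem.1 (Multiplicative.ofAdd s) *
            C.quatternElt K h.center_mem.1.1 (Multiplicative.ofAdd (n * (s * t))))) :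
    ArmLeg F (C.quatternMap F (Set.sdiff_subset : P \ {β} ⊆ P) (subset_refl K))
      (C.quatternMap F (subset_refl (P \ {β})) (Set.subset_union_left : K ⊆ K ∪ {δ})) where
  injective := C.quatternMap_injective _ (C.normal_patternSubgroup F h.isPattern h.isNormalIn)
    (C.normal_patternSubgroup F h.sdiff_arm_isPattern h.isNormalIn_sdiff_arm)
  surjective := C.quatternMap_surjective _
  leg s := C.quatternElt K h.leg_mem_sdiff_arm (Multiplicative.ofAdd s)
  -- The structure constant n is absorbed here, so that the commutator of leg and arm is exactly
  -- multiplication in F.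
  center s := C.quatternElt K (h.mem_sdiff_arm_of_mem_centralRoots h.center_mem)
    (Multiplicative.ofAdd (n * s))
  arm t := C.quatternElt K h.arm_mem.1 (Multiplicative.ofAdd t)
  leg_add s t := by rw [ofAdd_add, map_mul]
  center_add s t := by rw [mul_add, ofAdd_add, map_mul]
  arm_add s t := by rw [ofAdd_add, map_mul]
  map_eq_one x := (h.quatternMap_eq_one_iff C
    (C.normal_patternSubgroup F h.sdiff_arm_isPattern h.union_leg_isNormalIn) x).trans
      Multiplicative.ofAdd.surjective.exists
  leg_central s x := C.quatternElt_mul_comm h.sdiff_arm_isPattern h.isNormalIn_sdiff_arm _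
    (fun _ hα _ hε => h.leg_add_mem hα hε) _ x
  center_central s g := by
    rw [C.quatternMap_quatternElt]
    exact C.quatternElt_mul_comm h.isPattern h.isNormalIn _
      (fun _ hα _ hε => h.mem_of_central h.center_mem hα hε) _ g
  leg_mul_arm s t := by
    rw [C.quatternMap_quatternElt, C.quatternMap_quatternElt]
    exact hn s t
  normal x g := by
    obtain ⟨y, hy⟩ := (C.quatternMap_range_normal (F := F) (K := K) h.isPattern
      h.sdiff_arm_isNormalIn).conj_mem _ ⟨x, rfl⟩ g⁻¹
    exact ⟨y, by rw [hy]; group⟩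
  exists_eq_mul g := by
    obtain ⟨t, x, hg⟩ := h.exists_eq_arm_mul C g
    exact ⟨t.toAdd, x, hg⟩

theorem bijOn_induce_inflate [Finite F] {p : ℕ} [CharP F p] (hp : NotVeryBad Φ p) (Z : Set ι)
    (hZ : Z ⊆ centralRoots Φ (P \ K)) (hγ : γ ∈ Z) :
    Set.BijOn
      (fun χ : C.QuatternGroup F (P \ {β}) (K ∪ {δ}) → ℂ =>
        induce (C.quatternMap F (Set.sdiff_subset : P \ {β} ⊆ P) (subset_refl K))
          (inflate
            (C.quatternMap F (subset_refl (P \ {β})) (Set.subset_union_left : K ⊆ K ∪ {δ})) χ))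
      (C.IrrZ F (P \ {β}) (K ∪ {δ}) Z) (C.IrrZ F P K Z) := by
  obtain ⟨n, hn0, hn⟩ := h.exists_leg_mul_arm C (F := F) hp
  have hbij := (h.armLeg C hn).bijOn_induce_inflate Z
    (fun α => {x | ∃ hα : α ∈ P \ {β}, ∃ t, C.quatternElt K hα t = x}) ?_ hγ ?_
  · convert hbij using 1
    · ext χ
      rw [C.mem_IrrZ_iff fun α hα => h.mem_sdiff_arm_of_mem_centralRoots (hZ hα)]
      refine and_congr_right fun _ => forall₂_congr fun α hα => ⟨?_, ?_⟩
      · rintro ⟨hα, t, ht⟩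
        exact ⟨_, ⟨hα, t, rfl⟩, by rwa [C.quatternMap_quatternElt]⟩
      · rintro ⟨_, ⟨hα, t, rfl⟩, ht⟩
        rw [C.quatternMap_quatternElt] at ht
        exact ⟨hα, t, ht⟩
    · ext χ
      rw [C.mem_IrrZ_iff fun α hα => (hZ hα).1.1]
      refine and_congr_right fun _ => forall₂_congr fun α hα => ⟨?_, ?_⟩
      · rintro ⟨_, t, ht⟩
        exact ⟨_, ⟨h.mem_sdiff_arm_of_mem_centralRoots (hZ hα), t, rfl⟩,
          by rwa [C.quatternMap_quatternElt]⟩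
      · rintro ⟨_, ⟨hα, t, rfl⟩, ht⟩
        rw [C.quatternMap_quatternElt] at ht
        exact ⟨hα.1, t, ht⟩
  · rintro α hα _ ⟨hα', t, rfl⟩ g
    rw [C.quatternMap_quatternElt]
    exact C.quatternElt_mul_comm h.isPattern h.isNormalIn _
      (fun _ hκ _ hε => h.mem_of_central (hZ hα) hκ hε) t g
  · rintro _ ⟨hγ', t, rfl⟩
    -- Here invertibility of n enters: the rescaled parametrisation still exhausts the image of X_γ.
    exact ⟨n⁻¹ * t.toAdd, by
      change C.quatternElt K _ (Multiplicative.ofAdd (n * (n⁻¹ * t.toAdd))) = _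
      rw [mul_inv_cancel_left₀ hn0, ofAdd_toAdd]⟩

end IsArmLegPair
end Bijection

end

theorem lemma3p1
    {ι X Y : Type*} [AddCommGroup X] [AddCommGroup Y] [Module.Finite ℤ X] [Module.Finite ℤ Y]
    [Fintype ι] [DecidableEq ι]
    (Φ : RootDatum ι X Y) [Φ.IsReduced] (b : Φ.Base)
    {L : Type*} [LieRing L] (C : ChevalleyBasis Φ b L)
    (p : ℕ) [Fact p.Prime] (hp : NotVeryBad Φ p)
    (F : Type*) [Field F] [Finite F] [CharP F p]
    (P K : Set ι) (hP : IsPattern b P) (hK : IsNormalIn Φ K P)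
    (Z : Set ι) (hZ : Z ⊆ centralRoots Φ (P \ K))
    (β δ γ : ι) (hβ : β ∈ P \ K) (hδ : δ ∈ P \ K) (hγ : γ ∈ Z)
    (hsum : Φ.root δ + Φ.root β = Φ.root γ)
    (hβsum : ∀ α ∈ (P \ K) \ {β, δ}, ∀ α' ∈ (P \ K) \ {β, δ},
      Φ.root α + Φ.root α' ≠ Φ.root β)
    (hδsum : ∀ α ∈ (P \ K) \ {β}, ∀ ε ∈ P \ K, Φ.root δ + Φ.root α ≠ Φ.root ε) :
    -- `P' = P \ {β}` is closed, `K' = K ∪ {δ}` is normal in it, and `S' = S \ {β, δ}`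
    IsPattern b (P \ {β}) ∧ IsNormalIn Φ (K ∪ {δ}) (P \ {β}) ∧
    (P \ {β}) \ (K ∪ {δ}) = (P \ K) \ {β, δ} ∧
    Z ⊆ centralRoots Φ ((P \ {β}) \ (K ∪ {δ})) ∧
    -- the groups `X_S = X_P / X_K`, `X_{P'} / X_K` and `X_{S'} = X_{P'} / X_{K'}`
    ((C.patternSubgroup F K).subgroupOf (C.patternSubgroup F P)).Normal ∧
    ((C.patternSubgroup F K).subgroupOf (C.patternSubgroup F (P \ {β}))).Normal ∧
    ((C.patternSubgroup F (K ∪ {δ})).subgroupOf (C.patternSubgroup F (P \ {β}))).Normal ∧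
    -- `χ ↦ Ind^β Inf_δ χ` is a bijection from `Irr(X_{S'})_Z` to `Irr(X_S)_Z`
    Set.BijOn
      (fun χ : C.QuatternGroup F (P \ {β}) (K ∪ {δ}) → ℂ =>
        induce (C.quatternMap F (Set.sdiff_subset : P \ {β} ⊆ P) (subset_refl K))
          (inflate
            (C.quatternMap F (subset_refl (P \ {β})) (Set.subset_union_left : K ⊆ K ∪ {δ})) χ))
      (C.IrrZ F (P \ {β}) (K ∪ {δ}) Z) (C.IrrZ F P K Z) := by
  have h : IsArmLegPair b P K β δ γ := ⟨hP, hK, hβ, hδ, hZ hγ, hsum, hβsum, hδsum⟩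
  have hN := C.normal_patternSubgroup F hP hK
  have hN' := C.normal_patternSubgroup F h.sdiff_arm_isPattern h.isNormalIn_sdiff_arm
  have hN'' := C.normal_patternSubgroup F h.sdiff_arm_isPattern h.union_leg_isNormalIn
  refine ⟨h.sdiff_arm_isPattern, h.union_leg_isNormalIn, ?_, hZ.trans h.centralRoots_subset, hN,
    hN', hN'', ?_⟩
  · ext α
    simp only [Set.mem_sdiff, Set.mem_union, Set.mem_insert_iff, Set.mem_singleton_iff]
    tauto
  · exact h.bijOn_induce_inflate C hp Z hZ hγ
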